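/- Let $Y_n$ ($n\ge 1$) be the number of key exchanges made by Hoare's Quickselect (FIND) when it acts on a uniformly random permutation of $\{1,\dots,n\}$ stored in $A[1..n]$ and selects a rank that is uniform on $\{1,\dots,n\}$ and independent of the permutation. Here a list $A[p..r]$ with $p<r$ is partitioned by Hoare's procedure as follows. Put $x=A[p]$, $i=p-1$, $j=r+1$ and repeat: decrease $j$ (at least once) until $A[j]\le x$, increase $i$ (at least once) until $A[i]\ge x$; if $i<j$, exchange $A[i]$ and $A[j]$ (one key exchange) and continue, otherwise stop. The algorithm then continues in the same way with whichever of the sub-lists $A[p..j]$, $A[j+1..r]$ contains the element sought, until the list has size one. Let $U$ be uniformly distributed on $[0,1]$. Then there is exactly one probability distribution $\mathcal L(X)$ on $\mathbb R$ such that, with $X$ and $U$ independent, $$X\stackrel{d}{=}\sqrt U\,X+\sqrt U\,(1-\sqrt U).$$ This distribution has a Lebesgue density $f$, its essential supremum $\|f\|_\infty$ is finite, and for all $0<\varepsilon\le \frac14$ and all $n\ge 1$ $$d_{\mathrm{KS}}\Big(\frac{Y_n}{n},X\Big)\le \omega_\varepsilon\, n^{-\frac12+\varepsilon},\qquad \omega_\varepsilon:=\Big(\frac1{2\varepsilon}\Big)^{2\varepsilon}\Big\{\|f\|_\infty\,\kappa_{-1+1/(2\varepsilon)}\Big\}^{1-2\varepsilon},$$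 where $d_{\mathrm{KS}}(W,Z):=\sup_{x\in\mathbb R}|\mathbb P(W\le x)-\mathbb P(Z\le x)|$ and, for $1\le p<\infty$, with Euler's gamma function $\Gamma$, $$\kappa_p:=\frac{2p+3}{2p-1}(7+\tau_p),\qquad \tau_p:=\Big(\frac12+\frac{\Gamma(\frac p2+1)}{2^{\frac p2+1}}\Big)^{\frac1p}.$$ -/

import Mathlib

open MeasureTheory Set

/-! ### Hoare's partitioning procedure and Quickselect

An array is a function `A : ℕ → ℕ`, of which the entries at the positions `p, …, r` are used. -/

/-- The downward scan "repeat `j ← j - 1` until `A[j] ≤ x`", started at `j`; the value is the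
position where it stops (`0` if it meets no such entry). -/
def scanDown (A : ℕ → ℕ) (x : ℕ) : ℕ → ℕ
  | 0 => 0
  | j + 1 => if A j ≤ x then j else scanDown A x j

/-- The upward scan "repeat `i ← i + 1` until `A[i] ≥ x`", started at `i`; the value is the
position where it stops. The scan is cut off at the right end `r` of the list (it always stops
by itself before that in the procedure below). -/
def scanUp (r : ℕ) (A : ℕ → ℕ) (x : ℕ) (i : ℕ) : ℕ :=
  if i < r then
    if x ≤ A (i + 1) then i + 1 else scanUp r A x (i + 1)
  else i
termination_by r - i

/-- Interchanging the entries at the positions `i` and `j`. -/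
def exchange (A : ℕ → ℕ) (i j : ℕ) : ℕ → ℕ := fun k => A (Equiv.swap i j k)

theorem scanDown_lt (A : ℕ → ℕ) (x : ℕ) : ∀ j, 0 < j → scanDown A x j < j
  | 0, h => absurd h (lt_irrefl 0)
  | 1, _ => by
    unfold scanDown
    split_ifs
    · exact Nat.zero_lt_one
    · simp [scanDown]
  | j + 2, _ => by
    unfold scanDown
    split_ifs
    · exact Nat.lt_succ_self _
    · exact (scanDown_lt A x (j + 1) (Nat.succ_pos j)).trans (Nat.lt_succ_self _)

theorem scanDown_decreasing (A : ℕ → ℕ) (x i j : ℕ) (h : i < scanDown A x j) :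
    scanDown A x j < j := by
  rcases Nat.eq_zero_or_pos j with rfl | hj
  · exact absurd h (Nat.not_lt_zero _)
  · exact scanDown_lt A x j hj

/-- The loop of the partitioning procedure with pivot value `x` and current indices `i`, `j`;
`t` counts the key exchanges made so far. Both scans are performed; if afterwards `i < j`, the two
entries are exchanged and the loop continues, otherwise it stops. The value consists of the
rearranged array, the final index `j`, and the number of key exchanges. -/
def partitionLoop (r x : ℕ) (A : ℕ → ℕ) (i j t : ℕ) : (ℕ → ℕ) × ℕ × ℕ :=
  if scanUp r A x i < scanDown A x j then
    partitionLoop r x (exchange A (scanUp r A x i) (scanDown A x j))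
      (scanUp r A x i) (scanDown A x j) (t + 1)
  else (A, scanDown A x j, t)
termination_by j
decreasing_by exact scanDown_decreasing A x _ j ‹_›

/-- Hoare's partitioning of the list `A[p..r]`: the pivot is the first entry `A[p]`, and the
indices start at `i = p - 1` and `j = r + 1`. With `q` the returned index, the left sub-list is
`A[p..q]` and the right sub-list is `A[q+1..r]`. -/
def hoarePartition (A : ℕ → ℕ) (p r : ℕ) : (ℕ → ℕ) × ℕ × ℕ :=
  partitionLoop r (A p) A (p - 1) (r + 1) 0

theorem le_scanDown (A : ℕ → ℕ) (x p : ℕ) (hA : A p ≤ x) : ∀ j, p < j → p ≤ scanDown A x j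
  | 0, h => absurd h (Nat.not_lt_zero _)
  | j + 1, h => by
    unfold scanDown
    split_ifs with h1
    · exact Nat.lt_succ_iff.mp h
    · refine le_scanDown A x p hA j (lt_of_le_of_ne (Nat.lt_succ_iff.mp h) ?_)
      rintro rfl
      exact h1 hA

theorem scanDown_spec (A : ℕ → ℕ) (x p : ℕ) (hA : A p ≤ x) :
    ∀ j, p < j → A (scanDown A x j) ≤ x
  | 0, h => absurd h (Nat.not_lt_zero _)
  | j + 1, h => by
    unfold scanDown
    split_ifs with h1
    · exact h1
    · refine scanDown_spec A x p hA j (lt_of_le_of_ne (Nat.lt_succ_iff.mp h) ?_)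
      rintro rfl
      exact h1 hA

theorem le_scanUp (r : ℕ) (A : ℕ → ℕ) (x i : ℕ) : i ≤ scanUp r A x i := by
  fun_induction scanUp r A x i <;> omega

theorem partitionLoop_bounds (p r x : ℕ) (A : ℕ → ℕ) (i j t : ℕ) (hA : A p ≤ x) (hj : p < j)
    (hi : p ≤ i) :
    p ≤ (partitionLoop r x A i j t).2.1 ∧ (partitionLoop r x A i j t).2.1 < j := by
  fun_induction partitionLoop r x A i j t with
  | case1 A i j t h ih =>
    have h1 := le_scanUp r A x i
    have h2 := scanDown_lt A x j (by omega)
    have h3 := scanDown_spec A x p hA j hj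
    have := ih (by
      unfold exchange
      by_cases hp : p = scanUp r A x i
      · rw [← hp, Equiv.swap_apply_left]
        exact h3
      · rw [Equiv.swap_apply_of_ne_of_ne hp (by omega)]
        exact hA) (by omega) (by omega)
    omega
  | case2 A i j t h =>
    exact ⟨le_scanDown A x p hA j hj, scanDown_lt A x j (by omega)⟩

/-- Both sub-lists are non-empty. -/
theorem hoarePartition_bounds (A : ℕ → ℕ) (p r : ℕ) (hp : 1 ≤ p) (h : p < r) :
    p ≤ (hoarePartition A p r).2.1 ∧ (hoarePartition A p r).2.1 < r := by
  have hu : scanUp r A (A p) (p - 1) = p := by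
    unfold scanUp
    have : p - 1 + 1 = p := by omega
    simp [this]
    omega
  have h1 := le_scanDown A (A p) p le_rfl (r + 1) (by omega)
  have h2 := scanDown_lt A (A p) (r + 1) (by omega)
  have h3 := scanDown_spec A (A p) p le_rfl (r + 1) (by omega)
  unfold hoarePartition
  rw [partitionLoop, hu]
  split_ifs with hlt
  · have := partitionLoop_bounds p r (A p) (exchange A p (scanDown A (A p) (r + 1))) p
      (scanDown A (A p) (r + 1)) (0 + 1)
      (by unfold exchange; rw [Equiv.swap_apply_left]; exact h3) hlt le_rfl
    omega
  · dsimp only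
    omega

/-- The number of key exchanges made by Quickselect when it selects the entry of rank `k` in the
list `A[p..r]` (positions are counted from `1`): a list with at least two entries is partitioned,
and the algorithm continues with the sub-list that contains the entry sought. -/
def quickselectExchanges (A : ℕ → ℕ) (p r k : ℕ) : ℕ :=
  if h : 1 ≤ p ∧ p < r then
    (hoarePartition A p r).2.2 +
      if k ≤ (hoarePartition A p r).2.1 - p + 1 then
        quickselectExchanges (hoarePartition A p r).1 p (hoarePartition A p r).2.1 k
      else
        quickselectExchanges (hoarePartition A p r).1 ((hoarePartition A p r).2.1 + 1) r
          (k - ((hoarePartition A p r).2.1 - p + 1))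
  else 0
termination_by r - p
decreasing_by
  all_goals
    have := hoarePartition_bounds A p r h.1 h.2
    omega

/-- The array of length `n` with entries `σ(1), …, σ(n)` at the positions `1, …, n`
(`Fin n` counts from `0`). -/
def permArray {n : ℕ} (σ : Equiv.Perm (Fin n)) (k : ℕ) : ℕ :=
  if h : 1 ≤ k ∧ k ≤ n then (σ ⟨k - 1, by omega⟩ : ℕ) + 1 else 0

/-- The number `Y_n` of key exchanges, as a function of the permutation and of the rank; the
element `R` of `Fin n` stands for the rank `R + 1`. -/
def keyExchanges {n : ℕ} (ω : Equiv.Perm (Fin n) × Fin n) : ℕ :=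
  quickselectExchanges (permArray ω.1) 1 n ((ω.2 : ℕ) + 1)

noncomputable section

/-- The law of `Y_n / n` for a uniformly random permutation and an independent uniform rank. -/
def normalizedLaw (n : ℕ) [NeZero n] : Measure ℝ :=
  ((PMF.uniformOfFintype (Equiv.Perm (Fin n) × Fin n)).map
    (fun ω => (keyExchanges ω : ℝ) / n)).toMeasure

/-! ### The limit law and the metric -/

/-- `μ` is the law of a real random variable `X` such that `X` and `√U X + √U (1 - √U)` have the
same law, where `U` is uniform on `[0,1]` and independent of `X`. -/
def SolvesRDE (μ : Measure ℝ) : Prop :=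
  IsProbabilityMeasure μ ∧
    ((volume.restrict (Icc (0 : ℝ) 1)).prod μ).map
      (fun z : ℝ × ℝ => √z.1 * z.2 + √z.1 * (1 - √z.1)) = μ

/-- `f` is a Lebesgue density of `μ`. -/
def IsLebesgueDensity (μ : Measure ℝ) (f : ℝ → ℝ) : Prop :=
  Measurable f ∧ (∀ x, 0 ≤ f x) ∧ μ = volume.withDensity (fun x => ENNReal.ofReal (f x))

/-- The Kolmogorov–Smirnov distance of two probability measures on the real line. -/
def dKS (μ ν : Measure ℝ) : ℝ := ⨆ x : ℝ, |μ.real (Iic x) - ν.real (Iic x)|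

/-! ### The constants -/

/-- `τ_p = (1/2 + Γ(p/2 + 1) / 2^(p/2 + 1))^(1/p)`. -/
def tauConst (p : ℝ) : ℝ :=
  (1 / 2 + Real.Gamma (p / 2 + 1) / (2 : ℝ) ^ (p / 2 + 1)) ^ (1 / p)

/-- `κ_p = (2p + 3) / (2p - 1) * (7 + τ_p)`. -/
def kappaConst (p : ℝ) : ℝ := (2 * p + 3) / (2 * p - 1) * (7 + tauConst p)

/-- `ω_ε = (1/(2ε))^(2ε) * (M κ_{-1 + 1/(2ε)})^(1 - 2ε)`, to be used with `M = ‖f‖_∞`. -/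
def omegaConst (M ε : ℝ) : ℝ :=
  (1 / (2 * ε)) ^ (2 * ε) * (M * kappaConst (-1 + 1 / (2 * ε))) ^ (1 - 2 * ε)

end

/-!
Write `Y` for the number of exchanges in a list of length `m` and `X` for the limit variable. The
law of `Y` satisfies a recursion in which the list is replaced by one of its two sub-lists, and
`X` satisfies the continuous counterpart `X = √U X + √U (1 - √U)` of this recursion: the length of
the sub-list in which the search continues is close to `m √U`, and the number of exchanges in one
partitioning, a hypergeometric random variable, is concentrated around `m √U (1 - √U)`.

*Structure of the sub-lists.* The sub-lists are not quite in random order: the right one contains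
the pivot, which is its minimum, at a special position. The class of lists in random order, given
the position of the minimum, is stable under Hoare's partitioning (`permAverage_sublist_le`),
because the procedure only compares entries with the pivot and so commutes with all relabellings
of the entries on one side of the pivot (`hoarePartition_comp`).

*Transport bound.* For `|y| ≤ 13 / 25`, the two laws admit a coupling with
`E exp (y (Y - m X)) ≤ exp (y² m / 8 + 6 |y| √m)`. This is stated and proved in dual form
(`IsDualBound`, `isDualBound_costBound`), which avoids the construction of couplings, by induction
on the length. In each step, Hoeffding's inequality for sampling without replacement
(`permAverage_exp_card_le`) bounds the exponential moment of the number of exchanges with variance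
proxy `i / 4`, where `i` is the length of the sub-list that is discarded, so that the variance
proxies of all steps add up to at most `m / 4`. The error made in replacing lengths by `m √U` is
paid for by the term `6 √m` (`shift_le`, `shift_le_of_min`, `sum_weights_exp_le_one`).

*Kolmogorov–Smirnov distance.* Let `M` be the essential supremum of the density and `K = M / √n`.
By Markov's inequality with `y = ± 4 t / √n`, the distance `δ` satisfies
`δ ≤ K (6 + t) + exp (-2 t²)` for `0 ≤ t ≤ 13 √n / 100` (`dKS_le_add_exp`). Integrating this
inequality against `p t ^ (p - 1)`, where `2 ε = 1 / (p + 1)`, turns the exponential tail into its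
moment of order `p`, which is at most `2 τ_p ^ p` (`le_rate_of_tail_bound`).

*The limit law.* A solution is given by the series that results from iterating the equation
(`exists_solvesRDE`). It is unique, since the difference `Δ` of the characteristic functions of
two solutions satisfies `|Δ(t)| ≤ E |Δ(t √U)|` (`SolvesRDE.unique`). Given `X = x`, the variable
`√U x + √U (1 - √U)` has a density with a square root singularity at its maximum `(1 + x)² / 4`.
This gives `P(X ∈ I) = O(|I| ^ (1 / 2))` for all intervals `I`; moreover, a bound of this kind
makes moments of negative order finite, which improves the exponent, in three rounds to `1 / 2`,
`5 / 6` and `1` (`SolvesRDE.exists_measure_Ioc_le`). Hence the law has a bounded density.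
-/

/-! ### Hoare's partitioning procedure -/

theorem scanDown_eq_of_forall_iff {A B : ℕ → ℕ} {x : ℕ} (h : ∀ l, B l ≤ x ↔ A l ≤ x) :
    ∀ j, scanDown B x j = scanDown A x j
  | 0 => rfl
  | j + 1 => by
    unfold scanDown
    rw [scanDown_eq_of_forall_iff h j]
    simp only [h j]

theorem scanUp_eq_of_forall_iff {A B : ℕ → ℕ} {x : ℕ} (r : ℕ) (h : ∀ l, x ≤ B l ↔ x ≤ A l)
    (i : ℕ) : scanUp r B x i = scanUp r A x i := by
  fun_induction scanUp r A x i with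
  | case1 i h1 h2 => rw [scanUp, if_pos h1, if_pos ((h _).2 h2)]
  | case2 i h1 h2 ih => rw [scanUp, if_pos h1, if_neg (fun h3 => h2 ((h _).1 h3)), ih]
  | case3 i h1 => rw [scanUp, if_neg h1]

/-- The partitioning procedure only compares entries with the pivot, so it commutes with every
relabelling `g` of the entries that preserves these comparisons. -/
theorem partitionLoop_comp (r x : ℕ) (A : ℕ → ℕ) (i j t : ℕ) (g : ℕ → ℕ)
    (h1 : ∀ v, g v ≤ x ↔ v ≤ x) (h2 : ∀ v, x ≤ g v ↔ x ≤ v) :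
    partitionLoop r x (fun l => g (A l)) i j t =
      (fun l => g ((partitionLoop r x A i j t).1 l), (partitionLoop r x A i j t).2) := by
  have hd : ∀ B : ℕ → ℕ, ∀ j, scanDown (fun l => g (B l)) x j = scanDown B x j := fun B =>
    scanDown_eq_of_forall_iff fun l => h1 _
  have hu : ∀ B : ℕ → ℕ, ∀ i, scanUp r (fun l => g (B l)) x i = scanUp r B x i := fun B =>
    scanUp_eq_of_forall_iff r fun l => h2 _
  fun_induction partitionLoop r x A i j t with
  | case1 A i j t h ih =>
    rw [partitionLoop, hu, hd, if_pos h]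
    exact ih
  | case2 A i j t h =>
    rw [partitionLoop, hu, hd, if_neg h]

theorem scanDown_gt (A : ℕ → ℕ) (x : ℕ) : ∀ j l, scanDown A x j < l → l < j → x < A l
  | 0, l, _, h => absurd h (Nat.not_lt_zero _)
  | j + 1, l, h, hl => by
    unfold scanDown at h
    split_ifs at h with h1
    · omega
    · rcases Nat.lt_succ_iff_lt_or_eq.mp hl with h2 | rfl
      · exact scanDown_gt A x j l h h2
      · omega

theorem scanUp_lt (r : ℕ) (A : ℕ → ℕ) (x i : ℕ) :
    ∀ l, i < l → l < scanUp r A x i → A l < x := by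
  fun_induction scanUp r A x i with
  | case1 i h1 h2 => intro l h3 h4; omega
  | case2 i h1 h2 ih =>
    intro l h3 h4
    rcases Nat.lt_or_ge (i + 1) l with h | h
    · exact ih l h h4
    · obtain rfl : l = i + 1 := by omega
      omega
  | case3 i h1 => intro l h3 h4; omega

theorem scanUp_spec (r : ℕ) (A : ℕ → ℕ) (x i j : ℕ) (hj : x ≤ A j) (hij : i < j) (hjr : j ≤ r) :
    x ≤ A (scanUp r A x i) ∧ i < scanUp r A x i ∧ scanUp r A x i ≤ j := by
  fun_induction scanUp r A x i with
  | case1 i h1 h2 => exact ⟨h2, by omega, by omega⟩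
  | case2 i h1 h2 ih =>
    have : i + 1 ≠ j := by rintro rfl; exact h2 hj
    have := ih (by omega)
    exact ⟨this.1, by omega, this.2.2⟩
  | case3 i h1 => omega

/-- The loop invariant: once the entries at the positions up to `i` are smaller than the pivot value
and those from `j` on are at least as large, the procedure rearranges the list so that
the smaller entries come first, and the number of further exchanges is the number of entries that
are not smaller than the pivot value but stand in the left sub-list. -/
theorem partitionLoop_spec (p r x : ℕ) (A : ℕ → ℕ) (i j t : ℕ) (hpi : p ≤ i) (hij : i < j)
    (hjr : j ≤ r) (hlo : ∀ l, p ≤ l → l ≤ i → A l < x) (hhi : ∀ l, j ≤ l → l ≤ r → x ≤ A l)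
    (hx : ∀ l, i < l → l < j → A l ≠ x) :
    ∃ π : Equiv.Perm ℕ, (partitionLoop r x A i j t).1 = (fun l => A (π l)) ∧
      (∀ l, π l ≠ l → p ≤ l ∧ l ≤ r) ∧
      i ≤ (partitionLoop r x A i j t).2.1 ∧ (partitionLoop r x A i j t).2.1 < j ∧
      (∀ l, p ≤ l → l ≤ (partitionLoop r x A i j t).2.1 → A (π l) < x) ∧
      (∀ l, (partitionLoop r x A i j t).2.1 < l → l ≤ r → x ≤ A (π l)) ∧
      (partitionLoop r x A i j t).2.2 = t +
        ((Finset.Icc p (partitionLoop r x A i j t).2.1).filter fun l => x ≤ A l).card := by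
  fun_induction partitionLoop r x A i j t with
  | case1 A i j t h ih =>
    obtain ⟨hu1, hu2, hu3⟩ := scanUp_spec r A x i j (hhi j le_rfl hjr) hij hjr
    have hd1 := scanDown_spec A x i (hlo i hpi le_rfl).le j hij
    have hd2 := le_scanDown A x i (hlo i hpi le_rfl).le j hij
    have hd3 := scanDown_lt A x j (by omega)
    have hd4 := scanDown_gt A x j
    have hu4 := scanUp_lt r A x i
    generalize scanUp r A x i = u at *
    generalize scanDown A x j = d at *
    have hdx : A d < x := lt_of_le_of_ne hd1 (hx d (by omega) hd3)
    have hux : x < A u := lt_of_le_of_ne hu1 (hx u hu2 (by omega)).symm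
    have eu : exchange A u d u = A d := by simp [exchange]
    have ed : exchange A u d d = A u := by simp [exchange]
    have eo : ∀ l, l ≠ u → l ≠ d → exchange A u d l = A l := fun l h1 h2 => by
      simp [exchange, Equiv.swap_apply_of_ne_of_ne h1 h2]
    obtain ⟨π, e1, e2, e3, e4, e5, e6, e7⟩ := ih (by omega) h (by omega)
      (fun l h1 h2 => by
        rcases eq_or_ne l u with rfl | hl
        · rw [eu]; exact hdx
        · rw [eo l hl (by omega)]
          rcases Nat.lt_or_ge i l with h3 | h3
          · exact hu4 l h3 (by omega)
          · exact hlo l h1 h3)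
      (fun l h1 h2 => by
        rcases eq_or_ne l d with rfl | hl
        · rw [ed]; exact hux.le
        · rw [eo l (by omega) hl]
          rcases Nat.lt_or_ge l j with h3 | h3
          · exact (hd4 l (by omega) h3).le
          · exact hhi l h3 h2)
      (fun l h1 h2 => by
        rw [eo l (by omega) (by omega)]
        exact hx l (by omega) (by omega))
    refine ⟨π.trans (Equiv.swap u d), ?_, ?_, by omega, by omega, e5, e6, ?_⟩
    · rw [e1]; rfl
    · intro l hl
      by_contra hcon
      have h1 : π l = l := by by_contra h2; exact hcon (e2 l h2)
      apply hl
      simp only [Equiv.trans_apply, h1]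
      exact Equiv.swap_apply_of_ne_of_ne (by omega) (by omega)
    · rw [e7]
      generalize (partitionLoop r x (exchange A u d) u d (t + 1)).2.1 = q at *
      have : (Finset.Icc p q).filter (fun l => x ≤ A l) =
          insert u ((Finset.Icc p q).filter fun l => x ≤ exchange A u d l) := by
        ext l
        simp only [Finset.mem_filter, Finset.mem_Icc, Finset.mem_insert]
        constructor
        · rintro ⟨h1, h2⟩
          rcases eq_or_ne l u with rfl | hl
          · exact Or.inl rfl
          · rw [eo l hl (by omega)]; exact Or.inr ⟨h1, h2⟩
        · rintro (rfl | ⟨h1, h2⟩)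
          · exact ⟨by omega, hu1⟩
          · refine ⟨h1, ?_⟩
            rcases eq_or_ne l u with rfl | hl
            · exact hu1
            · rwa [eo l hl (by omega)] at h2
      rw [this, Finset.card_insert_of_notMem]
      · omega
      · simp only [Finset.mem_filter, eu]
        rintro ⟨-, h1⟩
        omega
  | case2 A i j t h =>
    obtain ⟨hu1, hu2, hu3⟩ := scanUp_spec r A x i j (hhi j le_rfl hjr) hij hjr
    have hd2 := le_scanDown A x i (hlo i hpi le_rfl).le j hij
    have hd3 := scanDown_lt A x j (by omega)
    have hd4 := scanDown_gt A x j
    have hu4 := scanUp_lt r A x i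
    have hlt : ∀ l, p ≤ l → l ≤ scanDown A x j → A l < x := fun l h1 h2 => by
      rcases Nat.lt_or_ge i l with h3 | h3
      · have : l ≠ scanUp r A x i → A l < x := fun h4 => hu4 l h3 (by omega)
        rcases eq_or_ne l (scanUp r A x i) with h4 | h4
        · have h5 := scanDown_spec A x i (hlo i hpi le_rfl).le j hij
          have h6 : l = scanDown A x j := by omega
          rw [← h6] at h5
          exact lt_of_le_of_ne h5 (hx l h3 (by omega))
        · exact this h4
      · exact hlo l h1 h3
    refine ⟨1, rfl, by simp, hd2, hd3, hlt, fun l h1 h2 => ?_, ?_⟩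
    · rcases Nat.lt_or_ge l j with h3 | h3
      · exact (hd4 l h1 h3).le
      · exact hhi l h3 h2
    · rw [Finset.card_eq_zero.2, add_zero]
      rw [Finset.filter_eq_empty_iff]
      intro l hl
      rw [Finset.mem_Icc] at hl
      exact not_le.2 (hlt l hl.1 hl.2)

/-- The first upward scan stops at once, at the pivot. -/
theorem scanUp_pred (A : ℕ → ℕ) {p r : ℕ} (hp : 1 ≤ p) (h : p ≤ r) :
    scanUp r A (A p) (p - 1) = p := by
  unfold scanUp
  have : p - 1 + 1 = p := by omega
  simp [this]
  omega

/-- Relabelling entries on either side of the pivot commutes with the partitioning, which therefore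
leaves the two sub-lists in random order. -/
theorem hoarePartition_comp (A : ℕ → ℕ) (p r : ℕ) (g : ℕ → ℕ)
    (h1 : ∀ v, g v ≤ A p ↔ v ≤ A p) (h2 : ∀ v, A p ≤ g v ↔ A p ≤ v) :
    hoarePartition (fun l => g (A l)) p r =
      (fun l => g ((hoarePartition A p r).1 l), (hoarePartition A p r).2) := by
  unfold hoarePartition
  have : g (A p) = A p := le_antisymm ((h1 _).2 le_rfl) ((h2 _).2 le_rfl)
  change partitionLoop r (g (A p)) (fun l => g (A l)) (p - 1) (r + 1) 0 = _
  rw [this]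
  exact partitionLoop_comp r (A p) A _ _ _ g h1 h2

/-- If the pivot is the minimum of the list, then nothing is exchanged, and the left sub-list
consists of the pivot. -/
theorem hoarePartition_of_min (A : ℕ → ℕ) (p r : ℕ) (hp : 1 ≤ p) (hpr : p ≤ r)
    (hmin : ∀ l, p < l → l ≤ r → A p < A l) : hoarePartition A p r = (A, p, 0) := by
  have hu := scanUp_pred A hp hpr
  have hd : scanDown A (A p) (r + 1) = p := by
    have h1 := le_scanDown A (A p) p le_rfl (r + 1) (by omega)
    have h2 := scanDown_lt A (A p) (r + 1) (by omega)
    have h3 := scanDown_spec A (A p) p le_rfl (r + 1) (by omega)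
    rcases h1.lt_or_eq with h4 | h4
    · exact absurd (hmin _ h4 (by omega)) (not_lt.2 h3)
    · exact h4.symm
  unfold hoarePartition
  rw [partitionLoop, hu, hd, if_neg (lt_irrefl p)]

/-- If the pivot is not the minimum of the list, then the left sub-list consists of the entries
smaller than the pivot, and the number of exchanges is the number of positions of the left sub-list
which were occupied by other entries. -/
theorem hoarePartition_spec (A : ℕ → ℕ) (p r : ℕ) (hp : 1 ≤ p) (hA : InjOn A (Icc p r))
    (hmin : ∃ l, p < l ∧ l ≤ r ∧ A l < A p) :
    ∃ π : Equiv.Perm ℕ, (hoarePartition A p r).1 = (fun l => A (π l)) ∧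
      (∀ l, π l ≠ l → p ≤ l ∧ l ≤ r) ∧
      p ≤ (hoarePartition A p r).2.1 ∧ (hoarePartition A p r).2.1 < r ∧
      (∀ l, p ≤ l → l ≤ (hoarePartition A p r).2.1 → A (π l) < A p) ∧
      (∀ l, (hoarePartition A p r).2.1 < l → l ≤ r → A p ≤ A (π l)) ∧
      (hoarePartition A p r).2.2 =
        ((Finset.Icc p (hoarePartition A p r).2.1).filter fun l => A p ≤ A l).card := by
  obtain ⟨l0, hl1, hl2, hl3⟩ := hmin
  have hb := hoarePartition_bounds A p r hp (by omega)
  have hu := scanUp_pred A hp (by omega : p ≤ r)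
  have h1 := le_scanDown A (A p) p le_rfl (r + 1) (by omega)
  have h2 := scanDown_lt A (A p) (r + 1) (by omega)
  have h3 := scanDown_spec A (A p) p le_rfl (r + 1) (by omega)
  have h4 := scanDown_gt A (A p) (r + 1)
  have h5 : p < scanDown A (A p) (r + 1) := by
    rcases h1.lt_or_eq with h | h
    · exact h
    · have := h4 l0 (by omega) (by omega); omega
  unfold hoarePartition at hb ⊢
  rw [partitionLoop, hu, if_pos h5] at hb ⊢
  generalize scanDown A (A p) (r + 1) = d at *
  have hdx : A d < A p := lt_of_le_of_ne h3 fun h => by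
    have := hA ⟨by omega, by omega⟩ ⟨le_rfl, by omega⟩ h; omega
  have eu : exchange A p d p = A d := by simp [exchange]
  have ed : exchange A p d d = A p := by simp [exchange]
  have eo : ∀ l, l ≠ p → l ≠ d → exchange A p d l = A l := fun l h1 h2 => by
    simp [exchange, Equiv.swap_apply_of_ne_of_ne h1 h2]
  obtain ⟨π, e1, e2, e3, e4, e5, e6, e7⟩ := partitionLoop_spec p r (A p) (exchange A p d) p d
    (0 + 1) le_rfl h5 (by omega)
    (fun l h6 h7 => by
      obtain rfl : l = p := by omega
      rw [eu]; exact hdx)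
    (fun l h6 h7 => by
      rcases eq_or_ne l d with rfl | hl
      · rw [ed]
      · rw [eo l (by omega) hl]; exact (h4 l (by omega) (by omega)).le)
    (fun l h6 h7 h8 => by
      rw [eo l (by omega) (by omega)] at h8
      have := hA ⟨by omega, by omega⟩ ⟨le_rfl, by omega⟩ h8; omega)
  refine ⟨π.trans (Equiv.swap p d), ?_, ?_, hb.1, hb.2, e5, e6, ?_⟩
  · rw [e1]; rfl
  · intro l hl
    by_contra hcon
    have h1 : π l = l := by by_contra h2; exact hcon (e2 l h2)
    apply hl
    simp only [Equiv.trans_apply, h1]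
    exact Equiv.swap_apply_of_ne_of_ne (by omega) (by omega)
  · rw [e7]
    generalize (partitionLoop r (A p) (exchange A p d) p d (0 + 1)).2.1 = q at *
    have : (Finset.Icc p q).filter (fun l => A p ≤ A l) =
        insert p ((Finset.Icc p q).filter fun l => A p ≤ exchange A p d l) := by
      ext l
      simp only [Finset.mem_filter, Finset.mem_Icc, Finset.mem_insert]
      constructor
      · rintro ⟨h1, h2⟩
        rcases eq_or_ne l p with rfl | hl
        · exact Or.inl rfl
        · rw [eo l hl (by omega)]; exact Or.inr ⟨h1, h2⟩
      · rintro (rfl | ⟨h1, h2⟩)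
        · exact ⟨by omega, le_rfl⟩
        · refine ⟨h1, ?_⟩
          rcases eq_or_ne l p with rfl | hl
          · exact le_rfl
          · rwa [eo l hl (by omega)] at h2
    rw [this, Finset.card_insert_of_notMem]
    · omega
    · simp only [Finset.mem_filter, eu]
      rintro ⟨-, h1⟩
      omega

/-- The number of exchanges in one partitioning is at most the length of either sub-list. -/
theorem hoarePartition_exchanges_le (A : ℕ → ℕ) (p r : ℕ) (hp : 1 ≤ p) (hpr : p < r)
    (hA : InjOn A (Icc p r)) :
    (hoarePartition A p r).2.2 ≤ (hoarePartition A p r).2.1 + 1 - p ∧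
      (hoarePartition A p r).2.2 ≤ r - (hoarePartition A p r).2.1 := by
  by_cases hmin : ∃ l, p < l ∧ l ≤ r ∧ A l < A p
  · obtain ⟨π, e1, e2, e3, e4, e5, e6, e7⟩ := hoarePartition_spec A p r hp hA hmin
    generalize (hoarePartition A p r).2.1 = q at *
    have hπ : ∀ l, p ≤ l → l ≤ r → p ≤ π.symm l ∧ π.symm l ≤ r := fun l h1 h2 => by
      by_cases h : π.symm l = l
      · rw [h]; exact ⟨h1, h2⟩
      · exact e2 _ (by rw [Equiv.apply_symm_apply]; exact fun h' => h h'.symm)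
    constructor
    · rw [e7]
      refine (Finset.card_filter_le _ _).trans ?_
      rw [Nat.card_Icc]
    · rw [e7]
      have : ((Finset.Icc p q).filter fun l => A p ≤ A l).card ≤ (Finset.Icc (q + 1) r).card := by
        refine Finset.card_le_card_of_injOn π.symm ?_ π.symm.injective.injOn
        intro l hl
        simp only [Finset.coe_filter, Finset.mem_Icc, mem_ofPred_eq] at hl
        have h1 := hπ l (by omega) (by omega)
        simp only [Finset.coe_Icc, mem_Icc]
        refine ⟨?_, h1.2⟩
        by_contra h2
        have h3 := e5 (π.symm l) h1.1 (by omega)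
        rw [Equiv.apply_symm_apply] at h3
        omega
      rw [Nat.card_Icc] at this
      omega
  · rw [hoarePartition_of_min A p r hp hpr.le fun l h1 h2 => ?_]
    · simp
    · push Not at hmin
      refine lt_of_le_of_ne (hmin l h1 h2) fun h => ?_
      have := hA ⟨le_rfl, by omega⟩ ⟨by omega, h2⟩ h; omega

theorem quickselectExchanges_self (A : ℕ → ℕ) (p k : ℕ) : quickselectExchanges A p p k = 0 := by
  rw [quickselectExchanges, dif_neg (by omega)]

theorem hoarePartition_injOn (A : ℕ → ℕ) (p r : ℕ) (hp : 1 ≤ p) (hpr : p < r)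
    (hA : InjOn A (Icc p r)) : InjOn (hoarePartition A p r).1 (Icc p r) := by
  by_cases hmin : ∃ l, p < l ∧ l ≤ r ∧ A l < A p
  · obtain ⟨π, e1, e2, -⟩ := hoarePartition_spec A p r hp hA hmin
    rw [e1]
    have : ∀ l, l ∈ Icc p r → π l ∈ Icc p r := fun l hl => by
      by_cases h : π l = l
      · rwa [h]
      · exact e2 _ fun h' => h (π.injective h')
    intro l hl l' hl' h
    exact π.injective (hA (this l hl) (this l' hl') h)
  · rw [hoarePartition_of_min A p r hp hpr.le fun l h1 h2 => ?_]
    · exact hA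
    · push Not at hmin
      refine lt_of_le_of_ne (hmin l h1 h2) fun h => ?_
      have := hA ⟨le_rfl, by omega⟩ ⟨by omega, h2⟩ h; omega

/-- The number of exchanges is at most the length of the list: in each partitioning there are at
most as many exchanges as entries are discarded. -/
theorem quickselectExchanges_le (A : ℕ → ℕ) (p r k : ℕ) (hA : InjOn A (Icc p r)) :
    quickselectExchanges A p r k ≤ r - p := by
  fun_induction quickselectExchanges A p r k with
  | case1 A p r k h ih1 ih2 =>
    have h1 := hoarePartition_bounds A p r h.1 h.2
    have h2 := hoarePartition_exchanges_le A p r h.1 h.2 hA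
    have h3 := hoarePartition_injOn A p r h.1 h.2 hA
    split_ifs with hk
    · have := ih1 (h3.mono (Icc_subset_Icc le_rfl (by omega)))
      omega
    · have := ih2 (h3.mono (Icc_subset_Icc (by omega) le_rfl))
      omega
  | case2 => omega

/-! ### Averages over the permutations of a finite set -/

section PermAverage

variable {α : Type*} [DecidableEq α]

/-- The average of `F` over the permutations of the finite set `W` (extended by the identity). -/
noncomputable def permAverage (W : Finset α) (F : Equiv.Perm α → ℝ) : ℝ :=
  (∑ g ∈ permsOfFinset W, F g) / (W.card.factorial : ℝ)

theorem apply_eq_of_mem_permsOfFinset {W : Finset α} {g : Equiv.Perm α} (hg : g ∈ permsOfFinset W)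
    {x : α} (hx : x ∉ W) : g x = x := by
  by_contra h
  exact hx (mem_perms_of_finset_iff.1 hg h)

theorem apply_mem_of_mem_permsOfFinset {W : Finset α} {g : Equiv.Perm α}
    (hg : g ∈ permsOfFinset W) {x : α} : g x ∈ W ↔ x ∈ W := by
  by_cases h : g x = x
  · rw [h]
  · refine ⟨fun _ => mem_perms_of_finset_iff.1 hg h, fun _ => ?_⟩
    exact mem_perms_of_finset_iff.1 hg fun h' => h (g.injective h')

theorem mul_mem_permsOfFinset {W : Finset α} {g h : Equiv.Perm α} (hg : g ∈ permsOfFinset W)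
    (hh : h ∈ permsOfFinset W) : g * h ∈ permsOfFinset W := by
  rw [mem_perms_of_finset_iff]
  intro x hx
  by_contra hW
  rw [Equiv.Perm.mul_apply, apply_eq_of_mem_permsOfFinset hh hW,
    apply_eq_of_mem_permsOfFinset hg hW] at hx
  exact hx rfl

theorem inv_mem_permsOfFinset {W : Finset α} {g : Equiv.Perm α} (hg : g ∈ permsOfFinset W) :
    g⁻¹ ∈ permsOfFinset W := by
  rw [mem_perms_of_finset_iff]
  intro x hx
  by_contra hW
  apply hx
  rw [Equiv.Perm.inv_eq_iff_eq, apply_eq_of_mem_permsOfFinset hg hW]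

theorem permsOfFinset_mono {V W : Finset α} (h : V ⊆ W) : permsOfFinset V ⊆ permsOfFinset W :=
  fun _ hg => mem_perms_of_finset_iff.2 fun hx => h (mem_perms_of_finset_iff.1 hg hx)

theorem image_eq_of_mem_permsOfFinset {W V : Finset α} {g : Equiv.Perm α}
    (hg : g ∈ permsOfFinset W) (hW : W ⊆ V) : V.image g = V := by
  apply Finset.eq_of_subset_of_card_le
  · intro y hy
    obtain ⟨x, hx, rfl⟩ := Finset.mem_image.1 hy
    exact (apply_mem_of_mem_permsOfFinset (permsOfFinset_mono hW hg)).2 hx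
  · rw [Finset.card_image_of_injective _ g.injective]

theorem permAverage_congr {W : Finset α} {F G : Equiv.Perm α → ℝ}
    (h : ∀ g ∈ permsOfFinset W, F g = G g) : permAverage W F = permAverage W G := by
  unfold permAverage
  rw [Finset.sum_congr rfl h]

theorem permAverage_mono {W : Finset α} {F G : Equiv.Perm α → ℝ}
    (h : ∀ g ∈ permsOfFinset W, F g ≤ G g) : permAverage W F ≤ permAverage W G := by
  unfold permAverage
  gcongr with g hg
  exact h g hg

theorem permAverage_const (W : Finset α) (c : ℝ) : permAverage W (fun _ => c) = c := by
  have : (W.card.factorial : ℝ) ≠ 0 := by positivity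
  unfold permAverage
  rw [Finset.sum_const, card_perms_of_finset, nsmul_eq_mul]
  field_simp

theorem permAverage_add (W : Finset α) (F G : Equiv.Perm α → ℝ) :
    permAverage W (fun g => F g + G g) = permAverage W F + permAverage W G := by
  unfold permAverage
  rw [Finset.sum_add_distrib, add_div]

theorem permAverage_const_mul (W : Finset α) (c : ℝ) (F : Equiv.Perm α → ℝ) :
    permAverage W (fun g => c * F g) = c * permAverage W F := by
  unfold permAverage
  rw [← Finset.mul_sum, mul_div_assoc]

theorem permAverage_sum {ι : Type*} (W : Finset α) (s : Finset ι) (F : ι → Equiv.Perm α → ℝ) :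
    permAverage W (fun g => ∑ k ∈ s, F k g) = ∑ k ∈ s, permAverage W (F k) := by
  unfold permAverage
  rw [Finset.sum_comm, Finset.sum_div]

/-- An average over the permutations of `W` does not change if one averages in addition over the
permutations of a subset of `W`, even if this subset depends on the first permutation, as long as it
stays the same under the second. -/
theorem permAverage_permAverage (W : Finset α) (F : Equiv.Perm α → ℝ)
    (w : Equiv.Perm α → Finset α) (hw : ∀ g ∈ permsOfFinset W, w g ⊆ W)
    (hinv : ∀ g ∈ permsOfFinset W, ∀ h ∈ permsOfFinset (w g), w (h * g) = w g) :
    permAverage W (fun g => permAverage (w g) fun h => F (h * g)) = permAverage W F := by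
  unfold permAverage
  congr 1
  have h1 : ∑ g ∈ permsOfFinset W, (∑ h ∈ permsOfFinset (w g), F (h * g)) /
      ((w g).card.factorial : ℝ) = ∑ z ∈ (permsOfFinset W).sigma (fun g => permsOfFinset (w g)),
        F (z.2 * z.1) / ((w z.1).card.factorial : ℝ) := by
    rw [Finset.sum_sigma]
    exact Finset.sum_congr rfl fun g _ => Finset.sum_div _ _ _
  have h2 : ∑ g ∈ permsOfFinset W, F g =
      ∑ z ∈ (permsOfFinset W).sigma (fun g => permsOfFinset (w g)),
        F z.1 / ((w z.1).card.factorial : ℝ) := by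
    rw [Finset.sum_sigma]
    refine Finset.sum_congr rfl fun g _ => ?_
    have : ((w g).card.factorial : ℝ) ≠ 0 := by positivity
    simp only [Finset.sum_const, card_perms_of_finset, nsmul_eq_mul]
    field_simp
  rw [h1, h2]
  have key : ∀ z ∈ (permsOfFinset W).sigma (fun g => permsOfFinset (w g)),
      (⟨z.2 * z.1, z.2⁻¹⟩ : Σ _ : Equiv.Perm α, Equiv.Perm α) ∈
        (permsOfFinset W).sigma (fun g => permsOfFinset (w g)) := by
    rintro ⟨g, h⟩ hz
    rw [Finset.mem_sigma] at hz ⊢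
    refine ⟨mul_mem_permsOfFinset (permsOfFinset_mono (hw g hz.1) hz.2) hz.1, ?_⟩
    change h⁻¹ ∈ permsOfFinset (w (h * g))
    rw [hinv g hz.1 h hz.2]
    exact inv_mem_permsOfFinset hz.2
  refine Finset.sum_nbij' (fun z => ⟨z.2 * z.1, z.2⁻¹⟩) (fun z => ⟨z.2 * z.1, z.2⁻¹⟩) key key
    ?_ ?_ ?_
  · rintro ⟨g, h⟩ _; simp
  · rintro ⟨g, h⟩ _; simp
  · rintro ⟨g, h⟩ hz
    rw [Finset.mem_sigma] at hz
    simp only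
    rw [hinv g hz.1 h hz.2]

theorem permAverage_inv (W : Finset α) (F : Equiv.Perm α → ℝ) :
    permAverage W (fun g => F g⁻¹) = permAverage W F := by
  unfold permAverage
  congr 1
  refine Finset.sum_nbij' (fun g => g⁻¹) (fun g => g⁻¹) (fun g hg => inv_mem_permsOfFinset hg)
    (fun g hg => inv_mem_permsOfFinset hg) ?_ ?_ ?_ <;> simp

/-- The image of a point of `W` under a random permutation of `W` is uniform. -/
theorem permAverage_apply {W : Finset α} {a : α} (ha : a ∈ W) (G : α → ℝ) :
    permAverage W (fun g => G (g a)) = (∑ x ∈ W, G x) / (W.card : ℝ) := by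
  have hsw : ∀ b ∈ W, permAverage W (fun g => G (g b)) = permAverage W (fun g => G (g a)) := by
    intro b hb
    have hs : Equiv.swap a b ∈ permsOfFinset W := by
      rw [mem_perms_of_finset_iff]
      intro x hx
      by_contra hW
      exact hx (Equiv.swap_apply_of_ne_of_ne (fun h => hW (h ▸ ha)) (fun h => hW (h ▸ hb)))
    unfold permAverage
    congr 1
    refine Finset.sum_nbij' (fun g => g * Equiv.swap a b) (fun g => g * Equiv.swap a b)
      (fun g hg => mul_mem_permsOfFinset hg hs) (fun g hg => mul_mem_permsOfFinset hg hs) ?_ ?_ ?_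
    · intro g _; simp [mul_assoc]
    · intro g _; simp [mul_assoc]
    · intro g _; simp
  have hc : (W.card : ℝ) ≠ 0 := by
    have := Finset.card_pos.2 ⟨a, ha⟩
    positivity
  rw [eq_div_iff hc]
  calc permAverage W (fun g => G (g a)) * W.card
      = ∑ b ∈ W, permAverage W (fun g => G (g b)) := by
        rw [Finset.sum_congr rfl hsw, Finset.sum_const, nsmul_eq_mul, mul_comm]
    _ = permAverage W (fun g => ∑ b ∈ W, G (g b)) := (permAverage_sum W W fun b g => G (g b)).symm
    _ = permAverage W (fun _ => ∑ b ∈ W, G b) := by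
        refine permAverage_congr fun g hg => ?_
        conv_rhs => rw [← image_eq_of_mem_permsOfFinset hg (Finset.Subset.refl W)]
        rw [Finset.sum_image fun x _ y _ h => g.injective h]
    _ = ∑ b ∈ W, G b := permAverage_const W _

end PermAverage

/-! ### Hoeffding's inequality for sampling without replacement -/

/-- Hoeffding's lemma for a two-point distribution. -/
theorem two_point_hoeffding {q : ℝ} (hq0 : 0 ≤ q) (hq1 : q ≤ 1) (y : ℝ) :
    q * Real.exp y + (1 - q) ≤ Real.exp (q * y + y ^ 2 / 8) := by
  let μ : Measure ℝ := ENNReal.ofReal q • Measure.dirac 1 + ENNReal.ofReal (1 - q) • Measure.dirac 0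
  have hμ : IsProbabilityMeasure μ := ⟨by
    simp only [μ, Measure.add_apply, Measure.smul_apply, measure_univ, smul_eq_mul, mul_one]
    rw [← ENNReal.ofReal_add hq0 (by linarith)]
    simp⟩
  have hint : ∀ f : ℝ → ℝ, ∫ x, f x ∂μ = q * f 1 + (1 - q) * f 0 := fun f => by
    rw [integral_add_measure, integral_smul_measure, integral_smul_measure, integral_dirac,
      integral_dirac, ENNReal.toReal_ofReal hq0, ENNReal.toReal_ofReal (by linarith)]
    · simp
    · exact (integrable_dirac (by simp)).smul_measure (by simp)
    · exact (integrable_dirac (by simp)).smul_measure (by simp)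
  have h := (ProbabilityTheory.hasSubgaussianMGF_of_mem_Icc (μ := μ) (X := id) (a := 0) (b := 1)
    aemeasurable_id (by
      rw [ae_add_measure_iff]
      refine ⟨Measure.ae_smul_measure ?_ _, Measure.ae_smul_measure ?_ _⟩ <;>
      · rw [ae_dirac_eq]; simp)).mgf_le y
  rw [ProbabilityTheory.mgf, hint, hint] at h
  simp only [id] at h
  have e1 : Real.exp (q * y + y ^ 2 / 8) =
      Real.exp (q * y) * Real.exp (y ^ 2 / 8) := Real.exp_add _ _
  have e2 : Real.exp (y * (1 - (q * 1 + (1 - q) * 0))) = Real.exp y * Real.exp (-(q * y)) := by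
    rw [← Real.exp_add]; ring_nf
  have e3 : Real.exp (y * (0 - (q * 1 + (1 - q) * 0))) = Real.exp (-(q * y)) := by ring_nf
  rw [e2, e3] at h
  have e4 : Real.exp (q * y) * Real.exp (-(q * y)) = 1 := by rw [← Real.exp_add]; simp
  rw [e1]
  have h' := mul_le_mul_of_nonneg_left h (Real.exp_pos (q * y)).le
  refine le_trans (le_of_eq ?_) (h'.trans (mul_le_mul_of_nonneg_left
    (Real.exp_le_exp.2 (le_of_eq ?_)) (Real.exp_pos _).le))
  · linear_combination (-(q * Real.exp y) - (1 - q)) * e4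
  · norm_num
    ring

section Hypergeometric

variable {α : Type*} [DecidableEq α]

/-- The moment generating function of the number of points of `D` that a random permutation of `S`
moves into `G`; the inequality of Hoeffding with one term for each point of `D`. It is proved by
revealing the images of the points of `D` one after the other. -/
theorem permAverage_exp_card_le (n : ℕ) : ∀ (S D G : Finset α), D.card = n → D ⊆ S → G ⊆ S →
    ∀ y : ℝ, permAverage S (fun h => Real.exp (y * ((D.filter fun b => h b ∈ G).card : ℝ))) ≤
      Real.exp (y * (D.card * G.card / S.card) + y ^ 2 * D.card / 8) := by
  induction n with
  | zero =>
    intro S D G hD _ _ y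
    obtain rfl := Finset.card_eq_zero.1 hD
    simp [permAverage_const]
  | succ n ih =>
    intro S D G hD hDS hGS y
    obtain ⟨b, hb⟩ : D.Nonempty := Finset.card_pos.1 (by omega)
    have hbS := hDS hb
    have hSpos : 0 < S.card := Finset.card_pos.2 ⟨b, hbS⟩
    have hDle : D.card ≤ S.card := Finset.card_le_card hDS
    have hGle : G.card ≤ S.card := Finset.card_le_card hGS
    have hDe : (D.erase b).card = n := by rw [Finset.card_erase_of_mem hb, hD]; rfl
    -- reveal the image of `b`
    have hsplit : ∀ h ∈ permsOfFinset S, ∀ h' ∈ permsOfFinset (S.erase b),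
        ((D.filter fun c => h (h' c) ∈ G).card : ℝ) = (if h b ∈ G then (1 : ℝ) else 0) +
          (((D.erase b).filter fun c => h' c ∈ (G.image ⇑h⁻¹).erase b).card : ℝ) := by
      intro h hh h' hh'
      have hb' : h' b = b := apply_eq_of_mem_permsOfFinset hh' (Finset.notMem_erase b S)
      have e1 : (D.erase b).filter (fun c => h' c ∈ (G.image ⇑h⁻¹).erase b) =
          (D.filter fun c => h (h' c) ∈ G).erase b := by
        ext c
        simp only [Finset.mem_filter, Finset.mem_erase, Finset.mem_image]
        constructor
        · rintro ⟨⟨h1, h2⟩, -, z, hz, hz'⟩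
          refine ⟨h1, h2, ?_⟩
          rw [← hz']; simpa using hz
        · rintro ⟨h1, h2, h3⟩
          refine ⟨⟨h1, h2⟩, fun h4 => h1 (h'.injective (h4.trans hb'.symm)), _, h3, by simp⟩
      rw [e1]
      split_ifs with hG
      · rw [Finset.card_erase_of_mem (by simp [hb, hb', hG])]
        have : 0 < (D.filter fun c => h (h' c) ∈ G).card :=
          Finset.card_pos.2 ⟨b, by simp [hb, hb', hG]⟩
        rw [Nat.cast_sub this]; simp
      · rw [Finset.erase_eq_of_notMem (by simp [hb', hG])]; simp
    have hcardG : ∀ h ∈ permsOfFinset S, (((G.image ⇑h⁻¹).erase b).card : ℝ) =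
        G.card - (if h b ∈ G then (1 : ℝ) else 0) := by
      intro h hh
      have hc : (G.image ⇑h⁻¹).card = G.card := Finset.card_image_of_injective _ (h⁻¹).injective
      have hm : b ∈ G.image ⇑h⁻¹ ↔ h b ∈ G := by
        simp only [Finset.mem_image]
        constructor
        · rintro ⟨z, hz, rfl⟩; simpa using hz
        · intro hz; exact ⟨_, hz, by simp⟩
      split_ifs with hG
      · rw [Finset.card_erase_of_mem (hm.2 hG), hc]
        have : 0 < G.card := Finset.card_pos.2 ⟨_, hG⟩
        rw [Nat.cast_sub this]; simp
      · rw [Finset.erase_eq_of_notMem (fun h' => hG (hm.1 h')), hc]; simp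
    set N : ℝ := (S.card : ℝ) with hN
    have hNpos : 0 < N := by rw [hN]; exact_mod_cast hSpos
    set a : ℝ := n / (N - 1) with ha
    have hSe : ((S.erase b).card : ℝ) = N - 1 := by
      rw [Finset.card_erase_of_mem hbS, Nat.cast_sub hSpos]; simp [hN]
    have hn1 : (n : ℝ) ≤ N - 1 := by
      have : n + 1 ≤ S.card := by omega
      have : ((n + 1 : ℕ) : ℝ) ≤ N := by rw [hN]; exact_mod_cast this
      push_cast at this; linarith
    have ha0 : 0 ≤ a := div_nonneg (Nat.cast_nonneg n) (le_trans (Nat.cast_nonneg n) hn1)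
    have ha1 : a ≤ 1 := div_le_one_of_le₀ hn1 (le_trans (Nat.cast_nonneg n) hn1)
    have haN : a * (N - 1) = n := by
      rcases eq_or_ne (N - 1) 0 with h0 | h0
      · have : (n : ℝ) = 0 := le_antisymm (by linarith) (Nat.cast_nonneg n)
        rw [h0, this]; simp
      · rw [ha]; field_simp
    -- the average over the remaining points, by the induction hypothesis
    have hinner : ∀ h ∈ permsOfFinset S,
        permAverage (S.erase b) (fun h' =>
          Real.exp (y * ((D.filter fun c => h (h' c) ∈ G).card : ℝ))) ≤
        Real.exp (y * (a * G.card) + y ^ 2 * n / 8) *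
          (if h b ∈ G then Real.exp (y * (1 - a)) else 1) := by
      intro h hh
      have hsub : (G.image ⇑h⁻¹).erase b ⊆ S.erase b := by
        apply Finset.erase_subset_erase
        intro z hz
        obtain ⟨z', hz', rfl⟩ := Finset.mem_image.1 hz
        exact (apply_mem_of_mem_permsOfFinset (inv_mem_permsOfFinset hh)).2 (hGS hz')
      have := ih (S.erase b) (D.erase b) ((G.image ⇑h⁻¹).erase b) hDe
        (Finset.erase_subset_erase _ hDS) hsub y
      rw [permAverage_congr (G := fun h' => Real.exp (y * (if h b ∈ G then (1 : ℝ) else 0)) *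
        Real.exp (y * (((D.erase b).filter fun c => h' c ∈ (G.image ⇑h⁻¹).erase b).card : ℝ)))
        (fun h' hh' => by rw [hsplit h hh h' hh', mul_add, Real.exp_add]), permAverage_const_mul]
      refine (mul_le_mul_of_nonneg_left this (Real.exp_pos _).le).trans (le_of_eq ?_)
      rw [hcardG h hh, hSe, hDe, ← Real.exp_add]
      have e : ∀ c : ℝ, (n : ℝ) * c / (N - 1) = a * c := fun c => by rw [ha]; ring
      rw [e]
      split_ifs
      · rw [← Real.exp_add]; ring_nf
      · rw [mul_one]; ring_nf
    have hrev : permAverage S (fun h => Real.exp (y * ((D.filter fun b => h b ∈ G).card : ℝ))) =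
        permAverage S (fun h => permAverage (S.erase b) (fun h' =>
          Real.exp (y * ((D.filter fun c => h (h' c) ∈ G).card : ℝ)))) := by
      have h1 := permAverage_permAverage S
        (fun h => Real.exp (y * ((D.filter fun b => h⁻¹ b ∈ G).card : ℝ))) (fun _ => S.erase b)
        (fun _ _ => Finset.erase_subset _ _) (fun _ _ _ _ => rfl)
      have h2 := permAverage_inv S
        (fun h => Real.exp (y * ((D.filter fun b => h b ∈ G).card : ℝ)))
      rw [← h2, ← h1, ← permAverage_inv S]
      refine permAverage_congr fun h _ => ?_
      rw [← permAverage_inv (S.erase b)]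
      refine permAverage_congr fun h' _ => ?_
      have e : (h'⁻¹ * h⁻¹)⁻¹ = h * h' := by simp
      simp only [e]
      rfl
    rw [hrev]
    refine (permAverage_mono hinner).trans ?_
    rw [permAverage_const_mul,
      permAverage_apply hbS (fun z => if z ∈ G then Real.exp (y * (1 - a)) else 1),
      Finset.sum_ite, Finset.sum_const, Finset.sum_const]
    have hf1 : (S.filter fun z => z ∈ G) = G := by
      ext z; simp only [Finset.mem_filter]; exact ⟨fun h => h.2, fun h => ⟨hGS h, h⟩⟩
    have hf2 : ((S.filter fun z => z ∉ G).card : ℝ) = N - G.card := by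
      have := Finset.card_filter_add_card_filter_not (s := S) (fun z => z ∈ G)
      rw [hf1] at this
      rw [hN, ← this]; push_cast; ring
    rw [hf1, nsmul_eq_mul, nsmul_eq_mul, hf2, ← hN]
    have hq := two_point_hoeffding (q := G.card / N) (by positivity)
      (div_le_one_of_le₀ (by rw [hN]; exact_mod_cast hGle) hNpos.le) (y * (1 - a))
    have e5 : ((G.card : ℝ) * Real.exp (y * (1 - a)) + (N - G.card) * 1) / N =
        G.card / N * Real.exp (y * (1 - a)) + (1 - G.card / N) := by field_simp
    rw [e5]
    refine (mul_le_mul_of_nonneg_left hq (Real.exp_pos _).le).trans ?_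
    rw [← Real.exp_add, Real.exp_le_exp, hD]
    push_cast
    have e6 : y * (a * G.card) + G.card / N * (y * (1 - a)) =
        y * ((n + 1) * G.card / N) := by
      rw [← haN]; field_simp; ring
    have e7 : (y * (1 - a)) ^ 2 ≤ y ^ 2 := by
      rw [mul_pow]
      have : (1 - a) ^ 2 ≤ 1 := by nlinarith
      nlinarith [sq_nonneg y]
    linarith [e6, e7]

/-- The same with one term for each point of the target set `G`. -/
theorem permAverage_exp_card_le' (S D G : Finset α) (hDS : D ⊆ S) (hGS : G ⊆ S) (y : ℝ) :
    permAverage S (fun h => Real.exp (y * ((D.filter fun b => h b ∈ G).card : ℝ))) ≤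
      Real.exp (y * (D.card * G.card / S.card) + y ^ 2 * G.card / 8) := by
  have h := permAverage_exp_card_le G.card S G D rfl hGS hDS y
  rw [← permAverage_inv] at h
  have e : ∀ h : Equiv.Perm α, (G.filter fun b => h⁻¹ b ∈ D).card =
      (D.filter fun b => h b ∈ G).card := fun h => by
    refine Finset.card_nbij' (⇑h⁻¹) (⇑h) ?_ ?_ ?_ ?_ <;> intro z hz <;> simp_all
  simp only [e] at h
  rwa [mul_comm (G.card : ℝ)] at h

/-- The same with one term for each point outside the target set `G`. -/
theorem permAverage_exp_card_le_compl (S D G : Finset α) (hDS : D ⊆ S) (hGS : G ⊆ S) (y : ℝ) :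
    permAverage S (fun h => Real.exp (y * ((D.filter fun b => h b ∈ G).card : ℝ))) ≤
      Real.exp (y * (D.card * G.card / S.card) + y ^ 2 * (S.card - G.card) / 8) := by
  rcases S.eq_empty_or_nonempty with rfl | hS
  · obtain rfl := Finset.subset_empty.1 hDS
    obtain rfl := Finset.subset_empty.1 hGS
    simp [permAverage_const]
  have hSpos : (0 : ℝ) < S.card := by exact_mod_cast Finset.card_pos.2 hS
  have h := permAverage_exp_card_le' S D (S \ G) hDS Finset.sdiff_subset (-y)
  have hc : ((S \ G).card : ℝ) = S.card - G.card := by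
    rw [Finset.card_sdiff_of_subset hGS, Nat.cast_sub (Finset.card_le_card hGS)]
  have e : ∀ h ∈ permsOfFinset S, Real.exp (y * ((D.filter fun b => h b ∈ G).card : ℝ)) =
      Real.exp (y * D.card) * Real.exp (-y * ((D.filter fun b => h b ∈ S \ G).card : ℝ)) := by
    intro h hh
    rw [← Real.exp_add]
    have h1 : D.filter (fun b => h b ∈ S \ G) = D.filter fun b => ¬ h b ∈ G := by
      refine Finset.filter_congr fun b hb => ?_
      simp [(apply_mem_of_mem_permsOfFinset hh).2 (hDS hb)]
    have h2 := Finset.card_filter_add_card_filter_not (s := D) (fun b => h b ∈ G)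
    rw [h1]
    have h3 : (D.card : ℝ) = (D.filter fun b => h b ∈ G).card +
      (D.filter fun b => ¬ h b ∈ G).card := by exact_mod_cast h2.symm
    rw [h3]; ring_nf
  rw [permAverage_congr e, permAverage_const_mul]
  refine (mul_le_mul_of_nonneg_left h (Real.exp_pos _).le).trans (le_of_eq ?_)
  rw [← Real.exp_add, hc]
  congr 1
  field_simp
  ring

end Hypergeometric

/-- Summing over the elements of a finite set of natural numbers by rank. -/
theorem sum_card_filter_lt (V : Finset ℕ) (G : ℕ → ℝ) :
    ∑ x ∈ V, G (V.filter fun v => v < x).card = ∑ i ∈ Finset.range V.card, G i := by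
  induction V using Finset.induction_on_max with
  | empty => simp
  | insert a s ha ih =>
    have has : a ∉ s := fun h => lt_irrefl a (ha a h)
    rw [Finset.sum_insert has, Finset.card_insert_of_notMem has, Finset.sum_range_succ, ← ih,
      add_comm]
    congr 1
    · refine Finset.sum_congr rfl fun x hx => ?_
      rw [Finset.filter_insert, if_neg (by have := ha x hx; omega)]
    · rw [Finset.filter_insert, if_neg (lt_irrefl a), Finset.filter_true_of_mem ha]

/-! ### Lists in random order with a fixed position of the minimum -/

/-- The finite set of the entries of the list `A[p..r]`. -/
def listValues (A : ℕ → ℕ) (p r : ℕ) : Finset ℕ := (Finset.Icc p r).image A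

/-- The elements of `V` other than its minimum. -/
def nonMin (V : Finset ℕ) : Finset ℕ := V.filter fun x => ∃ v ∈ V, v < x

/-- The average of `φ` of the number of exchanges over the rank of the element sought. -/
noncomputable def rankAverage (φ : ℕ → ℝ) (A : ℕ → ℕ) (p r : ℕ) : ℝ :=
  (∑ R ∈ Finset.range (r + 1 - p), φ (quickselectExchanges A p r (R + 1))) / ((r + 1 - p : ℕ) : ℝ)

/-- The average of `φ` of the number of exchanges over the rank of the element sought and over all
rearrangements of the list `A[p..r]` that leave its minimum in place. -/
noncomputable def listAverage (φ : ℕ → ℝ) (A : ℕ → ℕ) (p r : ℕ) : ℝ :=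
  permAverage (nonMin (listValues A p r)) fun g => rankAverage φ (fun l => g (A l)) p r

theorem card_listValues {A : ℕ → ℕ} {p r : ℕ} (hA : InjOn A (Icc p r)) :
    (listValues A p r).card = r + 1 - p := by
  unfold listValues
  rw [Finset.card_image_of_injOn (by simpa using hA), Nat.card_Icc]

theorem nonMin_subset (V : Finset ℕ) : nonMin V ⊆ V := Finset.filter_subset _ _

theorem mem_nonMin_iff {V : Finset ℕ} {x : ℕ} :
    x ∈ nonMin V ↔ x ∈ V ∧ 0 < (V.filter fun v => v < x).card := by
  unfold nonMin
  rw [Finset.mem_filter, Finset.card_pos]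
  refine and_congr_right fun _ => ⟨?_, ?_⟩
  · rintro ⟨v, h1, h2⟩; exact ⟨v, Finset.mem_filter.2 ⟨h1, h2⟩⟩
  · rintro ⟨v, h⟩; exact ⟨v, Finset.mem_filter.1 h⟩

theorem sum_nonMin (V : Finset ℕ) (F : ℕ → ℝ) :
    ∑ x ∈ nonMin V, F (V.filter fun v => v < x).card = ∑ i ∈ Finset.Ico 1 V.card, F i := by
  have h1 : nonMin V = V.filter fun x => 0 < (V.filter fun v => v < x).card := by
    ext x; rw [mem_nonMin_iff, Finset.mem_filter]
  have h2 : Finset.Ico 1 V.card = (Finset.range V.card).filter fun i => 0 < i := by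
    ext i; simp only [Finset.mem_Ico, Finset.mem_filter, Finset.mem_range]; omega
  rw [h1, h2, Finset.sum_filter, Finset.sum_filter,
    ← sum_card_filter_lt V fun i => if 0 < i then F i else 0]

theorem card_nonMin (V : Finset ℕ) : (nonMin V).card = V.card - 1 := by
  have h := sum_nonMin V fun _ => 1
  simp only [Finset.sum_const, Nat.card_Ico, nsmul_eq_mul, mul_one] at h
  exact_mod_cast h

theorem nonMin_filter_le {V : Finset ℕ} {x : ℕ} (hx : x ∈ V) :
    nonMin (V.filter fun v => x ≤ v) = V.filter fun v => x < v := by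
  ext y
  simp only [nonMin, Finset.mem_filter]
  constructor
  · rintro ⟨⟨h1, -⟩, v, ⟨-, h2⟩, h3⟩; exact ⟨h1, by omega⟩
  · rintro ⟨h1, h2⟩; exact ⟨⟨h1, h2.le⟩, x, ⟨hx, le_rfl⟩, h2⟩

/-- The search continues in each sub-list with a probability proportional to its length. -/
theorem rankAverage_split (φ : ℕ → ℝ) (A : ℕ → ℕ) (p r : ℕ) (hp : 1 ≤ p) (hpr : p < r) :
    rankAverage φ A p r =
      (((hoarePartition A p r).2.1 + 1 - p : ℕ) : ℝ) / ((r + 1 - p : ℕ) : ℝ) *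
        rankAverage (fun y => φ ((hoarePartition A p r).2.2 + y)) (hoarePartition A p r).1 p
          (hoarePartition A p r).2.1 +
      ((r - (hoarePartition A p r).2.1 : ℕ) : ℝ) / ((r + 1 - p : ℕ) : ℝ) *
        rankAverage (fun y => φ ((hoarePartition A p r).2.2 + y)) (hoarePartition A p r).1
          ((hoarePartition A p r).2.1 + 1) r := by
  have hb := hoarePartition_bounds A p r hp hpr
  have hQ : ∀ k, quickselectExchanges A p r k = (hoarePartition A p r).2.2 +
      if k ≤ (hoarePartition A p r).2.1 - p + 1 then
        quickselectExchanges (hoarePartition A p r).1 p (hoarePartition A p r).2.1 k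
      else
        quickselectExchanges (hoarePartition A p r).1 ((hoarePartition A p r).2.1 + 1) r
          (k - ((hoarePartition A p r).2.1 - p + 1)) := fun k => by
    rw [quickselectExchanges, dif_pos ⟨hp, hpr⟩]
  unfold rankAverage
  simp only [hQ]
  generalize (hoarePartition A p r).1 = A' at *
  generalize (hoarePartition A p r).2.1 = q at *
  generalize (hoarePartition A p r).2.2 = T at *
  have e1 : r + 1 - (q + 1) = r - q := by omega
  have e2 : r + 1 - p = (q + 1 - p) + (r - q) := by omega
  have h1 : ((q + 1 - p : ℕ) : ℝ) ≠ 0 := by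
    have : 0 < q + 1 - p := by omega
    positivity
  have h2 : ((r - q : ℕ) : ℝ) ≠ 0 := by
    have : 0 < r - q := by omega
    positivity
  have h3 : ((r + 1 - p : ℕ) : ℝ) ≠ 0 := by
    have : 0 < r + 1 - p := by omega
    positivity
  rw [e1]
  have hs : ∑ R ∈ Finset.range (r + 1 - p), φ (T + if R + 1 ≤ q - p + 1 then
        quickselectExchanges A' p q (R + 1) else
        quickselectExchanges A' (q + 1) r (R + 1 - (q - p + 1))) =
      ∑ R ∈ Finset.range (q + 1 - p), φ (T + quickselectExchanges A' p q (R + 1)) +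
      ∑ R ∈ Finset.range (r - q), φ (T + quickselectExchanges A' (q + 1) r (R + 1)) := by
    rw [e2, Finset.sum_range_add]
    congr 1
    · refine Finset.sum_congr rfl fun R hR => ?_
      rw [Finset.mem_range] at hR
      rw [if_pos (by omega)]
    · refine Finset.sum_congr rfl fun R hR => ?_
      rw [if_neg (by omega)]
      congr 3
      omega
  rw [hs]
  field_simp

/-- The sub-lists produced by one partitioning in terms of the set of the entries. -/
theorem hoarePartition_lists (B : ℕ → ℕ) (p r : ℕ) (hp : 1 ≤ p) (hB : InjOn B (Icc p r))
    (hx : B p ∈ nonMin (listValues B p r)) :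
    p ≤ (hoarePartition B p r).2.1 ∧ (hoarePartition B p r).2.1 < r ∧
    (hoarePartition B p r).2.1 + 1 - p =
      ((listValues B p r).filter fun v => v < B p).card ∧
    listValues (hoarePartition B p r).1 p (hoarePartition B p r).2.1 =
      (listValues B p r).filter (fun v => v < B p) ∧
    listValues (hoarePartition B p r).1 ((hoarePartition B p r).2.1 + 1) r =
      (listValues B p r).filter (fun v => B p ≤ v) ∧
    (hoarePartition B p r).2.2 =
      ((Finset.Icc p (hoarePartition B p r).2.1).filter fun l => B p ≤ B l).card ∧
    InjOn (hoarePartition B p r).1 (Icc p r) := by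
  obtain ⟨l0, hl1, hl2, hl3⟩ : ∃ l, p < l ∧ l ≤ r ∧ B l < B p := by
    obtain ⟨v, hv, hvx⟩ := (Finset.mem_filter.1 hx).2
    obtain ⟨l, hl, rfl⟩ := Finset.mem_image.1 hv
    rw [Finset.mem_Icc] at hl
    refine ⟨l, lt_of_le_of_ne hl.1 ?_, hl.2, hvx⟩
    rintro rfl
    exact lt_irrefl _ hvx
  have hinj := hoarePartition_injOn B p r hp (by omega) hB
  obtain ⟨π, e1, e2, e3, e4, e5, e6, e7⟩ := hoarePartition_spec B p r hp hB ⟨l0, hl1, hl2, hl3⟩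
  rw [e1] at hinj ⊢
  generalize (hoarePartition B p r).2.1 = q at *
  have hπ : ∀ l, p ≤ l → l ≤ r → p ≤ π.symm l ∧ π.symm l ≤ r := fun l h1 h2 => by
    by_cases h : π.symm l = l
    · rw [h]; exact ⟨h1, h2⟩
    · exact e2 _ (by rw [Equiv.apply_symm_apply]; exact fun h' => h h'.symm)
  have hπ' : ∀ l, p ≤ l → l ≤ r → p ≤ π l ∧ π l ≤ r := fun l h1 h2 => by
    by_cases h : π l = l
    · rw [h]; exact ⟨h1, h2⟩
    · exact e2 _ fun h' => h (π.injective h')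
  have hL : listValues (fun l => B (π l)) p q = (listValues B p r).filter (fun v => v < B p) := by
    ext y
    simp only [listValues, Finset.mem_image, Finset.mem_filter, Finset.mem_Icc]
    constructor
    · rintro ⟨l, hl, rfl⟩
      exact ⟨⟨π l, hπ' l hl.1 (by omega), rfl⟩, e5 l hl.1 hl.2⟩
    · rintro ⟨⟨l, hl, rfl⟩, h⟩
      refine ⟨π.symm l, ⟨(hπ l hl.1 hl.2).1, ?_⟩, by simp⟩
      by_contra hc
      have := e6 (π.symm l) (by omega) (hπ l hl.1 hl.2).2
      rw [Equiv.apply_symm_apply] at this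
      omega
  have hR : listValues (fun l => B (π l)) (q + 1) r =
      (listValues B p r).filter (fun v => B p ≤ v) := by
    ext y
    simp only [listValues, Finset.mem_image, Finset.mem_filter, Finset.mem_Icc]
    constructor
    · rintro ⟨l, hl, rfl⟩
      exact ⟨⟨π l, hπ' l (by omega) hl.2, rfl⟩, e6 l (by omega) hl.2⟩
    · rintro ⟨⟨l, hl, rfl⟩, h⟩
      refine ⟨π.symm l, ⟨?_, (hπ l hl.1 hl.2).2⟩, by simp⟩
      by_contra hc
      have := e5 (π.symm l) (hπ l hl.1 hl.2).1 (by omega)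
      rw [Equiv.apply_symm_apply] at this
      omega
  refine ⟨e3, e4, ?_, hL, hR, e7, hinj⟩
  rw [← hL, card_listValues (hinj.mono (Icc_subset_Icc le_rfl e4.le))]

theorem listValues_comp {A : ℕ → ℕ} {p r : ℕ} {W : Finset ℕ} (hW : W ⊆ listValues A p r)
    {g : Equiv.Perm ℕ} (hg : g ∈ permsOfFinset W) :
    listValues (fun l => g (A l)) p r = listValues A p r := by
  conv_rhs => rw [← image_eq_of_mem_permsOfFinset hg hW]
  unfold listValues
  rw [Finset.image_image]
  rfl

/-- A permutation that moves only numbers on one side of `x` preserves all comparisons with `x`. -/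
theorem apply_le_iff {W : Finset ℕ} {h : Equiv.Perm ℕ} (hh : h ∈ permsOfFinset W) {x : ℕ}
    (hW : (∀ v ∈ W, v < x) ∨ ∀ v ∈ W, x < v) :
    (∀ v, h v ≤ x ↔ v ≤ x) ∧ (∀ v, x ≤ h v ↔ x ≤ v) := by
  have key : ∀ v, h v = v ∨ (v ∈ W ∧ h v ∈ W) := fun v => by
    by_cases hv : v ∈ W
    · exact Or.inr ⟨hv, (apply_mem_of_mem_permsOfFinset hh).2 hv⟩
    · exact Or.inl (apply_eq_of_mem_permsOfFinset hh hv)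
  constructor <;> intro v <;> rcases key v with h1 | ⟨h1, h2⟩
  · rw [h1]
  · rcases hW with hW | hW <;> have h3 := hW _ h1 <;> have h4 := hW _ h2 <;> omega
  · rw [h1]
  · rcases hW with hW | hW <;> have h3 := hW _ h1 <;> have h4 := hW _ h2 <;> omega

/-- One of the two sub-lists (given by `a`, `b`, which depend on the final index) is in random order
with a fixed position of the minimum, given the pivot, the number of exchanges and this position. -/
theorem permAverage_sublist_le (φ : ℕ → ℝ) (A : ℕ → ℕ) (p r : ℕ)
    (w : ℕ → Finset ℕ) (lo hi : ℕ → ℕ) (c : ℕ → ℝ) (hc : ∀ i, 0 ≤ c i) (u : ℕ → ℕ → ℝ)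
    (hx : A p ∈ nonMin (listValues A p r))
    (hw : ∀ x ∈ nonMin (listValues A p r), w x ⊆ nonMin (listValues A p r) ∧
      ((∀ v ∈ w x, v < x) ∨ ∀ v ∈ w x, x < v))
    (hlist : ∀ g ∈ permsOfFinset (nonMin (listValues A p r)),
      nonMin (listValues (hoarePartition (fun l => g (A l)) p r).1
        (lo (hoarePartition (fun l => g (A l)) p r).2.1)
        (hi (hoarePartition (fun l => g (A l)) p r).2.1)) = w (g (A p)))
    (hleaf : ∀ g ∈ permsOfFinset (nonMin (listValues A p r)),
      listAverage (fun y => φ ((hoarePartition (fun l => g (A l)) p r).2.2 + y))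
        (hoarePartition (fun l => g (A l)) p r).1
        (lo (hoarePartition (fun l => g (A l)) p r).2.1)
        (hi (hoarePartition (fun l => g (A l)) p r).2.1) ≤
      u (hoarePartition (fun l => g (A l)) p r).2.1
        (hoarePartition (fun l => g (A l)) p r).2.2) :
    permAverage (nonMin (listValues A p r)) (fun g =>
      c (hoarePartition (fun l => g (A l)) p r).2.1 *
        rankAverage (fun y => φ ((hoarePartition (fun l => g (A l)) p r).2.2 + y))
          (hoarePartition (fun l => g (A l)) p r).1
          (lo (hoarePartition (fun l => g (A l)) p r).2.1)
          (hi (hoarePartition (fun l => g (A l)) p r).2.1)) ≤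
    permAverage (nonMin (listValues A p r)) (fun g =>
      c (hoarePartition (fun l => g (A l)) p r).2.1 *
        u (hoarePartition (fun l => g (A l)) p r).2.1
          (hoarePartition (fun l => g (A l)) p r).2.2) := by
  set W := nonMin (listValues A p r) with hWdef
  have hgx : ∀ g ∈ permsOfFinset W, g (A p) ∈ W := fun g hg =>
    (apply_mem_of_mem_permsOfFinset hg).2 hx
  have hfix : ∀ g ∈ permsOfFinset W, ∀ h ∈ permsOfFinset (w (g (A p))),
      h (g (A p)) = g (A p) := fun g hg h hh => by
    obtain ⟨h1, h2⟩ := apply_le_iff hh (hw _ (hgx g hg)).2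
    exact le_antisymm ((h1 _).2 le_rfl) ((h2 _).2 le_rfl)
  rw [← permAverage_permAverage W _ (fun g => w (g (A p))) (fun g hg => (hw _ (hgx g hg)).1)
    (fun g hg h hh => by rw [Equiv.Perm.mul_apply, hfix g hg h hh])]
  refine permAverage_mono fun g hg => ?_
  have hpart : ∀ h ∈ permsOfFinset (w (g (A p))),
      hoarePartition (fun l => (h * g) (A l)) p r =
        (fun l => h ((hoarePartition (fun l => g (A l)) p r).1 l),
          (hoarePartition (fun l => g (A l)) p r).2) := fun h hh => by
    obtain ⟨h1, h2⟩ := apply_le_iff hh (hw _ (hgx g hg)).2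
    exact hoarePartition_comp (fun l => g (A l)) p r h h1 h2
  rw [permAverage_congr (fun h hh => by rw [hpart h hh])]
  dsimp only
  rw [permAverage_const_mul]
  refine mul_le_mul_of_nonneg_left ?_ (hc _)
  have := hleaf g hg
  unfold listAverage at this
  rw [hlist g hg] at this
  exact this

/-- The expected number of exchanges in one partitioning differs from its approximation
`i (m - i) / m` by at most one, whatever the position of the minimum. -/
theorem abs_expected_exchanges_sub_le {m i d : ℝ} (hm : 3 ≤ m) (hi1 : 1 ≤ i) (him : i ≤ m - 1)
    (hd1 : d ≤ i - 1) (hd2 : i - 2 ≤ d) :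
    |1 + d * (m - 1 - i) / (m - 2) - i * (m - i) / m| ≤ 1 := by
  have h2 : (0 : ℝ) < m - 2 := by linarith
  have h0 : (0 : ℝ) < m := by linarith
  have e : 1 + d * (m - 1 - i) / (m - 2) - i * (m - i) / m =
      ((m - 2 + d * (m - 1 - i)) * m - i * (m - i) * (m - 2)) / ((m - 2) * m) := by
    field_simp
  rw [e, abs_le, le_div_iff₀ (by positivity), div_le_iff₀ (by positivity)]
  have h3 : 0 ≤ (m - 1 - i) * (d - (i - 2)) := mul_nonneg (by linarith) (by linarith)
  have h4 : 0 ≤ (m - 1 - i) * (i - 1 - d) := mul_nonneg (by linarith) (by linarith)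
  have h5 : 0 ≤ (m - 1 - i) * (i - 1) := mul_nonneg (by linarith) (by linarith)
  constructor
  · nlinarith [mul_nonneg h0.le h3]
  · nlinarith [mul_nonneg h0.le h4, sq_nonneg (m - 2 * i)]

/-- The moment generating function of the number of exchanges in one partitioning, when the pivot
is uniform among the entries other than the minimum. The factor `c` may depend on the number `i` of
entries smaller than the pivot. -/
theorem permAverage_exp_exchanges_le (A : ℕ → ℕ) (p r : ℕ) (hp : 1 ≤ p)
    (hA : InjOn A (Icc p r)) (hx : A p ∈ nonMin (listValues A p r)) (m : ℕ) (hm : m = r + 1 - p)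
    (hm3 : 3 ≤ m) (c : ℕ → ℝ) (hc : ∀ i, 0 ≤ c i) (y : ℝ) (e : ℕ → ℝ)
    (he : (∀ i, e i = (m : ℝ) - 1 - i) ∨ ∀ i, e i = (i : ℝ) - 1) :
    permAverage (nonMin (listValues A p r)) (fun g =>
      c ((hoarePartition (fun l => g (A l)) p r).2.1 + 1 - p) *
        Real.exp (y * ((hoarePartition (fun l => g (A l)) p r).2.2 : ℝ))) ≤
    (∑ i ∈ Finset.Ico 1 m,
      c i * Real.exp (y * (i * (m - i) / m) + |y| + y ^ 2 * e i / 8)) / (m - 1) := by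
  set V := listValues A p r with hV
  set W := nonMin V with hWdef
  have hVc : V.card = m := by rw [hV, card_listValues hA, hm]
  have hWc : W.card = m - 1 := by rw [hWdef, card_nonMin, hVc]
  have hWV : W ⊆ V := nonMin_subset V
  have hgx : ∀ g ∈ permsOfFinset W, g (A p) ∈ W := fun g hg =>
    (apply_mem_of_mem_permsOfFinset hg).2 hx
  have hinj : ∀ g : Equiv.Perm ℕ, InjOn (fun l => g (A l)) (Icc p r) := fun g =>
    g.injective.comp_injOn hA
  have hvals : ∀ g ∈ permsOfFinset W, listValues (fun l => g (A l)) p r = V := fun g hg =>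
    listValues_comp hWV hg
  have hlists := fun (g : Equiv.Perm ℕ) (hg : g ∈ permsOfFinset W) =>
    hoarePartition_lists (fun l => g (A l)) p r hp (hinj g)
      (by rw [hvals g hg]; exact hgx g hg)
  have hrhs := sum_nonMin V (fun i =>
    c i * Real.exp (y * (i * (m - i) / m) + |y| + y ^ 2 * e i / 8))
  have happ := permAverage_apply hx (fun x => c (V.filter fun v => v < x).card *
    Real.exp (y * ((V.filter fun v => v < x).card * (m - (V.filter fun v => v < x).card) / m) +
      |y| + y ^ 2 * e (V.filter fun v => v < x).card / 8))
  rw [hrhs, hWc, hVc, Nat.cast_sub (by omega), Nat.cast_one] at happ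
  rw [← happ, ← permAverage_permAverage W _ (fun g => W.erase (g (A p)))
    (fun g _ => Finset.erase_subset _ _) (fun g hg h hh => by
      rw [Equiv.Perm.mul_apply, apply_eq_of_mem_permsOfFinset hh (Finset.notMem_erase _ _)])]
  refine permAverage_mono fun g hg => ?_
  set x := g (A p) with hxdef
  set i := (V.filter fun v => v < x).card with hi
  have hxW : x ∈ W := hgx g hg
  have hxV : x ∈ V := hWV hxW
  have hi1 : 0 < i := (mem_nonMin_iff.1 hxW).2
  have him : i < m := by
    rw [← hVc, hi]
    refine Finset.card_lt_card (Finset.filter_ssubset.2 ⟨x, hxV, lt_irrefl x⟩)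
  have hfixx : ∀ h ∈ permsOfFinset (W.erase x), h x = x := fun h hh =>
    apply_eq_of_mem_permsOfFinset hh (Finset.notMem_erase _ _)
  have hhg : ∀ h ∈ permsOfFinset (W.erase x), h * g ∈ permsOfFinset W := fun h hh =>
    mul_mem_permsOfFinset (permsOfFinset_mono (Finset.erase_subset _ _) hh) hg
  set q := p + i - 1 with hq
  set S := W.erase x with hS
  set D := ((Finset.Icc (p + 1) q).image fun l => g (A l)) ∩ W with hD
  set G := V.filter fun v => x < v with hG
  have hqr : q < r := by omega
  have hT : ∀ h ∈ permsOfFinset S,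
      (hoarePartition (fun l => (h * g) (A l)) p r).2.1 + 1 - p = i ∧
      (((hoarePartition (fun l => (h * g) (A l)) p r).2.2 : ℕ) : ℝ) =
        1 + ((D.filter fun b => h b ∈ G).card : ℝ) := by
    intro h hh
    obtain ⟨h1, h2, h3, -, -, h4, -⟩ := hlists (h * g) (hhg h hh)
    rw [hvals _ (hhg h hh)] at h3
    have hx' : (h * g) (A p) = x := by rw [Equiv.Perm.mul_apply, ← hxdef, hfixx h hh]
    simp only [hx'] at h3 h4
    refine ⟨h3, ?_⟩
    have h5 : (hoarePartition (fun l => (h * g) (A l)) p r).2.1 = q := by omega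
    rw [h4, h5]
    have e1 : (Finset.Icc p q).filter (fun l => x ≤ (h * g) (A l)) =
        insert p ((Finset.Icc (p + 1) q).filter fun l => h (g (A l)) ∈ G) := by
      ext l
      simp only [Finset.mem_filter, Finset.mem_insert, Finset.mem_Icc]
      constructor
      · rintro ⟨h6, h7⟩
        rcases eq_or_ne l p with rfl | hl
        · exact Or.inl rfl
        · refine Or.inr ⟨by omega, Finset.mem_filter.2 ⟨?_, lt_of_le_of_ne h7 ?_⟩⟩
          · have : (h * g) (A l) ∈ listValues (fun l => (h * g) (A l)) p r :=
              Finset.mem_image.2 ⟨l, Finset.mem_Icc.2 ⟨h6.1, by omega⟩, rfl⟩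
            rwa [hvals _ (hhg h hh)] at this
          · intro h8
            rw [← hx'] at h8
            exact hl ((hinj (h * g)) ⟨le_rfl, by omega⟩ ⟨h6.1, by omega⟩ h8).symm
      · rintro (rfl | ⟨h6, h7⟩)
        · exact ⟨by omega, hx'.ge⟩
        · exact ⟨by omega, (Finset.mem_filter.1 h7).2.le⟩
    have e2 : ((Finset.Icc (p + 1) q).filter fun l => h (g (A l)) ∈ G).card =
        (D.filter fun b => h b ∈ G).card := by
      have : D.filter (fun b => h b ∈ G) =
          ((Finset.Icc (p + 1) q).filter fun l => h (g (A l)) ∈ G).image fun l => g (A l) := by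
        ext z
        simp only [hD, Finset.mem_filter, Finset.mem_inter, Finset.mem_image]
        constructor
        · rintro ⟨⟨⟨l, hl, rfl⟩, -⟩, h7⟩; exact ⟨l, ⟨hl, h7⟩, rfl⟩
        · rintro ⟨l, ⟨hl, h7⟩, rfl⟩
          refine ⟨⟨⟨l, hl, rfl⟩, ?_⟩, h7⟩
          by_contra hc
          have h8 : h (g (A l)) = g (A l) := apply_eq_of_mem_permsOfFinset hh fun h9 =>
            hc (Finset.mem_of_mem_erase h9)
          rw [h8] at h7
          have h9 := Finset.mem_filter.1 h7
          exact hc (Finset.mem_filter.2 ⟨h9.1, x, hxV, h9.2⟩)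
      rw [this, Finset.card_image_of_injOn]
      refine (hinj g).mono ?_
      intro l hl
      simp only [Finset.coe_filter, Finset.mem_Icc, mem_ofPred_eq] at hl
      exact ⟨by omega, by omega⟩
    rw [e1, Finset.card_insert_of_notMem (by simp), e2]
    push_cast; ring
  have hDS : D ⊆ S := by
    intro z hz
    obtain ⟨hz1, hz2⟩ := Finset.mem_inter.1 hz
    refine Finset.mem_erase.2 ⟨?_, hz2⟩
    rintro rfl
    obtain ⟨l, hl, hl'⟩ := Finset.mem_image.1 hz1
    rw [Finset.mem_Icc] at hl
    have := (hinj g) ⟨by omega, by omega⟩ ⟨le_rfl, by omega⟩ hl'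
    omega
  have hGS : G ⊆ S := by
    intro z hz
    obtain ⟨hz1, hz2⟩ := Finset.mem_filter.1 hz
    exact Finset.mem_erase.2 ⟨by omega, Finset.mem_filter.2 ⟨hz1, x, hxV, hz2⟩⟩
  have hSc : (S.card : ℝ) = m - 2 := by
    rw [hS, Finset.card_erase_of_mem hxW, hWc, Nat.cast_sub (by omega), Nat.cast_sub (by omega)]
    push_cast; ring
  have hGc : (G.card : ℝ) = m - 1 - i := by
    have h1 := Finset.card_filter_add_card_filter_not (s := V) (fun v => v < x)
    have h2 : V.filter (fun v => ¬ v < x) = insert x G := by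
      ext v
      simp only [hG, Finset.mem_filter, Finset.mem_insert]
      constructor
      · rintro ⟨h2, h3⟩
        rcases eq_or_ne v x with h4 | h4
        · exact Or.inl h4
        · exact Or.inr ⟨h2, by omega⟩
      · rintro (rfl | ⟨h2, h3⟩)
        · exact ⟨hxV, lt_irrefl _⟩
        · exact ⟨h2, by omega⟩
    rw [h2, Finset.card_insert_of_notMem (by simp [hG]), hVc, ← hi] at h1
    have : ((i + (G.card + 1) : ℕ) : ℝ) = m := by exact_mod_cast h1
    push_cast at this; linarith
  have hDc : (D.card : ℝ) ≤ (i : ℝ) - 1 ∧ (i : ℝ) - 2 ≤ D.card := by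
    have h1 : ((Finset.Icc (p + 1) q).image fun l => g (A l)).card = i - 1 := by
      rw [Finset.card_image_of_injOn ((hinj g).mono ?_), Nat.card_Icc]
      · omega
      · intro l hl
        simp only [Finset.coe_Icc, mem_Icc] at hl
        exact ⟨by omega, by omega⟩
    have h2 : D.card ≤ i - 1 := h1 ▸ Finset.card_le_card Finset.inter_subset_left
    have h3 : i - 1 ≤ D.card + 1 := by
      have hsub : ((Finset.Icc (p + 1) q).image fun l => g (A l)) ⊆ D ∪ (V \ W) := by
        intro z hz
        by_cases hzW : z ∈ W
        · exact Finset.mem_union_left _ (Finset.mem_inter.2 ⟨hz, hzW⟩)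
        · refine Finset.mem_union_right _ (Finset.mem_sdiff.2 ⟨?_, hzW⟩)
          obtain ⟨l, hl, rfl⟩ := Finset.mem_image.1 hz
          rw [Finset.mem_Icc] at hl
          have : g (A l) ∈ listValues (fun l => g (A l)) p r :=
            Finset.mem_image.2 ⟨l, Finset.mem_Icc.2 ⟨by omega, by omega⟩, rfl⟩
          rwa [hvals g hg] at this
      have h4 := (Finset.card_le_card hsub).trans (Finset.card_union_le _ _)
      rw [h1, Finset.card_sdiff_of_subset hWV, hVc, hWc] at h4
      omega
    constructor
    · have : ((D.card + 1 : ℕ) : ℝ) ≤ i := by exact_mod_cast (by omega : D.card + 1 ≤ i)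
      push_cast at this; linarith
    · have : (i : ℝ) ≤ ((D.card + 2 : ℕ) : ℝ) := by exact_mod_cast (by omega : i ≤ D.card + 2)
      push_cast at this; linarith
  rw [permAverage_congr (G := fun h => c i * Real.exp y *
    Real.exp (y * ((D.filter fun b => h b ∈ G).card : ℝ))) (fun h hh => by
      rw [(hT h hh).1, (hT h hh).2, mul_assoc, ← Real.exp_add]; ring_nf), permAverage_const_mul]
  have hmgf : permAverage S (fun h => Real.exp (y * ((D.filter fun b => h b ∈ G).card : ℝ))) ≤
      Real.exp (y * (D.card * G.card / S.card) + y ^ 2 * e i / 8) := by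
    rcases he with he | he
    · have := permAverage_exp_card_le' S D G hDS hGS y
      rwa [he, ← hGc]
    · have := permAverage_exp_card_le_compl S D G hDS hGS y
      have h1 : (S.card : ℝ) - G.card = e i := by rw [he, hSc, hGc]; ring
      rwa [h1] at this
  rw [mul_assoc]
  refine mul_le_mul_of_nonneg_left ?_ (hc i)
  refine (mul_le_mul_of_nonneg_left hmgf (Real.exp_pos y).le).trans ?_
  rw [← Real.exp_add, Real.exp_le_exp, hSc, hGc]
  have hb := abs_expected_exchanges_sub_le (m := m) (i := i) (d := D.card)
    (by exact_mod_cast hm3) (by exact_mod_cast hi1)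
    (by have : ((i + 1 : ℕ) : ℝ) ≤ m := by exact_mod_cast him
        push_cast at this; linarith) hDc.1 hDc.2
  have h1 : y * (1 + D.card * ((m : ℝ) - 1 - i) / (m - 2) - i * (m - i) / m) ≤ |y| := by
    refine (le_abs_self _).trans ?_
    rw [abs_mul]
    exact mul_le_of_le_one_right (abs_nonneg y) hb
  linarith

/-! ### One partitioning step -/

/-- One partitioning step when the first entry of the list is not its minimum: bounds for the
averages over shorter lists yield a bound for the average over the list. The length `i` of the
sub-list in which the search continues has the weights `2 i / (m (m - 1))`, `i = 1, …, m - 1`. -/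
theorem listAverage_le_of_sublists (φ : ℕ → ℝ) (A : ℕ → ℕ) (p r : ℕ) (hp : 1 ≤ p)
    (hA : InjOn A (Icc p r)) (hx : A p ∈ nonMin (listValues A p r)) (m : ℕ) (hm : m = r + 1 - p)
    (hm3 : 3 ≤ m) (y : ℝ) (v b : ℕ → ℝ) (hb : ∀ i, 0 ≤ b i)
    (hleaf : ∀ (B : ℕ → ℕ) (p' r' T i : ℕ), 1 ≤ p' → p' ≤ r' → InjOn B (Icc p' r') →
      i = r' + 1 - p' → i < m →
      listAverage (fun z => φ (T + z)) B p' r' ≤ v i + b i * Real.exp (y * T)) :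
    listAverage φ A p r ≤ ∑ i ∈ Finset.Ico 1 m, 2 * (i : ℝ) / (m * (m - 1)) *
      (v i + b i * Real.exp (y * (i * (m - i) / m) + |y| + y ^ 2 * (m - 1 - i) / 8)) := by
  set V := listValues A p r with hV
  set W := nonMin V with hWdef
  have hVc : V.card = m := by rw [hV, card_listValues hA, hm]
  have hWc : W.card = m - 1 := by rw [hWdef, card_nonMin, hVc]
  have hWV : W ⊆ V := nonMin_subset V
  have hgx : ∀ g ∈ permsOfFinset W, g (A p) ∈ W := fun g hg =>
    (apply_mem_of_mem_permsOfFinset hg).2 hx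
  have hinj : ∀ g : Equiv.Perm ℕ, InjOn (fun l => g (A l)) (Icc p r) := fun g =>
    g.injective.comp_injOn hA
  have hvals : ∀ g ∈ permsOfFinset W, listValues (fun l => g (A l)) p r = V := fun g hg =>
    listValues_comp hWV hg
  have hlists := fun (g : Equiv.Perm ℕ) (hg : g ∈ permsOfFinset W) =>
    hoarePartition_lists (fun l => g (A l)) p r hp (hinj g)
      (by rw [hvals g hg]; exact hgx g hg)
  have hm0 : (0 : ℝ) < m := by positivity
  have hm1 : (0 : ℝ) < (m : ℝ) - 1 := by
    have : (3 : ℝ) ≤ m := by exact_mod_cast hm3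
    linarith
  -- the left and the right sub-lists
  have hleft := permAverage_sublist_le φ A p r (fun x => nonMin (V.filter fun v => v < x))
    (fun _ => p) (fun q => q) (fun q => ((q + 1 - p : ℕ) : ℝ) / m)
    (fun q => by positivity)
    (fun q T => v (q + 1 - p) + b (q + 1 - p) * Real.exp (y * T)) hx
    (fun x _ => ⟨fun z hz => by
        obtain ⟨h1, v, h2, h3⟩ := Finset.mem_filter.1 hz
        exact Finset.mem_filter.2 ⟨(Finset.mem_filter.1 h1).1, v, (Finset.mem_filter.1 h2).1, h3⟩,
      Or.inl fun z hz => (Finset.mem_filter.1 (nonMin_subset _ hz)).2⟩)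
    (fun g hg => by
      obtain ⟨h1, h2, h3, h4, -⟩ := hlists g hg
      rw [h4, hvals g hg])
    (fun g hg => by
      obtain ⟨h1, h2, h3, h4, h5, h6, h7⟩ := hlists g hg
      exact hleaf _ p _ _ _ hp h1 (h7.mono (Icc_subset_Icc le_rfl h2.le)) rfl (by omega))
  have hright := permAverage_sublist_le φ A p r (fun x => V.filter fun v => x < v)
    (fun q => q + 1) (fun _ => r) (fun q => ((r - q : ℕ) : ℝ) / m)
    (fun q => by positivity)
    (fun q T => v (r - q) + b (r - q) * Real.exp (y * T)) hx
    (fun x hx => ⟨fun z hz => by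
        obtain ⟨h1, h2⟩ := Finset.mem_filter.1 hz
        exact Finset.mem_filter.2 ⟨h1, x, hWV hx, h2⟩,
      Or.inr fun z hz => (Finset.mem_filter.1 hz).2⟩)
    (fun g hg => by
      obtain ⟨h1, h2, h3, h4, h5, -⟩ := hlists g hg
      rw [h5, hvals g hg, nonMin_filter_le (hWV (hgx g hg))])
    (fun g hg => by
      obtain ⟨h1, h2, h3, h4, h5, h6, h7⟩ := hlists g hg
      exact hleaf _ _ r _ _ (by omega) (by omega) (h7.mono (Icc_subset_Icc (by omega) le_rfl))
        (by omega) (by omega))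
  have hsum : listAverage φ A p r ≤
      permAverage W (fun g => (fun i : ℕ => (i : ℝ) / m * v i + ((m - i : ℕ) : ℝ) / m * v (m - i))
        ((hoarePartition (fun l => g (A l)) p r).2.1 + 1 - p) * Real.exp (0 *
          ((hoarePartition (fun l => g (A l)) p r).2.2 : ℝ))) +
      (permAverage W (fun g => (fun i : ℕ => (i : ℝ) / m * b i)
        ((hoarePartition (fun l => g (A l)) p r).2.1 + 1 - p) * Real.exp (y *
          ((hoarePartition (fun l => g (A l)) p r).2.2 : ℝ))) +
      permAverage W (fun g => (fun i : ℕ => ((m - i : ℕ) : ℝ) / m * b (m - i))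
        ((hoarePartition (fun l => g (A l)) p r).2.1 + 1 - p) * Real.exp (y *
          ((hoarePartition (fun l => g (A l)) p r).2.2 : ℝ)))) := by
    have e : listAverage φ A p r = permAverage W (fun g => _ + _) :=
      permAverage_congr fun g hg => rankAverage_split φ (fun l => g (A l)) p r hp (by omega)
    rw [e, permAverage_add, ← hm]
    refine (add_le_add hleft hright).trans (le_of_eq ?_)
    rw [← permAverage_add, ← permAverage_add, ← permAverage_add]
    refine permAverage_congr fun g hg => ?_
    obtain ⟨h1, h2, h3, -⟩ := hlists g hg
    have e1 : r - (hoarePartition (fun l => g (A l)) p r).2.1 =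
        m - ((hoarePartition (fun l => g (A l)) p r).2.1 + 1 - p) := by omega
    rw [e1]
    simp only [zero_mul, Real.exp_zero]
    ring
  have hv : permAverage W (fun g =>
      (fun i : ℕ => (i : ℝ) / m * v i + ((m - i : ℕ) : ℝ) / m * v (m - i))
        ((hoarePartition (fun l => g (A l)) p r).2.1 + 1 - p) * Real.exp (0 *
          ((hoarePartition (fun l => g (A l)) p r).2.2 : ℝ))) =
      (∑ i ∈ Finset.Ico 1 m, ((i : ℝ) / m * v i + ((m - i : ℕ) : ℝ) / m * v (m - i))) /
        (m - 1) := by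
    have happ := permAverage_apply hx (fun x => (fun i : ℕ => (i : ℝ) / m * v i +
      ((m - i : ℕ) : ℝ) / m * v (m - i)) (V.filter fun v => v < x).card)
    rw [sum_nonMin V (fun i : ℕ => (i : ℝ) / m * v i + ((m - i : ℕ) : ℝ) / m * v (m - i)),
      hWc, hVc, Nat.cast_sub (by omega), Nat.cast_one] at happ
    rw [← happ]
    refine permAverage_congr fun g hg => ?_
    obtain ⟨h1, h2, h3, -⟩ := hlists g hg
    rw [hvals g hg] at h3
    rw [h3]
    simp
  have hl := permAverage_exp_exchanges_le A p r hp hA hx m hm hm3 (fun i : ℕ => (i : ℝ) / m * b i)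
    (fun i => mul_nonneg (by positivity) (hb i)) y (fun i => (m : ℝ) - 1 - i) (Or.inl fun _ => rfl)
  have hr := permAverage_exp_exchanges_le A p r hp hA hx m hm hm3
    (fun i : ℕ => ((m - i : ℕ) : ℝ) / m * b (m - i))
    (fun i => mul_nonneg (by positivity) (hb _)) y (fun i => (i : ℝ) - 1) (Or.inr fun _ => rfl)
  -- reflect the index of the right sub-lists
  have hrefl : ∀ F : ℕ → ℝ, ∑ i ∈ Finset.Ico 1 m, F (m - i) = ∑ i ∈ Finset.Ico 1 m, F i :=
    fun F => by
      refine Finset.sum_nbij' (fun i => m - i) (fun i => m - i) ?_ ?_ ?_ ?_ ?_ <;>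
        intro i hi <;> simp only [Finset.mem_Ico] at hi ⊢ <;> omega
  have hr' : ∑ i ∈ Finset.Ico 1 m, ((m - i : ℕ) : ℝ) / m * b (m - i) *
        Real.exp (y * (i * (m - i) / m) + |y| + y ^ 2 * ((i : ℝ) - 1) / 8) =
      ∑ i ∈ Finset.Ico 1 m, (i : ℝ) / m * b i *
        Real.exp (y * (i * (m - i) / m) + |y| + y ^ 2 * ((m : ℝ) - 1 - i) / 8) := by
    rw [← hrefl fun i => (i : ℝ) / m * b i *
        Real.exp (y * (i * (m - i) / m) + |y| + y ^ 2 * ((m : ℝ) - 1 - i) / 8)]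
    refine Finset.sum_congr rfl fun i hi => ?_
    rw [Finset.mem_Ico] at hi
    have : ((m - i : ℕ) : ℝ) = (m : ℝ) - i := Nat.cast_sub hi.2.le
    rw [this]
    congr 2
    ring
  refine hsum.trans ?_
  rw [hv]
  refine (add_le_add le_rfl (add_le_add hl hr)).trans (le_of_eq ?_)
  rw [hr', Finset.sum_add_distrib, hrefl fun i => (i : ℝ) / m * v i, ← add_div, ← add_div,
    div_eq_iff hm1.ne', Finset.sum_mul, ← Finset.sum_add_distrib, ← Finset.sum_add_distrib,
    ← Finset.sum_add_distrib]
  refine Finset.sum_congr rfl fun i _ => ?_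
  field_simp
  ring

/-- One partitioning step when the first entry of the list is its minimum: either the element sought
is the minimum, or the search continues in the remaining list, now in completely random order. -/
theorem listAverage_of_min (φ : ℕ → ℝ) (A : ℕ → ℕ) (p r : ℕ) (hp : 1 ≤ p) (hpr : p < r)
    (hA : InjOn A (Icc p r)) (hx : A p ∉ nonMin (listValues A p r)) :
    listAverage φ A p r = φ 0 / ((r + 1 - p : ℕ) : ℝ) +
      ((r - p : ℕ) : ℝ) / ((r + 1 - p : ℕ) : ℝ) *
        permAverage (listValues A (p + 1) r)
          (fun g => listAverage φ (fun l => g (A l)) (p + 1) r) := by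
  have hmem : A p ∈ listValues A p r :=
    Finset.mem_image.2 ⟨p, Finset.mem_Icc.2 ⟨le_rfl, hpr.le⟩, rfl⟩
  have hmin : ∀ l, p < l → l ≤ r → A p < A l := fun l h1 h2 => by
    by_contra h3
    have h4 : A l ≠ A p := fun h => by
      have := hA ⟨h1.le, h2⟩ ⟨le_rfl, hpr.le⟩ h; omega
    exact hx (Finset.mem_filter.2 ⟨hmem, A l, Finset.mem_image.2
      ⟨l, Finset.mem_Icc.2 ⟨h1.le, h2⟩, rfl⟩, by omega⟩)
  have hW : nonMin (listValues A p r) = listValues A (p + 1) r := by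
    ext z
    rw [nonMin, Finset.mem_filter]
    simp only [listValues, Finset.mem_image, Finset.mem_Icc]
    constructor
    · rintro ⟨⟨l, hl, rfl⟩, v, ⟨l', hl', rfl⟩, h⟩
      refine ⟨l, ⟨?_, hl.2⟩, rfl⟩
      by_contra hc
      obtain rfl : l = p := by omega
      rcases eq_or_ne l' l with rfl | h1
      · exact lt_irrefl _ h
      · have := hmin l' (by omega) hl'.2; omega
    · rintro ⟨l, hl, rfl⟩
      exact ⟨⟨l, ⟨by omega, hl.2⟩, rfl⟩, A p, ⟨p, ⟨le_rfl, by omega⟩, rfl⟩, hmin l hl.1 hl.2⟩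
  have hsub : listValues A (p + 1) r ⊆ listValues A p r := by rw [← hW]; exact nonMin_subset _
  have hApn : A p ∉ listValues A (p + 1) r := by rwa [← hW]
  have hstep : ∀ g ∈ permsOfFinset (listValues A (p + 1) r),
      rankAverage φ (fun l => g (A l)) p r = φ 0 / ((r + 1 - p : ℕ) : ℝ) +
        ((r - p : ℕ) : ℝ) / ((r + 1 - p : ℕ) : ℝ) *
          rankAverage φ (fun l => g (A l)) (p + 1) r := by
    intro g hg
    have hgp : g (A p) = A p := apply_eq_of_mem_permsOfFinset hg hApn
    have hpart : hoarePartition (fun l => g (A l)) p r = (fun l => g (A l), p, 0) := by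
      refine hoarePartition_of_min _ p r hp hpr.le fun l h1 h2 => ?_
      simp only [hgp]
      have : g (A l) ∈ listValues A (p + 1) r := (apply_mem_of_mem_permsOfFinset hg).2
        (Finset.mem_image.2 ⟨l, Finset.mem_Icc.2 ⟨h1, h2⟩, rfl⟩)
      obtain ⟨l', hl', e⟩ := Finset.mem_image.1 this
      rw [← e]
      rw [Finset.mem_Icc] at hl'
      exact hmin l' (by omega) hl'.2
    rw [rankAverage_split φ _ p r hp hpr, hpart]
    have e1 : rankAverage (fun y => φ (0 + y)) (fun l => g (A l)) p p = φ 0 := by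
      unfold rankAverage
      have : p + 1 - p = 1 := by omega
      rw [this]
      simp [quickselectExchanges_self]
    dsimp only
    rw [e1]
    have e2 : p + 1 - p = 1 := by omega
    rw [e2]
    simp only [zero_add, Nat.cast_one]
    ring
  have hnm : ∀ g ∈ permsOfFinset (listValues A (p + 1) r),
      listValues (fun l => g (A l)) (p + 1) r = listValues A (p + 1) r := fun g hg =>
    listValues_comp (Finset.Subset.refl _) hg
  unfold listAverage
  rw [hW, permAverage_congr hstep, permAverage_add, permAverage_const, permAverage_const_mul,
    ← permAverage_permAverage (listValues A (p + 1) r)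
      (fun g => rankAverage φ (fun l => g (A l)) (p + 1) r)
      (fun _ => nonMin (listValues A (p + 1) r)) (fun _ _ => nonMin_subset _)
      (fun _ _ _ _ => rfl)]
  congr 2
  refine permAverage_congr fun g hg => ?_
  rw [hnm g hg]
  rfl

theorem listAverage_le_of_forall_le (φ : ℕ → ℝ) (A : ℕ → ℕ) (p r : ℕ) (hpr : p ≤ r)
    (hA : InjOn A (Icc p r)) (c : ℝ) (h : ∀ y, y ≤ r - p → φ y ≤ c) : listAverage φ A p r ≤ c := by
  unfold listAverage
  rw [← permAverage_const (nonMin (listValues A p r)) c]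
  refine permAverage_mono fun g _ => ?_
  unfold rankAverage
  have hm : (0 : ℝ) < ((r + 1 - p : ℕ) : ℝ) := by
    have : 0 < r + 1 - p := by omega
    positivity
  rw [div_le_iff₀ hm]
  refine (Finset.sum_le_sum fun R _ => h _ (quickselectExchanges_le _ p r _
    (g.injective.comp_injOn hA))).trans (le_of_eq ?_)
  rw [Finset.sum_const, Finset.card_range, nsmul_eq_mul, mul_comm]

/-! ### Comparison of the number of exchanges with the limit law -/

/-- The map `x ↦ √U x + √U (1 - √U)` of the fixed point equation. -/
noncomputable def rdeMap (U x : ℝ) : ℝ := √U * x + √U * (1 - √U)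

theorem measurable_rdeMap : Measurable fun z : ℝ × ℝ => rdeMap z.1 z.2 := by
  unfold rdeMap
  fun_prop

theorem rdeMap_mem_Icc {U x : ℝ} (hU : U ∈ Icc (0 : ℝ) 1) (hx : x ∈ Icc (0 : ℝ) 1) :
    rdeMap U x ∈ Icc (0 : ℝ) 1 := by
  have h0 := Real.sqrt_nonneg U
  have h1 : √U ≤ 1 := Real.sqrt_le_one.2 hU.2
  unfold rdeMap
  constructor
  · have := hx.1
    have : 0 ≤ 1 - √U := by linarith
    positivity
  · nlinarith [mul_le_mul_of_nonneg_left hx.2 h0, sq_nonneg (1 - √U)]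

theorem SolvesRDE.integrable_comp {μ : Measure ℝ} [IsProbabilityMeasure μ] {ψ : ℝ → ℝ}
    (hm : Measurable ψ) (hb : ∀ z, 0 ≤ ψ z ∧ ψ z ≤ 1) : Integrable ψ μ :=
  Integrable.of_bound hm.aestronglyMeasurable 1 (ae_of_all _ fun z => by
    rw [Real.norm_eq_abs, abs_le]; exact ⟨by linarith [(hb z).1], (hb z).2⟩)

/-- The fixed point equation, integrated against a test function. -/
theorem SolvesRDE.integral_eq {μ : Measure ℝ} (h : SolvesRDE μ) {ψ : ℝ → ℝ} (hm : Measurable ψ)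
    (hb : ∀ z, 0 ≤ ψ z ∧ ψ z ≤ 1) :
    IntervalIntegrable (fun U => ∫ x, ψ (rdeMap U x) ∂μ) volume 0 1 ∧
      ∫ U in (0 : ℝ)..1, ∫ x, ψ (rdeMap U x) ∂μ = ∫ x, ψ x ∂μ := by
  obtain ⟨hP, he⟩ := h
  have hint : Integrable (fun z : ℝ × ℝ => ψ (rdeMap z.1 z.2))
      ((volume.restrict (Icc (0 : ℝ) 1)).prod μ) :=
    Integrable.of_bound (hm.comp measurable_rdeMap).aestronglyMeasurable 1 (ae_of_all _ fun z => by
      rw [Real.norm_eq_abs, abs_le]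
      exact ⟨by linarith [(hb (rdeMap z.1 z.2)).1], (hb _).2⟩)
  constructor
  · rw [intervalIntegrable_iff_integrableOn_Icc_of_le zero_le_one]
    exact hint.integral_prod_left
  · rw [intervalIntegral.integral_of_le zero_le_one, ← integral_Icc_eq_integral_Ioc,
      ← integral_prod _ hint]
    have he' : ((volume.restrict (Icc (0 : ℝ) 1)).prod μ).map
      (fun z : ℝ × ℝ => rdeMap z.1 z.2) = μ := he
    conv_rhs => rw [← he']
    rw [integral_map measurable_rdeMap.aemeasurable hm.aestronglyMeasurable]

/-- `IsDualBound μ y i H` bounds, in dual form, the optimal transport cost for the cost function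
`exp (y (k - z))` between the number of exchanges in a list of length `i`, in random order with
a fixed position of its minimum, and `i` times a random variable with law `μ`. The dual form is
stable under mixtures without any construction of couplings. -/
def IsDualBound (μ : Measure ℝ) (y : ℝ) (i : ℕ) (H : ℝ) : Prop :=
  ∀ (B : ℕ → ℕ) (p r : ℕ), 1 ≤ p → p ≤ r → InjOn B (Icc p r) → i = r + 1 - p →
    ∀ (φ : ℕ → ℝ) (ψ : ℝ → ℝ) (C : ℝ), 0 ≤ C → Measurable ψ → (∀ z, 0 ≤ ψ z ∧ ψ z ≤ 1) →
      (∀ k : ℕ, ∀ z ∈ Icc (0 : ℝ) i, φ k - ψ z ≤ C * Real.exp (y * (k - z))) →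
      listAverage φ B p r ≤ ∫ x, ψ (i * x) ∂μ + C * H

/-- A bound for lists of length `i`, used after one step of the fixed point equation with
parameter `U`: the comparison of `T + Y` with `m √U X + m √U (1 - √U)`. -/
theorem IsDualBound.step {μ : Measure ℝ} {y H : ℝ} {i m : ℕ} (h : IsDualBound μ y i H)
    {B : ℕ → ℕ} {p r : ℕ} (hp : 1 ≤ p) (hpr : p ≤ r) (hB : InjOn B (Icc p r)) (hi : i = r + 1 - p)
    {φ : ℕ → ℝ} {ψ : ℝ → ℝ} {C : ℝ} (hC : 0 ≤ C) (hm : Measurable ψ)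
    (hb : ∀ z, 0 ≤ ψ z ∧ ψ z ≤ 1)
    (hφ : ∀ k : ℕ, ∀ z ∈ Icc (0 : ℝ) m, φ k - ψ z ≤ C * Real.exp (y * (k - z)))
    {U : ℝ} (hU : U ∈ Icc (0 : ℝ) 1) (T : ℕ) {D : ℝ}
    (hD : ∀ x ∈ Icc (0 : ℝ) 1, -(y * (m * rdeMap U x - i * x)) ≤ D) :
    listAverage (fun z => φ (T + z)) B p r ≤
      ∫ x, ψ (m * rdeMap U x) ∂μ + C * H * Real.exp D * Real.exp (y * T) := by
  have hi0 : (0 : ℝ) < i := by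
    have : 0 < i := by omega
    positivity
  have := h B p r hp hpr hB hi (fun z => φ (T + z)) (fun z => ψ (m * rdeMap U (z / i)))
    (C * Real.exp D * Real.exp (y * T)) (by positivity)
    (hm.comp (measurable_const.mul (measurable_rdeMap.comp
      (measurable_const.prodMk (measurable_id.div_const _))))) (fun z => hb _) (fun k z hz => by
      have hx : z / i ∈ Icc (0 : ℝ) 1 :=
        ⟨div_nonneg hz.1 hi0.le, div_le_one_of_le₀ hz.2 hi0.le⟩
      have hr := rdeMap_mem_Icc hU hx
      refine (hφ (T + k) _ ⟨mul_nonneg (Nat.cast_nonneg m) hr.1,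
        mul_le_of_le_one_right (Nat.cast_nonneg m) hr.2⟩).trans ?_
      rw [mul_assoc, mul_assoc, ← Real.exp_add, ← Real.exp_add]
      refine mul_le_mul_of_nonneg_left (Real.exp_le_exp.2 ?_) hC
      have h1 := hD _ hx
      have h2 : (i : ℝ) * (z / i) = z := by field_simp
      rw [h2] at h1
      push_cast
      linarith)
  refine this.trans (le_of_eq ?_)
  have e : ∀ x : ℝ, (i : ℝ) * x / i = x := fun x => by field_simp
  simp only [e]
  ring

/-- A pointwise lower bound on an interval, averaged over it. -/
theorem le_average_add {L K a b : ℝ} {f : ℝ → ℝ} (hab : a < b)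
    (hf : IntervalIntegrable f volume a b) (h : ∀ U ∈ Icc a b, L ≤ f U + K) :
    L ≤ (b - a)⁻¹ * (∫ U in a..b, f U) + K := by
  have h1 : ∫ U in a..b, (L - K) ≤ ∫ U in a..b, f U :=
    intervalIntegral.integral_mono_on hab.le intervalIntegrable_const hf fun U hU => by
      linarith [h U hU]
  rw [intervalIntegral.integral_const, smul_eq_mul] at h1
  have h2 : 0 < b - a := by linarith
  have h3 : L - K ≤ (b - a)⁻¹ * ∫ U in a..b, f U := by
    rw [inv_mul_eq_div, le_div_iff₀ h2]; linarith
  linarith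

/-- The Laplace transform of the loss of length in one step. -/
theorem sum_exp_loss_le {μ : ℝ} (hμ : 0 ≤ μ) (m : ℕ) (hm : 1 ≤ m) :
    ∑ i ∈ Finset.Ico 1 m, 2 * (i : ℝ) * Real.exp (-(μ * (m - i))) ≤
      m * (m - 1) / (1 + μ * (m + 1) / 3) := by
  induction m, hm using Nat.le_induction with
  | base => simp
  | succ m hm ih =>
    have e : ∑ i ∈ Finset.Ico 1 (m + 1), 2 * (i : ℝ) * Real.exp (-(μ * ((m + 1 : ℕ) - i))) =
        Real.exp (-μ) *
          (∑ i ∈ Finset.Ico 1 m, 2 * (i : ℝ) * Real.exp (-(μ * (m - i))) + 2 * m) := by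
      rw [Finset.sum_Ico_succ_top hm, mul_add, Finset.mul_sum]
      congr 1
      · refine Finset.sum_congr rfl fun i _ => ?_
        rw [mul_left_comm, ← Real.exp_add]
        push_cast
        ring_nf
      · push_cast
        ring_nf
    have hexp : Real.exp (-μ) ≤ 1 / (1 + μ) := by
      rw [Real.exp_neg, one_div]
      exact inv_anti₀ (by linarith) (by linarith [Real.add_one_le_exp μ])
    have hm' : (1 : ℝ) ≤ m := by exact_mod_cast hm
    rw [e]
    calc Real.exp (-μ) * (∑ i ∈ Finset.Ico 1 m, 2 * (i : ℝ) * Real.exp (-(μ * (m - i))) + 2 * m)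
        ≤ 1 / (1 + μ) * (m * (m - 1) / (1 + μ * (m + 1) / 3) + 2 * m) := by
          refine mul_le_mul hexp (by linarith) ?_ (by positivity)
          have : 0 ≤ ∑ i ∈ Finset.Ico 1 m, 2 * (i : ℝ) * Real.exp (-(μ * (m - i))) :=
            Finset.sum_nonneg fun i _ => by positivity
          positivity
      _ ≤ _ := by
          push_cast
          rw [div_add' _ _ _ (by positivity), div_mul_div_comm, one_mul,
            div_le_div_iff₀ (by positivity) (by positivity)]
          have : 0 ≤ μ ^ 2 * (m * (m + 1) * (m - 1)) / 9 := by
            have : (0 : ℝ) ≤ m - 1 := by linarith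
            positivity
          nlinarith

/-- By convexity it suffices to consider `t = 13 / 25`, which is what determines this constant. -/
theorem exp_mul_le_one_add_mul {t : ℝ} (h0 : 0 ≤ t) (h1 : t ≤ 13 / 25) :
    Real.exp (t * (43 / 20)) ≤ 1 + t * (81 / 20) := by
  have hE : Real.exp (13 / 25 * (43 / 20)) ≤ 1 + 13 / 25 * (81 / 20) := by
    have e : (13 / 25 * (43 / 20) : ℝ) = 1 + 59 / 500 := by norm_num
    rw [e, Real.exp_add]
    have h1 := Real.exp_one_lt_d9
    have h2 : Real.exp (59 / 500) ≤ 1.1333 := by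
      have := Real.exp_bound' (x := 59 / 500) (by norm_num) (by norm_num) (n := 2) (by norm_num)
      refine this.trans ?_
      norm_num [Finset.sum_range_succ, Nat.factorial]
    have h3 := Real.exp_pos (59 / 500)
    nlinarith
  have hw : 0 ≤ 1 - t / (13 / 25) := by
    rw [sub_nonneg]; exact div_le_one_of_le₀ h1 (by norm_num)
  have hc := convexOn_exp.2 (mem_univ 0) (mem_univ (13 / 25 * (43 / 20) : ℝ)) hw
    (by positivity : 0 ≤ t / (13 / 25)) (by ring)
  simp only [smul_eq_mul, mul_zero, zero_add, Real.exp_zero, mul_one] at hc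
  have e : t / (13 / 25) * (13 / 25 * (43 / 20)) = t * (43 / 20) := by ring
  rw [e] at hc
  refine hc.trans ?_
  have := mul_le_mul_of_nonneg_left hE (by positivity : 0 ≤ t / (13 / 25))
  linarith

theorem le_sqrt_of_le {m : ℕ} (hm : 37 ≤ m) : (243 / 40 : ℝ) ≤ √m := by
  apply Real.le_sqrt_of_sq_le
  have : (37 : ℝ) ≤ m := by exact_mod_cast hm
  norm_num; linarith

/-- The exponential moments contract in one step: the loss of length compensates a shift of at
most `43 / 20`. This needs `exp (43 t / 20) ≤ 1 + t (2 / √m) (m + 1) / 3`, which holds for `t ≤ 13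
/ 25` and `m ≥ 37`. -/
theorem sum_weights_exp_le_one {t : ℝ} (h0 : 0 ≤ t) (h1 : t ≤ 13 / 25) {m : ℕ} (hm : 37 ≤ m) :
    ∑ i ∈ Finset.Ico 1 m, 2 * (i : ℝ) / (m * (m - 1)) *
      Real.exp (t * (43 / 20 - 2 / √m * (m - i))) ≤ 1 := by
  have hs := le_sqrt_of_le hm
  have hs0 : 0 < √(m : ℝ) := by linarith
  have hm' : (37 : ℝ) ≤ m := by exact_mod_cast hm
  have hm1 : (0 : ℝ) < (m : ℝ) - 1 := by linarith
  have hloss := sum_exp_loss_le (μ := t * (2 / √m)) (by positivity) m (by omega)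
  have e : ∑ i ∈ Finset.Ico 1 m, 2 * (i : ℝ) / (m * (m - 1)) *
      Real.exp (t * (43 / 20 - 2 / √m * (m - i))) = Real.exp (t * (43 / 20)) / (m * (m - 1)) *
      ∑ i ∈ Finset.Ico 1 m, 2 * (i : ℝ) * Real.exp (-(t * (2 / √m) * (m - i))) := by
    rw [Finset.mul_sum]
    refine Finset.sum_congr rfl fun i _ => ?_
    have : t * (43 / 20 - 2 / √m * (m - i)) = t * (43 / 20) + -(t * (2 / √m) * (m - i)) := by ring
    rw [this, Real.exp_add]
    ring
  rw [e]
  refine (mul_le_mul_of_nonneg_left hloss (by positivity)).trans ?_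
  have hd : 1 + t * (81 / 20) ≤ 1 + t * (2 / √m) * (m + 1) / 3 := by
    have h2 : 81 / 20 ≤ 2 / √(m : ℝ) * (m + 1) / 3 := by
      have h3 : 2 / √(m : ℝ) * (m + 1) / 3 = (2 * (m + 1)) / (3 * √m) := by field_simp
      rw [h3, le_div_iff₀ (by positivity)]
      nlinarith [Real.mul_self_sqrt (Nat.cast_nonneg m : (0 : ℝ) ≤ m)]
    nlinarith
  have hpos : 0 < 1 + t * (2 / √m) * (m + 1) / 3 := by positivity
  have e2 : Real.exp (t * (43 / 20)) / (m * (m - 1)) *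
      (m * (m - 1) / (1 + t * (2 / √m) * (m + 1) / 3)) =
      Real.exp (t * (43 / 20)) / (1 + t * (2 / √m) * (m + 1) / 3) := by
    field_simp
  rw [e2, div_le_one hpos]
  exact (exp_mul_le_one_add_mul h0 h1).trans hd

/-- With `a = √m` and `b = √i`: the term `6 √m` of the exponent of the bound decreases by more
than the gain `2 (m - i) / √m` that is used up in `sum_weights_exp_le_one`. -/
theorem gain_lower {a b : ℝ} (ha : 0 < a) (hba : b ≤ a) :
    a * (1 - b ^ 2 / a ^ 2) ≤ 6 * (a - b) - 2 / a * (a ^ 2 - b ^ 2) := by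
  have e : 6 * (a - b) - 2 / a * (a ^ 2 - b ^ 2) - a * (1 - b ^ 2 / a ^ 2) =
      (a - b) * (6 * a - 3 * (a + b)) / a := by field_simp; ring
  have : 0 ≤ (a - b) * (6 * a - 3 * (a + b)) / a :=
    div_nonneg (mul_nonneg (by linarith) (by linarith)) ha.le
  linarith

/-- One step from a list whose first entry is not its minimum: the length `i` and its continuous
counterpart `u = m √U` lead to almost the same position. -/
theorem shift_le {m i : ℕ} (hm : 37 ≤ m) (hi1 : 1 ≤ i) (him : i < m) {u x : ℝ} (hu0 : 0 ≤ u)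
    (hu1 : ((i : ℝ) - 1) * i / (m * (m - 1)) ≤ u ^ 2 / m ^ 2)
    (hu2 : u ^ 2 / m ^ 2 ≤ (i : ℝ) * (i + 1) / (m * (m - 1))) (hx : x ∈ Icc (0 : ℝ) 1) :
    |u * x + u * (1 - u / m) - i * x - i * (m - i) / m| + 1 ≤
      43 / 20 + 6 * (√m - √i) - 2 / √m * (m - i) := by
  have hs := le_sqrt_of_le hm
  have hm' : (37 : ℝ) ≤ m := by exact_mod_cast hm
  have hi' : (1 : ℝ) ≤ i := by exact_mod_cast hi1
  have him' : (i : ℝ) + 1 ≤ m := by exact_mod_cast him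
  have hm0 : (0 : ℝ) < m := by linarith
  have hm1 : (0 : ℝ) < (m : ℝ) - 1 := by linarith
  have hgain := gain_lower (a := √m) (b := √i) (by linarith)
    (Real.sqrt_le_sqrt (by linarith))
  rw [Real.sq_sqrt hm0.le, Real.sq_sqrt (by linarith)] at hgain
  rw [div_le_div_iff₀ (by positivity) (by positivity)] at hu1 hu2
  have hlo : (i : ℝ) - 1 ≤ u := by
    apply le_of_sq_le_sq _ hu0
    have h1 : ((i : ℝ) - 1) * i * m ≤ u ^ 2 * (m - 1) :=
      le_of_mul_le_mul_right (by linarith) hm0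
    have h2 : 0 ≤ ((i : ℝ) - 1) * i := mul_nonneg (by linarith) (by linarith)
    nlinarith
  have hhi : u ≤ (i : ℝ) + 1 := by
    apply le_of_sq_le_sq _ (by linarith)
    have h1 : u ^ 2 * (m - 1) ≤ (i : ℝ) * (i + 1) * m :=
      le_of_mul_le_mul_right (by linarith) hm0
    have h2 : (i : ℝ) * (i + 1) * m ≤ (i + 1) ^ 2 * (m - 1) := by nlinarith
    exact le_of_mul_le_mul_right (h1.trans h2) hm1
  have hs1 : (i : ℝ) / m ≤ 1 := div_le_one_of_le₀ (by linarith) hm0.le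
  have e : u * x + u * (1 - u / m) - i * x - i * (m - i) / m =
      (u - i) * (x + 1 - (u + i) / m) := by field_simp; ring
  have hf1 : x + 1 - (u + i) / m ≤ 1 + 1 / 30 + 2 * (1 - i / m) := by
    have h1 : (2 * i - 1) / (m : ℝ) ≤ (u + i) / m := by gcongr; linarith
    have h2 : (2 * i - 1) / (m : ℝ) = 2 * (i / m) - 1 / m := by ring
    have h3 : 1 / (m : ℝ) ≤ 1 / 30 := one_div_le_one_div_of_le (by norm_num) (by linarith)
    linarith [hx.2]
  have hf2 : -1 ≤ x + 1 - (u + i) / m := by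
    have h1 : (u + i) / m ≤ 2 := by rw [div_le_iff₀ hm0]; linarith
    linarith [hx.1]
  rw [e, abs_mul]
  have h1 : |u - i| ≤ 1 := abs_le.2 ⟨by linarith, by linarith⟩
  have h2 : |x + 1 - (u + i) / m| ≤ 1 + 1 / 30 + 2 * (1 - i / m) :=
    abs_le.2 ⟨by linarith, hf1⟩
  have h3 : |u - i| * |x + 1 - (u + i) / m| ≤ 1 * (1 + 1 / 30 + 2 * (1 - i / m)) :=
    mul_le_mul h1 h2 (abs_nonneg _) zero_le_one
  have h4 : 2 * (1 - (i : ℝ) / m) ≤ √m * (1 - i / m) :=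
    mul_le_mul_of_nonneg_right (by linarith) (by linarith)
  linarith

/-- The inequality behind `shift_le_of_min`, with `a = √m`, `σ = √(i / m)` and `δ = u - i`. -/
theorem abs_shift_le {a σ δ f q : ℝ} (ha : 6 ≤ a) (hσ1 : σ ≤ 1) (hδ0 : 0 ≤ δ)
    (hδ : δ ≤ 3 / 2 + a * (1 - σ)) (hf1 : f ≤ 2 - 2 * σ ^ 2) (hf2 : -f ≤ σ ^ 2)
    (hq1 : q ≤ 1) (hq2 : (σ ^ 2) ^ 2 ≤ q) :
    |δ * f + q| + 1 ≤ 43 / 20 + 6 * (a * (1 - σ)) - 2 * a * (1 - σ ^ 2) := by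
  have hτ : 0 ≤ 1 - σ := by linarith
  have hw : 6 * (1 - σ) ≤ a * (1 - σ) := mul_le_mul_of_nonneg_right ha hτ
  have haτ : 0 ≤ a * (1 - σ) := by positivity
  have hq0 : 0 ≤ q := le_trans (by positivity) hq2
  have hgain0 : 0 ≤ a * (1 - σ) * (4 - 2 * σ) := mul_nonneg haτ (by linarith)
  rcases le_or_gt 0 f with hf0 | hf0
  · have h3 : δ * f ≤ (3 / 2 + a * (1 - σ)) * (2 - 2 * σ ^ 2) :=
      mul_le_mul hδ hf1 hf0 (by linarith)
    rw [abs_of_nonneg (add_nonneg (mul_nonneg hδ0 hf0) hq0)]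
    have h4 : 0 ≤ a * (1 - σ) * (1 - 2 * σ) ^ 2 := by positivity
    have h5 : (1 - σ) * (1 + σ) ≤ (1 - σ) * 2 := mul_le_mul_of_nonneg_left (by linarith) hτ
    linarith
  · have h3 : δ * (-f) ≤ (3 / 2 + a * (1 - σ)) * σ ^ 2 :=
      mul_le_mul hδ hf2 (by linarith) (by linarith)
    have h5 : 0 ≤ δ * (-f) := mul_nonneg hδ0 (by linarith)
    have h6 : 0 ≤ a * (1 - σ) * (4 - 2 * σ - σ ^ 2) := mul_nonneg haτ (by nlinarith)
    have h7 : |δ * f + q| ≤ 43 / 20 - 1 + 6 * (a * (1 - σ)) - 2 * a * (1 - σ ^ 2) := by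
      rw [abs_le]
      constructor
      · linarith [sq_nonneg (σ ^ 2 - 3 / 4)]
      · linarith
    linarith

/-- One step from a list of length `m` whose first entry is its minimum: the next list but one has
a length `i` which is compared with `u = m √U` as follows. -/
theorem shift_le_of_min {m i : ℕ} (hm : 37 ≤ m) (hi1 : 1 ≤ i) (him : i + 1 < m) {u x : ℝ}
    (hu0 : 0 ≤ u) (hum : u ≤ m)
    (hu1 : 1 / (m : ℝ) + ((i : ℝ) - 1) * i / (m * (m - 1)) ≤ u ^ 2 / m ^ 2)
    (hu2 : u ^ 2 / m ^ 2 ≤ 1 / (m : ℝ) + (i : ℝ) * (i + 1) / (m * (m - 1)))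
    (hx : x ∈ Icc (0 : ℝ) 1) :
    |u * x + u * (1 - u / m) - i * x - i * (m - 1 - i) / (m - 1)| + 1 ≤
      43 / 20 + 6 * (√m - √i) - 2 / √m * (m - i) := by
  have hs := le_sqrt_of_le hm
  have hm' : (37 : ℝ) ≤ m := by exact_mod_cast hm
  have hi' : (1 : ℝ) ≤ i := by exact_mod_cast hi1
  have him' : (i : ℝ) + 2 ≤ m := by exact_mod_cast him
  have hm0 : (0 : ℝ) < m := by linarith
  have hm1 : (0 : ℝ) < (m : ℝ) - 1 := by linarith
  set a := √(m : ℝ) with ha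
  set b := √(i : ℝ) with hb
  have ha2 : a ^ 2 = m := Real.sq_sqrt hm0.le
  have hb2 : b ^ 2 = i := Real.sq_sqrt (by linarith)
  have hb1 : 1 ≤ b := Real.one_le_sqrt.2 hi'
  have hba : b ≤ a := Real.sqrt_le_sqrt (by linarith)
  have ha0 : 0 < a := by linarith
  have e1 : 1 / (m : ℝ) + ((i : ℝ) - 1) * i / (m * (m - 1)) =
      (m - 1 + (i - 1) * i) / (m * (m - 1)) := by field_simp
  have e2 : 1 / (m : ℝ) + (i : ℝ) * (i + 1) / (m * (m - 1)) =
      (m - 1 + i * (i + 1)) / (m * (m - 1)) := by field_simp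
  rw [e1, div_le_div_iff₀ (by positivity) (by positivity)] at hu1
  rw [e2, div_le_div_iff₀ (by positivity) (by positivity)] at hu2
  have h1 : ((m : ℝ) - 1 + (i - 1) * i) * m ≤ u ^ 2 * (m - 1) :=
    le_of_mul_le_mul_right (by linarith) hm0
  have h2 : u ^ 2 * (m - 1) ≤ ((m : ℝ) - 1 + i * (i + 1)) * m :=
    le_of_mul_le_mul_right (by linarith) hm0
  have hlo : (i : ℝ) ≤ u := by
    apply le_of_sq_le_sq _ hu0
    refine le_of_mul_le_mul_right (le_trans ?_ h1) hm1
    linarith [mul_nonneg hm0.le (by linarith : (0 : ℝ) ≤ m - 1 - i), sq_nonneg (i : ℝ)]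
  have hhi : u ≤ i + 3 / 2 + (a - b) := by
    apply le_of_sq_le_sq _ (by linarith)
    have h3 : u ^ 2 ≤ m + i ^ 2 + 2 * i := by
      refine le_of_mul_le_mul_right (h2.trans ?_) hm1
      linarith [mul_nonneg (by linarith : (0 : ℝ) ≤ i) (by linarith : (0 : ℝ) ≤ m - 2 - i)]
    refine h3.trans ?_
    rw [← ha2, ← hb2]
    linarith [mul_nonneg (sub_nonneg.2 hba)
      (by linarith [mul_nonneg (by linarith : 0 ≤ b) (sub_nonneg.2 hb1)] : 0 ≤ b ^ 2 - b + 1)]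
  have hq : (i : ℝ) ^ 2 / (m * (m - 1)) ≤ 1 := by
    rw [div_le_one (by positivity)]
    linarith [mul_nonneg (by linarith : (0 : ℝ) ≤ m - 2 - i) (by linarith : (0 : ℝ) ≤ m + i)]
  have hq2 : ((i : ℝ) / m) ^ 2 ≤ i ^ 2 / (m * (m - 1)) := by
    rw [div_pow]
    gcongr
    linarith
  have e : u * x + u * (1 - u / m) - i * x - i * (m - 1 - i) / (m - 1) =
      (u - i) * (x + 1 - (u + i) / m) + i ^ 2 / (m * (m - 1)) := by field_simp; ring
  set q := (i : ℝ) ^ 2 / (m * (m - 1)) with hqdef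
  set f := x + 1 - (u + i) / m with hf
  -- the variable `σ = √(i / m)`
  have hσ1 : b / a ≤ 1 := div_le_one_of_le₀ hba ha0.le
  have hσ : b = a * (b / a) := by field_simp
  set σ := b / a
  have hsσ : (i : ℝ) / m = σ ^ 2 := by
    rw [← ha2, ← hb2, hσ]; field_simp
  have hg : 2 / a * (m - i) = 2 * a * (1 - σ ^ 2) := by
    rw [← ha2, ← hb2, hσ]; field_simp
  have hab : a - b = a * (1 - σ) := by rw [hσ]; ring
  have hf1 : f ≤ 2 - 2 * σ ^ 2 := by
    have h3 : (i + i) / (m : ℝ) ≤ (u + i) / m := by gcongr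
    have h4 : (i + i) / (m : ℝ) = 2 * σ ^ 2 := by rw [← hsσ]; ring
    linarith [hx.2]
  have hf2 : -f ≤ σ ^ 2 := by
    have h3 : (u + i) / m ≤ (m + i) / m := by gcongr
    have h4 : (m + i) / (m : ℝ) = 1 + σ ^ 2 := by rw [← hsσ]; field_simp
    linarith [hx.1]
  rw [hsσ] at hq2
  rw [e, hg, hab]
  exact abs_shift_le (by linarith) hσ1 (by linarith) (by linarith) hf1 hf2 hq hq2

/-! ### Induction on the length of the list -/

/-- The bound for the transport cost between the number of exchanges in a list of length `m` and its
limit: `m / 4` is a variance proxy for the fluctuations, and `6 √m` bounds the effect of the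
discretization. -/
noncomputable def costBound (y : ℝ) (m : ℕ) : ℝ := Real.exp (y ^ 2 * m / 8 + 6 * |y| * √m)

theorem costBound_pos (y : ℝ) (m : ℕ) : 0 < costBound y m := Real.exp_pos _

theorem intervalIntegrable_of_subset {f : ℝ → ℝ} (hf : IntervalIntegrable f volume 0 1) {a b : ℝ}
    (ha : 0 ≤ a) (hab : a ≤ b) (hb : b ≤ 1) : IntervalIntegrable f volume a b :=
  hf.mono_set (by rw [uIcc_of_le hab, uIcc_of_le zero_le_one]; exact Icc_subset_Icc ha hb)

/-- For short lists the trivial bound `m` for the distance of the two random variables suffices, as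
`m ≤ 6 √m`. -/
theorem isDualBound_of_le {μ : Measure ℝ} [IsProbabilityMeasure μ]
    (hμ : ∀ᵐ x ∂μ, x ∈ Icc (0 : ℝ) 1) {y : ℝ} {m : ℕ} (hm : m ≤ 36) :
    IsDualBound μ y m (costBound y m) := by
  intro B p r hp hpr hB hi φ ψ C hC hψm hψb hφ
  have hm' : (m : ℝ) ≤ 36 := by exact_mod_cast hm
  have hsq : (m : ℝ) ≤ 6 * √m := by
    have h1 := Real.mul_self_sqrt (Nat.cast_nonneg m : (0 : ℝ) ≤ m)
    have h2 : √(m : ℝ) ≤ 6 := by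
      rw [Real.sqrt_le_left (by norm_num)]; norm_num; exact_mod_cast hm
    nlinarith [Real.sqrt_nonneg (m : ℝ)]
  have hψi : Integrable (fun x => ψ (m * x)) μ :=
    SolvesRDE.integrable_comp (hψm.comp (measurable_const.mul measurable_id)) fun z => hψb _
  refine listAverage_le_of_forall_le φ B p r hpr hB _ fun k hk => ?_
  have hk' : (k : ℝ) ≤ m := by exact_mod_cast (by omega : k ≤ m)
  have h1 : ∀ᵐ x ∂μ, φ k ≤ ψ (m * x) + C * costBound y m := by
    filter_upwards [hμ] with x hx
    have hz : (m : ℝ) * x ∈ Icc (0 : ℝ) m :=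
      ⟨mul_nonneg (Nat.cast_nonneg m) hx.1, mul_le_of_le_one_right (Nat.cast_nonneg m) hx.2⟩
    have h2 := hφ k _ hz
    have h3 : Real.exp (y * (k - m * x)) ≤ costBound y m := by
      refine Real.exp_le_exp.2 ?_
      have h4 : |(k : ℝ) - m * x| ≤ m := abs_le.2
        ⟨by linarith [hz.2, (Nat.cast_nonneg k : (0 : ℝ) ≤ k)], by linarith [hz.1]⟩
      have h5 : y * (k - m * x) ≤ |y| * m := by
        refine (le_abs_self _).trans ?_
        rw [abs_mul]
        exact mul_le_mul_of_nonneg_left h4 (abs_nonneg y)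
      have h6 : 0 ≤ y ^ 2 * m / 8 := by positivity
      nlinarith [mul_le_mul_of_nonneg_left hsq (abs_nonneg y)]
    have := mul_le_mul_of_nonneg_left h3 hC
    linarith
  have h2 := integral_mono_ae (integrable_const (φ k)) (hψi.add (integrable_const _)) h1
  simpa [integral_add hψi (integrable_const _)] using h2

/-- In the step to a list of length `i`, the bound `costBound` for that length and the moment
generating functions combine to the exponential weights of `sum_weights_exp_le_one`. -/
theorem cost_step_le {y d e : ℝ} {m i : ℕ} (he : e + i ≤ m)
    (hd : d + 1 ≤ 43 / 20 + 6 * (√m - √i) - 2 / √m * (m - i)) (w : ℝ) :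
    costBound y i * Real.exp (|y| * d - y * w) * Real.exp (y * w + |y| + y ^ 2 * e / 8) ≤
      costBound y m * Real.exp (|y| * (43 / 20 - 2 / √m * (m - i))) := by
  unfold costBound
  rw [← Real.exp_add, ← Real.exp_add, ← Real.exp_add, Real.exp_le_exp]
  have h1 := mul_le_mul_of_nonneg_left hd (abs_nonneg y)
  have h2 := mul_le_mul_of_nonneg_left he (sq_nonneg y)
  linarith

theorem sq_mul_sqrt_div {m : ℝ} (hm : 0 < m) {U : ℝ} (hU : 0 ≤ U) :
    (m * √U) ^ 2 / m ^ 2 = U := by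
  rw [mul_pow, Real.sq_sqrt hU]; field_simp

theorem mul_rdeMap (m U x : ℝ) (hm : m ≠ 0) :
    m * rdeMap U x = m * √U * x + m * √U * (1 - m * √U / m) := by
  unfold rdeMap; field_simp

/-- The induction step for lists whose first entry is not the minimum. The probability that the
search continues in a list of length `i` equals the length of an interval of `U`. -/
theorem listAverage_le_of_mem_nonMin {μ : Measure ℝ} (hμ : SolvesRDE μ) {y : ℝ}
    (hy : |y| ≤ 13 / 25) {m : ℕ} (hm : 37 ≤ m)
    (ih : ∀ i < m, IsDualBound μ y i (costBound y i))
    {B : ℕ → ℕ} {p r : ℕ} (hp : 1 ≤ p) (hB : InjOn B (Icc p r)) (hi : m = r + 1 - p)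
    (hx : B p ∈ nonMin (listValues B p r))
    {φ : ℕ → ℝ} {ψ : ℝ → ℝ} {C : ℝ} (hC : 0 ≤ C) (hψm : Measurable ψ)
    (hψb : ∀ z, 0 ≤ ψ z ∧ ψ z ≤ 1)
    (hφ : ∀ k : ℕ, ∀ z ∈ Icc (0 : ℝ) m, φ k - ψ z ≤ C * Real.exp (y * (k - z))) :
    listAverage φ B p r ≤ ∫ x, ψ (m * x) ∂μ + C * costBound y m := by
  have hm' : (37 : ℝ) ≤ m := by exact_mod_cast hm
  have hm0 : (0 : ℝ) < m := by linarith
  have hm1 : (0 : ℝ) < (m : ℝ) - 1 := by linarith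
  obtain ⟨hΨi, hΨ⟩ := hμ.integral_eq (ψ := fun z => ψ (m * z))
    (hψm.comp (measurable_const.mul measurable_id)) (fun z => hψb _)
  set Ψ : ℝ → ℝ := fun U => ∫ x, ψ (m * rdeMap U x) ∂μ with hΨdef
  -- `U` between `a i` and `a (i + 1)` corresponds to a sub-list of length `i`
  set a : ℕ → ℝ := fun k => ((k : ℝ) - 1) * k / (m * (m - 1)) with ha
  have ha_succ : ∀ k : ℕ, a (k + 1) = (k : ℝ) * (k + 1) / (m * (m - 1)) := fun k => by
    simp only [ha]; push_cast; ring
  have ha_diff : ∀ k : ℕ, a (k + 1) - a k = 2 * (k : ℝ) / (m * (m - 1)) := fun k => by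
    rw [ha_succ]; simp only [ha]; ring
  have ha1 : a 1 = 0 := by simp [ha]
  have ham : a m = 1 := by simp only [ha]; field_simp
  have hamono : ∀ k l : ℕ, 1 ≤ k → k ≤ l → a k ≤ a l := fun k l hk hkl => by
    simp only [ha]
    have h1 : (1 : ℝ) ≤ k := by exact_mod_cast hk
    have h2 : (k : ℝ) ≤ l := by exact_mod_cast hkl
    gcongr
    linarith
  have ha0 : ∀ k, 1 ≤ k → 0 ≤ a k := fun k hk => ha1 ▸ hamono 1 k le_rfl hk
  have hale : ∀ k, 1 ≤ k → k ≤ m → a k ≤ 1 := fun k hk hkm => ham ▸ hamono k m hk hkm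
  set d : ℕ → ℝ := fun i => 43 / 20 + 6 * (√m - √i) - 2 / √m * (m - i) - 1 with hd
  have hsplit := listAverage_le_of_sublists φ B p r hp hB hx m hi (by omega) y
    (fun i => (a (i + 1) - a i)⁻¹ * ∫ U in a i..a (i + 1), Ψ U)
    (fun i => C * (costBound y i * Real.exp (|y| * d i - y * (i * (m - i) / m))))
    (fun i => mul_nonneg hC (by have := costBound_pos y i; positivity))
    (fun B' p' r' T i hp' hpr' hB' hi' him => by
      have hi1 : 1 ≤ i := by omega
      have hi1' : (1 : ℝ) ≤ i := by exact_mod_cast hi1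
      refine le_average_add (by
        have := ha_diff i
        have h2 : 0 < 2 * (i : ℝ) / (m * (m - 1)) := by positivity
        linarith)
        (intervalIntegrable_of_subset hΨi (ha0 i hi1) (hamono _ _ hi1 (Nat.le_succ i))
          (hale _ (by omega) (by omega))) fun U hU => ?_
      have hU0 : 0 ≤ U := (ha0 i hi1).trans hU.1
      have hU1 : U ≤ 1 := hU.2.trans (hale _ (by omega) (by omega))
      refine ((ih i him).step hp' hpr' hB' hi' hC hψm hψb hφ ⟨hU0, hU1⟩ T
        (D := |y| * d i - y * (i * (m - i) / m)) fun x hx => ?_).trans (le_of_eq (by ring))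
      have hsh := shift_le hm hi1 him (u := m * √U) (by positivity)
        (by rw [sq_mul_sqrt_div hm0 hU0]; exact hU.1)
        (by rw [sq_mul_sqrt_div hm0 hU0, ← ha_succ]; exact hU.2) hx
      rw [← mul_rdeMap _ _ _ hm0.ne'] at hsh
      have h3 : -(y * (m * rdeMap U x - i * x - i * (m - i) / m)) ≤ |y| * d i := by
        refine (neg_le_abs _).trans ?_
        rw [abs_mul]
        exact mul_le_mul_of_nonneg_left (by simp only [hd]; linarith) (abs_nonneg y)
      linarith)
  refine hsplit.trans ?_
  have hv : ∑ i ∈ Finset.Ico 1 m, 2 * (i : ℝ) / (m * (m - 1)) *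
      ((a (i + 1) - a i)⁻¹ * ∫ U in a i..a (i + 1), Ψ U) = ∫ x, ψ (m * x) ∂μ := by
    have hsum := intervalIntegral.sum_integral_adjacent_intervals_Ico (f := Ψ) (μ := volume)
      (a := a) (show 1 ≤ m by omega) fun k hk =>
        intervalIntegrable_of_subset hΨi (ha0 k hk.1) (hamono _ _ hk.1 (Nat.le_succ k))
          (hale _ (by omega) (by have := hk.2; omega))
    rw [ha1, ham] at hsum
    rw [← hΨ, ← hsum]
    refine Finset.sum_congr rfl fun i hi => ?_
    rw [Finset.mem_Ico] at hi
    have : (1 : ℝ) ≤ i := by exact_mod_cast hi.1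
    rw [ha_diff, ← mul_assoc, mul_inv_cancel₀ (by positivity), one_mul]
  simp only [mul_add]
  rw [Finset.sum_add_distrib, hv]
  refine add_le_add le_rfl ?_
  calc _ ≤ ∑ i ∈ Finset.Ico 1 m, C * costBound y m * (2 * (i : ℝ) / (m * (m - 1)) *
        Real.exp (|y| * (43 / 20 - 2 / √m * (m - i)))) := by
        refine Finset.sum_le_sum fun i hi => ?_
        have h1 := cost_step_le (y := y) (d := d i) (e := m - 1 - i) (m := m) (i := i)
          (by linarith) (by simp only [hd]; linarith) (i * (m - i) / m)
        have h2 := mul_le_mul_of_nonneg_left h1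
          (by positivity : 0 ≤ 2 * (i : ℝ) / (m * (m - 1)) * C)
        refine le_trans (le_of_eq ?_) (h2.trans (le_of_eq ?_)) <;> ring
    _ ≤ C * costBound y m * 1 := by
        rw [← Finset.mul_sum]
        exact mul_le_mul_of_nonneg_left (sum_weights_exp_le_one (abs_nonneg y) hy hm)
          (mul_nonneg hC (costBound_pos y m).le)
    _ = _ := mul_one _

/-- The search stops: this event corresponds to `U ≤ 1 / m`, where `m √U` is at most `√m`. -/
theorem zero_le_average_add {μ : Measure ℝ} [IsProbabilityMeasure μ]
    (hsupp : ∀ᵐ x ∂μ, x ∈ Icc (0 : ℝ) 1) {y : ℝ} {m : ℕ} (hm : 37 ≤ m)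
    {φ : ℕ → ℝ} {ψ : ℝ → ℝ} {C : ℝ} (hC : 0 ≤ C) (hψm : Measurable ψ)
    (hψb : ∀ z, 0 ≤ ψ z ∧ ψ z ≤ 1)
    (hφ : ∀ k : ℕ, ∀ z ∈ Icc (0 : ℝ) m, φ k - ψ z ≤ C * Real.exp (y * (k - z)))
    (hΨi : IntervalIntegrable (fun U => ∫ x, ψ (m * rdeMap U x) ∂μ) volume 0 1) :
    φ 0 ≤ (1 / (m : ℝ) - 0)⁻¹ * (∫ U in (0 : ℝ)..(1 / m), ∫ x, ψ (m * rdeMap U x) ∂μ) +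
      C * Real.exp (2 * |y| * √m) := by
  have hm' : (37 : ℝ) ≤ m := by exact_mod_cast hm
  have hm0 : (0 : ℝ) < m := by linarith
  have hs := le_sqrt_of_le hm
  have hss := Real.mul_self_sqrt hm0.le
  have hminv : 0 < 1 / (m : ℝ) := by positivity
  have hminv1 : 1 / (m : ℝ) ≤ 1 := by rw [div_le_one hm0]; linarith
  refine le_average_add hminv (intervalIntegrable_of_subset hΨi le_rfl hminv.le hminv1)
    fun U hU => ?_
  have hU' : U ∈ Icc (0 : ℝ) 1 := ⟨hU.1, hU.2.trans hminv1⟩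
  have h1 : ∀ᵐ x ∂μ, φ 0 ≤ ψ (m * rdeMap U x) + C * Real.exp (2 * |y| * √m) := by
    filter_upwards [hsupp] with x hx
    have hr := rdeMap_mem_Icc hU' hx
    have h2 := hφ 0 (m * rdeMap U x) ⟨mul_nonneg hm0.le hr.1, mul_le_of_le_one_right hm0.le hr.2⟩
    have h3 : m * rdeMap U x ≤ 2 * √m := by
      have h4 : √U ≤ 1 / √m := by
        rw [← Real.sqrt_one, ← Real.sqrt_div zero_le_one]
        exact Real.sqrt_le_sqrt hU.2
      have h5 : rdeMap U x ≤ 2 * (1 / √m) := by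
        unfold rdeMap
        have := Real.sqrt_nonneg U
        nlinarith [hx.2]
      calc m * rdeMap U x ≤ m * (2 * (1 / √m)) := mul_le_mul_of_nonneg_left h5 hm0.le
        _ = 2 * √m := by
          have : (√(m : ℝ)) ≠ 0 := by linarith
          nth_rewrite 1 [← hss]
          field_simp
    have h6 : y * (((0 : ℕ) : ℝ) - m * rdeMap U x) ≤ 2 * |y| * √m := by
      refine (le_abs_self _).trans ?_
      rw [abs_mul, Nat.cast_zero, zero_sub, abs_neg, abs_of_nonneg (mul_nonneg hm0.le hr.1)]
      nlinarith [mul_le_mul_of_nonneg_left h3 (abs_nonneg y)]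
    have := mul_le_mul_of_nonneg_left (Real.exp_le_exp.2 h6) hC
    linarith
  have hψi : Integrable (fun x => ψ (m * rdeMap U x)) μ :=
    SolvesRDE.integrable_comp (ψ := fun x => ψ (m * rdeMap U x))
      (hψm.comp (measurable_const.mul (measurable_rdeMap.comp
        (measurable_const.prodMk measurable_id)))) fun z => hψb _
  have h2 := integral_mono_ae (integrable_const (φ 0)) (hψi.add (integrable_const _)) h1
  simpa [integral_add hψi (integrable_const _)] using h2

/-- The three kinds of continuation of a list whose first entry is the minimum cost together at
most `costBound y m`. -/
theorem cost_of_min_le {y : ℝ} (hy : |y| ≤ 13 / 25) {m : ℕ} (hm : 37 ≤ m) :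
    Real.exp (2 * |y| * √m) / m + costBound y (m - 1) * Real.exp |y| / m +
      costBound y m * ∑ i ∈ Finset.Ico 1 (m - 1), 2 * (i : ℝ) / (m * (m - 1)) *
        Real.exp (|y| * (43 / 20 - 2 / √m * (m - i))) ≤ costBound y m := by
  have hm' : (37 : ℝ) ≤ m := by exact_mod_cast hm
  have hm0 : (0 : ℝ) < m := by linarith
  have hm1 : (0 : ℝ) < (m : ℝ) - 1 := by linarith
  have hs := le_sqrt_of_le hm
  have hcast1 : ((m - 1 : ℕ) : ℝ) = (m : ℝ) - 1 := by
    rw [Nat.cast_sub (by omega)]; simp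
  have hw := sum_weights_exp_le_one (abs_nonneg y) hy hm
  have e1 : m = (m - 1) + 1 := by omega
  have hsum : ∑ i ∈ Finset.Ico 1 m, 2 * (i : ℝ) / (m * (m - 1)) *
      Real.exp (|y| * (43 / 20 - 2 / √m * (m - i))) =
      ∑ i ∈ Finset.Ico 1 (m - 1), 2 * (i : ℝ) / (m * (m - 1)) *
        Real.exp (|y| * (43 / 20 - 2 / √m * (m - i))) +
      2 / m * Real.exp (|y| * (43 / 20 - 2 / √m)) := by
    have h0 := Finset.sum_Ico_succ_top (show 1 ≤ m - 1 by omega) (fun i : ℕ =>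
      2 * (i : ℝ) / (m * (m - 1)) * Real.exp (|y| * (43 / 20 - 2 / √m * (m - i))))
    rw [← e1] at h0
    rw [h0, hcast1]
    congr 1
    have : |y| * (43 / 20 - 2 / √m * (m - (m - 1))) = |y| * (43 / 20 - 2 / √(m : ℝ)) := by ring
    rw [this]
    field_simp
  rw [hsum] at hw
  have ha2 : 2 / √(m : ℝ) ≤ 1 := by rw [div_le_one (by linarith)]; linarith
  have h1 : Real.exp (2 * |y| * √m) ≤
      costBound y m * Real.exp (|y| * (43 / 20 - 2 / √m)) := by
    unfold costBound
    rw [← Real.exp_add, Real.exp_le_exp]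
    have h2 : 0 ≤ |y| * (43 / 20 - 2 / √m) := mul_nonneg (abs_nonneg y) (by linarith)
    have h3 : 0 ≤ y ^ 2 * m / 8 := by positivity
    have h4 : 0 ≤ |y| * √m := by positivity
    linarith
  have h2 : costBound y (m - 1) * Real.exp |y| ≤
      costBound y m * Real.exp (|y| * (43 / 20 - 2 / √m)) := by
    refine mul_le_mul ?_ (Real.exp_le_exp.2 ?_) (Real.exp_pos _).le (costBound_pos y m).le
    · unfold costBound
      rw [Real.exp_le_exp, hcast1]
      gcongr <;> linarith
    · exact le_mul_of_one_le_right (abs_nonneg y) (by linarith)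
  have h3 := mul_le_mul_of_nonneg_left hw (costBound_pos y m).le
  have h4 := div_le_div_of_nonneg_right h1 hm0.le
  have h5 := div_le_div_of_nonneg_right h2 hm0.le
  have h6 : costBound y m * (2 / m * Real.exp (|y| * (43 / 20 - 2 / √m))) =
    costBound y m * Real.exp (|y| * (43 / 20 - 2 / √m)) / m +
    costBound y m * Real.exp (|y| * (43 / 20 - 2 / √m)) / m := by ring
  linarith

set_option maxHeartbeats 1000000 in
/-- The induction step for lists whose first entry is the minimum. With probability `1 / m` the
search stops, and this event corresponds to `U ≤ 1 / m`; with probability `1 / m` the first entry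
of the remaining list is again its minimum, and this event corresponds to `U ≥ 1 - 1 / m`; otherwise
the remaining list of length `m - 1` is partitioned into proper sub-lists. -/
theorem listAverage_le_of_notMem_nonMin {μ : Measure ℝ} (hμ : SolvesRDE μ)
    (hsupp : ∀ᵐ x ∂μ, x ∈ Icc (0 : ℝ) 1) {y : ℝ} (hy : |y| ≤ 13 / 25) {m : ℕ} (hm : 37 ≤ m)
    (ih : ∀ i < m, IsDualBound μ y i (costBound y i))
    {B : ℕ → ℕ} {p r : ℕ} (hp : 1 ≤ p) (hB : InjOn B (Icc p r)) (hi : m = r + 1 - p)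
    (hx : B p ∉ nonMin (listValues B p r))
    {φ : ℕ → ℝ} {ψ : ℝ → ℝ} {C : ℝ} (hC : 0 ≤ C) (hψm : Measurable ψ)
    (hψb : ∀ z, 0 ≤ ψ z ∧ ψ z ≤ 1)
    (hφ : ∀ k : ℕ, ∀ z ∈ Icc (0 : ℝ) m, φ k - ψ z ≤ C * Real.exp (y * (k - z))) :
    listAverage φ B p r ≤ ∫ x, ψ (m * x) ∂μ + C * costBound y m := by
  have hPμ := hμ.1
  have hm' : (37 : ℝ) ≤ m := by exact_mod_cast hm
  have hm0 : (0 : ℝ) < m := by linarith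
  have hm1 : (0 : ℝ) < (m : ℝ) - 1 := by linarith
  have hm2 : (0 : ℝ) < (m : ℝ) - 2 := by linarith
  have hs := le_sqrt_of_le hm
  have hss := Real.mul_self_sqrt hm0.le
  have hcast1 : ((m - 1 : ℕ) : ℝ) = (m : ℝ) - 1 := by
    rw [Nat.cast_sub (by omega)]; simp
  have hcast2 : ((m - 1 - 1 : ℕ) : ℝ) = (m : ℝ) - 2 := by
    rw [Nat.cast_sub (by omega), hcast1]; push_cast; ring
  obtain ⟨hΨi, hΨ⟩ := hμ.integral_eq (ψ := fun z => ψ (m * z))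
    (hψm.comp (measurable_const.mul measurable_id)) (fun z => hψb _)
  set Ψ : ℝ → ℝ := fun U => ∫ x, ψ (m * rdeMap U x) ∂μ with hΨdef
  -- `U` between `a i` and `a (i + 1)` corresponds to a list of length `i`
  set a : ℕ → ℝ := fun k => 1 / (m : ℝ) + ((k : ℝ) - 1) * k / (m * (m - 1)) with ha
  have ha_succ : ∀ k : ℕ, a (k + 1) = 1 / (m : ℝ) + (k : ℝ) * (k + 1) / (m * (m - 1)) :=
    fun k => by simp only [ha]; push_cast; ring
  have ha_diff : ∀ k : ℕ, a (k + 1) - a k = 2 * (k : ℝ) / (m * (m - 1)) := fun k => by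
    rw [ha_succ]; simp only [ha]; ring
  have ha1 : a 1 = 1 / (m : ℝ) := by simp [ha]
  have ham : a (m - 1) = 1 - 1 / (m : ℝ) := by
    simp only [ha]; rw [hcast1]; field_simp; ring
  have hamono : ∀ k l : ℕ, 1 ≤ k → k ≤ l → a k ≤ a l := fun k l hk hkl => by
    simp only [ha]
    have h1 : (1 : ℝ) ≤ k := by exact_mod_cast hk
    have h2 : (k : ℝ) ≤ l := by exact_mod_cast hkl
    gcongr
    linarith
  have hminv : 0 < 1 / (m : ℝ) := by positivity
  have hminv1 : 1 / (m : ℝ) ≤ 1 := by rw [div_le_one hm0]; linarith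
  have ha0 : ∀ k, 1 ≤ k → 0 ≤ a k := fun k hk =>
    hminv.le.trans (ha1 ▸ hamono 1 k le_rfl hk)
  have hale : ∀ k, 1 ≤ k → k ≤ m - 1 → a k ≤ 1 := fun k hk hkm => by
    have := hamono k (m - 1) hk hkm
    rw [ham] at this; linarith
  set d : ℕ → ℝ := fun i => 43 / 20 + 6 * (√m - √i) - 2 / √m * (m - i) - 1 with hd
  have hdead := zero_le_average_add hsupp (y := y) hm hC hψm hψb hφ hΨi
  simp only [← hΨdef] at hdead
  -- the remaining list starts with its minimum
  have hlast : ∀ (B' : ℕ → ℕ) (p' r' : ℕ), 1 ≤ p' → p' ≤ r' → InjOn B' (Icc p' r') →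
      m - 1 = r' + 1 - p' → listAverage φ B' p' r' ≤
        (1 - (1 - 1 / (m : ℝ)))⁻¹ * (∫ U in (1 - 1 / (m : ℝ))..1, Ψ U) +
          C * (costBound y (m - 1) * Real.exp |y|) := by
    intro B' p' r' hp' hpr' hB' hi'
    refine le_average_add (by linarith)
      (intervalIntegrable_of_subset hΨi (by linarith) (by linarith) le_rfl) fun U hU => ?_
    have hU0 : 0 ≤ U := by linarith [hU.1]
    have := (ih (m - 1) (by omega)).step hp' hpr' hB' hi' hC hψm hψb hφ ⟨hU0, hU.2⟩ 0
      (D := |y|) fun x hx => by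
        have h1 : (m : ℝ) - 1 ≤ m * √U := by
          apply le_of_sq_le_sq _ (by positivity)
          rw [mul_pow, Real.sq_sqrt hU0]
          have h2 : (m : ℝ) ^ 2 * (1 - 1 / m) ≤ m ^ 2 * U :=
            mul_le_mul_of_nonneg_left hU.1 (by positivity)
          have h3 : (m : ℝ) ^ 2 * (1 - 1 / m) = m ^ 2 - m := by field_simp
          nlinarith
        have h2 : √U ≤ 1 := Real.sqrt_le_one.2 hU.2
        have h3 : m * rdeMap U x - (m - 1) * x = (m * √U - (m - 1)) * x + √U * (m - m * √U) := by
          unfold rdeMap; ring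
        have h4 : m * √U ≤ m := mul_le_of_le_one_right hm0.le h2
        have h5 : 0 ≤ (m * √U - (m - 1)) * x := mul_nonneg (by linarith) hx.1
        have h6 : (m * √U - (m - 1)) * x ≤ m * √U - (m - 1) :=
          mul_le_of_le_one_right (by linarith) hx.2
        have h7 : 0 ≤ √U * (m - m * √U) := mul_nonneg (Real.sqrt_nonneg U) (by linarith)
        have h8 : √U * (m - m * √U) ≤ m - m * √U := mul_le_of_le_one_left (by linarith) h2
        have h9 : |(m * √U - (m - 1)) * x + √U * (m - m * √U)| ≤ 1 :=
          abs_le.2 ⟨by linarith, by linarith⟩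
        refine (neg_le_abs _).trans ?_
        rw [abs_mul, hcast1, h3]
        exact mul_le_of_le_one_right (abs_nonneg y) h9
    simpa [mul_assoc] using this
  -- the remaining list does not start with its minimum
  have hstep : ∀ (B' : ℕ → ℕ) (p' r' : ℕ), 1 ≤ p' → p' ≤ r' → InjOn B' (Icc p' r') →
      m - 1 = r' + 1 - p' → B' p' ∈ nonMin (listValues B' p' r') → listAverage φ B' p' r' ≤
        ∑ i ∈ Finset.Ico 1 (m - 1), 2 * (i : ℝ) / ((m - 1) * (m - 2)) *
          ((a (i + 1) - a i)⁻¹ * (∫ U in a i..a (i + 1), Ψ U) +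
            C * (costBound y m * Real.exp (|y| * (43 / 20 - 2 / √m * (m - i))))) := by
    intro B' p' r' hp' hpr' hB' hi' hx'
    have hsplit := listAverage_le_of_sublists φ B' p' r' hp' hB' hx' (m - 1) hi' (by omega) y
      (fun i => (a (i + 1) - a i)⁻¹ * ∫ U in a i..a (i + 1), Ψ U)
      (fun i => C * (costBound y i * Real.exp (|y| * d i - y * (i * (m - 1 - i) / (m - 1)))))
      (fun i => mul_nonneg hC (by have := costBound_pos y i; positivity))
      (fun B' p' r' T i hp' hpr' hB' hi' him => by
        have hi1 : 1 ≤ i := by omega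
        have hi1' : (1 : ℝ) ≤ i := by exact_mod_cast hi1
        refine le_average_add (by
          have := ha_diff i
          have h2 : 0 < 2 * (i : ℝ) / (m * (m - 1)) := by positivity
          linarith)
          (intervalIntegrable_of_subset hΨi (ha0 i hi1) (hamono _ _ hi1 (Nat.le_succ i))
            (hale _ (by omega) (by omega))) fun U hU => ?_
        have hU0 : 0 ≤ U := (ha0 i hi1).trans hU.1
        have hU1 : U ≤ 1 := hU.2.trans (hale _ (by omega) (by omega))
        refine ((ih i (by omega)).step hp' hpr' hB' hi' hC hψm hψb hφ ⟨hU0, hU1⟩ T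
          (D := |y| * d i - y * (i * (m - 1 - i) / (m - 1))) fun x hx => ?_).trans
            (le_of_eq (by ring))
        have hsh := shift_le_of_min hm hi1 (by omega) (u := m * √U) (by positivity)
          (mul_le_of_le_one_right hm0.le (Real.sqrt_le_one.2 hU1))
          (by rw [sq_mul_sqrt_div hm0 hU0]; exact hU.1)
          (by rw [sq_mul_sqrt_div hm0 hU0, ← ha_succ]; exact hU.2) hx
        rw [← mul_rdeMap _ _ _ hm0.ne'] at hsh
        have h3 : -(y * (m * rdeMap U x - i * x - i * (m - 1 - i) / (m - 1))) ≤ |y| * d i := by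
          refine (neg_le_abs _).trans ?_
          rw [abs_mul]
          exact mul_le_mul_of_nonneg_left (by simp only [hd]; linarith) (abs_nonneg y)
        linarith)
    refine hsplit.trans (Finset.sum_le_sum fun i hi => ?_)
    rw [hcast1]
    have e1 : (m : ℝ) - 1 - 1 = m - 2 := by ring
    rw [e1]
    refine mul_le_mul_of_nonneg_left (add_le_add le_rfl ?_) (by positivity)
    have h1 := cost_step_le (y := y) (d := d i) (e := m - 2 - i) (m := m) (i := i)
      (by linarith) (by simp only [hd]; linarith) (i * (m - 1 - i) / (m - 1))
    rw [mul_assoc]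
    exact mul_le_mul_of_nonneg_left h1 hC
  -- average over the first entry of the remaining list
  set L1 := (1 - (1 - 1 / (m : ℝ)))⁻¹ * (∫ U in (1 - 1 / (m : ℝ))..1, Ψ U) +
          C * (costBound y (m - 1) * Real.exp |y|) with hL1
  set L2 := ∑ i ∈ Finset.Ico 1 (m - 1), 2 * (i : ℝ) / ((m - 1) * (m - 2)) *
          ((a (i + 1) - a i)⁻¹ * (∫ U in a i..a (i + 1), Ψ U) +
            C * (costBound y m * Real.exp (|y| * (43 / 20 - 2 / √m * (m - i))))) with hL2
  have hB1 : InjOn B (Icc (p + 1) r) := hB.mono (Icc_subset_Icc (Nat.le_succ p) le_rfl)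
  set V := listValues B (p + 1) r with hV
  have hVc : V.card = m - 1 := by rw [hV, card_listValues hB1]; omega
  have hfirst : B (p + 1) ∈ V :=
    Finset.mem_image.2 ⟨p + 1, Finset.mem_Icc.2 ⟨le_rfl, by omega⟩, rfl⟩
  have havg : permAverage V (fun g => listAverage φ (fun l => g (B l)) (p + 1) r) ≤
      (L1 + (m - 2) * L2) / (m - 1) := by
    have h1 := permAverage_apply hfirst (fun z => if z ∈ nonMin V then L2 else L1)
    have h2 : (∑ z ∈ V, if z ∈ nonMin V then L2 else L1) = L1 + (m - 2) * L2 := by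
      have h3 : V.filter (fun z => z ∈ nonMin V) = nonMin V := by
        ext z; simp only [Finset.mem_filter]
        exact ⟨fun h => h.2, fun h => ⟨nonMin_subset V h, h⟩⟩
      have h4 := Finset.card_filter_add_card_filter_not (s := V) (fun z => z ∈ nonMin V)
      rw [h3, card_nonMin, hVc] at h4
      have h5 : (V.filter fun z => z ∉ nonMin V).card = 1 := by omega
      rw [Finset.sum_ite, Finset.sum_const, Finset.sum_const, h3, card_nonMin, hVc, h5,
        nsmul_eq_mul, nsmul_eq_mul, hcast2]
      push_cast; ring
    rw [h2, hVc, hcast1] at h1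
    rw [← h1]
    refine permAverage_mono fun g hg => ?_
    have hvals : listValues (fun l => g (B l)) (p + 1) r = V :=
      listValues_comp (Finset.Subset.refl _) hg
    have hinj : InjOn (fun l => g (B l)) (Icc (p + 1) r) := g.injective.comp_injOn hB1
    split_ifs with hgx
    · exact hstep _ (p + 1) r (by omega) (by omega) hinj (by omega) (by rw [hvals]; exact hgx)
    · exact hlast _ (p + 1) r (by omega) (by omega) hinj (by omega)
  rw [listAverage_of_min φ B p r hp (by omega) hB hx, ← hi]
  have hrp : ((r - p : ℕ) : ℝ) = m - 1 := by
    rw [← hcast1]; congr 1; omega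
  rw [hrp]
  have htotal : φ 0 / m + (m - 1) / m *
      permAverage V (fun g => listAverage φ (fun l => g (B l)) (p + 1) r) ≤
      φ 0 / m + L1 / m + (m - 2) / m * L2 := by
    have := mul_le_mul_of_nonneg_left havg (by positivity : 0 ≤ ((m : ℝ) - 1) / m)
    have e : ((m : ℝ) - 1) / m * ((L1 + (m - 2) * L2) / (m - 1)) =
      L1 / m + (m - 2) / m * L2 := by field_simp
    linarith
  refine htotal.trans ?_
  have hint : (∫ U in (0 : ℝ)..(1 / m), Ψ U) + (∫ U in (1 - 1 / (m : ℝ))..1, Ψ U) +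
      ∑ i ∈ Finset.Ico 1 (m - 1), ∫ U in a i..a (i + 1), Ψ U = ∫ x, ψ (m * x) ∂μ := by
    rw [intervalIntegral.sum_integral_adjacent_intervals_Ico (by omega)
      (fun k hk => intervalIntegrable_of_subset hΨi (ha0 k hk.1) (hamono _ _ hk.1 (Nat.le_succ k))
        (hale _ (by omega) (by have := hk.2; omega))), ha1, ham, ← hΨ,
      ← intervalIntegral.integral_add_adjacent_intervals (a := (0 : ℝ)) (b := 1 / m) (c := 1),
      ← intervalIntegral.integral_add_adjacent_intervals (a := 1 / (m : ℝ)) (b := 1 - 1 / m)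
        (c := 1)]
    · ring
    · exact intervalIntegrable_of_subset hΨi hminv.le (by
        have : 1 / (m : ℝ) ≤ 1 / 37 := one_div_le_one_div_of_le (by norm_num) hm'
        linarith) (by linarith)
    · exact intervalIntegrable_of_subset hΨi (by linarith) (by linarith) le_rfl
    · exact intervalIntegrable_of_subset hΨi le_rfl hminv.le hminv1
    · exact intervalIntegrable_of_subset hΨi hminv.le hminv1 le_rfl
  have hL2' : ((m : ℝ) - 2) / m * L2 = ∑ i ∈ Finset.Ico 1 (m - 1), (∫ U in a i..a (i + 1), Ψ U) +
      C * costBound y m * ∑ i ∈ Finset.Ico 1 (m - 1), 2 * (i : ℝ) / (m * (m - 1)) *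
        Real.exp (|y| * (43 / 20 - 2 / √m * (m - i))) := by
    rw [hL2, Finset.mul_sum, Finset.mul_sum, ← Finset.sum_add_distrib]
    refine Finset.sum_congr rfl fun i hi => ?_
    rw [Finset.mem_Ico] at hi
    have hi0 : (i : ℝ) ≠ 0 := by
      have : (1 : ℝ) ≤ i := by exact_mod_cast hi.1
      linarith
    rw [ha_diff]
    field_simp
  have hcost := cost_of_min_le hy hm
  have hφ0 := div_le_div_of_nonneg_right hdead hm0.le
  have e0 : ((1 / (m : ℝ) - 0)⁻¹ * (∫ U in (0 : ℝ)..(1 / m), Ψ U) +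
      C * Real.exp (2 * |y| * √m)) / m =
      (∫ U in (0 : ℝ)..(1 / m), Ψ U) + C * (Real.exp (2 * |y| * √m) / m) := by
    rw [sub_zero, one_div, inv_inv]; field_simp
  have e1 : L1 / m = (∫ U in (1 - 1 / (m : ℝ))..1, Ψ U) +
      C * (costBound y (m - 1) * Real.exp |y| / m) := by
    rw [hL1, sub_sub_cancel, one_div, inv_inv]; field_simp
  rw [e0] at hφ0
  rw [e1, hL2', ← hint]
  have := mul_le_mul_of_nonneg_left hcost hC
  linarith

/-- The transport bound for lists of every length. -/
theorem isDualBound_costBound {μ : Measure ℝ} (hμ : SolvesRDE μ)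
    (hsupp : ∀ᵐ x ∂μ, x ∈ Icc (0 : ℝ) 1) {y : ℝ} (hy : |y| ≤ 13 / 25) (m : ℕ) :
    IsDualBound μ y m (costBound y m) := by
  have hPμ := hμ.1
  induction m using Nat.strong_induction_on with
  | _ m ih =>
    rcases Nat.lt_or_ge 36 m with hm | hm
    · intro B p r hp hpr hB hi φ ψ C hC hψm hψb hφ
      by_cases hx : B p ∈ nonMin (listValues B p r)
      · exact listAverage_le_of_mem_nonMin hμ hy hm ih hp hB hi hx hC hψm hψb hφ
      · exact listAverage_le_of_notMem_nonMin hμ hsupp hy hm ih hp hB hi hx hC hψm hψb hφ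
    · exact isDualBound_of_le hsupp hm

/-! ### The Kolmogorov–Smirnov distance at a fixed level -/

/-- A permutation of the numbers `1, …, n`, applied to the entries of an array, gives the array of
another permutation. -/
theorem exists_permArray_comp {n : ℕ} {h : Equiv.Perm ℕ} (hh : h ∈ permsOfFinset (Finset.Icc 1 n)) :
    ∃ τ : Equiv.Perm (Fin n), ∀ (σ : Equiv.Perm (Fin n)) (k : ℕ),
      h (permArray σ k) = permArray (τ * σ) k := by
  have hmem : ∀ i : Fin n, 1 ≤ h ((i : ℕ) + 1) ∧ h ((i : ℕ) + 1) ≤ n := fun i =>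
    Finset.mem_Icc.1 ((apply_mem_of_mem_permsOfFinset hh).2
      (Finset.mem_Icc.2 ⟨Nat.le_add_left _ _, i.2⟩))
  let f : Fin n → Fin n := fun i => ⟨h ((i : ℕ) + 1) - 1, by have := hmem i; omega⟩
  have hf : Function.Injective f := fun i j hij => by
    have h1 := hmem i
    have h2 := hmem j
    have h3 : h ((i : ℕ) + 1) - 1 = h ((j : ℕ) + 1) - 1 := congrArg Fin.val hij
    have h4 := h.injective (show h ((i : ℕ) + 1) = h ((j : ℕ) + 1) by omega)
    exact Fin.ext (by omega)
  refine ⟨Equiv.ofBijective f (Finite.injective_iff_bijective.1 hf), fun σ k => ?_⟩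
  unfold permArray
  split_ifs with hk
  · have h1 := hmem (σ ⟨k - 1, by omega⟩)
    simp only [Equiv.Perm.mul_apply, Equiv.ofBijective_apply, f]
    omega
  · exact apply_eq_of_mem_permsOfFinset hh (by simp)

theorem listValues_permArray {n : ℕ} (σ : Equiv.Perm (Fin n)) :
    listValues (permArray σ) 1 n = Finset.Icc 1 n ∧ InjOn (permArray σ) (Icc 1 n) := by
  have hinj : InjOn (permArray σ) (Icc 1 n) := by
    intro k hk l hl hkl
    rw [mem_Icc] at hk hl
    simp only [permArray, hk, hl, and_self, dif_pos, Nat.add_right_cancel_iff] at hkl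
    have := congrArg Fin.val (σ.injective (Fin.ext hkl))
    simp only at this
    omega
  refine ⟨Finset.eq_of_subset_of_card_le (fun v hv => ?_) ?_, hinj⟩
  · obtain ⟨k, hk, rfl⟩ := Finset.mem_image.1 hv
    rw [Finset.mem_Icc] at hk ⊢
    simp only [permArray, hk, and_self, dif_pos]
    have := (σ ⟨k - 1, by omega⟩).2
    omega
  · rw [card_listValues hinj, Nat.card_Icc]

/-- A uniformly random permutation may be averaged in addition over the rearrangements that leave
the minimum in place. -/
theorem sum_listAverage_permArray (φ : ℕ → ℝ) (n : ℕ) :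
    ∑ σ : Equiv.Perm (Fin n), listAverage φ (permArray σ) 1 n =
      ∑ σ : Equiv.Perm (Fin n), rankAverage φ (permArray σ) 1 n := by
  unfold listAverage
  simp only [(listValues_permArray _).1]
  rw [← permAverage_sum]
  refine (permAverage_congr (G := fun _ => ∑ σ : Equiv.Perm (Fin n),
    rankAverage φ (permArray σ) 1 n) fun h hh => ?_).trans (permAverage_const _ _)
  obtain ⟨τ, hτ⟩ := exists_permArray_comp (permsOfFinset_mono (nonMin_subset _) hh)
  simp only [hτ]
  exact Fintype.sum_equiv (Equiv.mulLeft τ) _ _ fun σ => rfl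

theorem normalizedLaw_real (n : ℕ) [NeZero n] {S : Set ℝ} (hS : MeasurableSet S) :
    (normalizedLaw n).real S =
      (∑ σ : Equiv.Perm (Fin n),
        rankAverage (fun k => S.indicator 1 ((k : ℝ) / n)) (permArray σ) 1 n) /
        (n.factorial : ℝ) := by
  classical
  have hn : (n : ℝ) ≠ 0 := Nat.cast_ne_zero.2 (NeZero.ne n)
  have hn' : (n.factorial : ℝ) ≠ 0 := by positivity
  let _ : MeasurableSpace (Equiv.Perm (Fin n) × Fin n) := ⊤
  unfold normalizedLaw rankAverage
  rw [measureReal_def, PMF.toMeasure_map_apply _ _ _ (measurable_from_top) hS,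
    PMF.toMeasure_uniformOfFintype_apply _ MeasurableSpace.measurableSet_top,
    Fintype.card_prod, Fintype.card_perm,
    Fintype.card_fin, ENNReal.toReal_div, ENNReal.toReal_natCast, ENNReal.toReal_natCast,
    ← Finset.sum_div]
  have h1 : (Fintype.card ((fun ω : Equiv.Perm (Fin n) × Fin n => (keyExchanges ω : ℝ) / n) ⁻¹' S) :
      ℝ) = ∑ ω : Equiv.Perm (Fin n) × Fin n, S.indicator 1 ((keyExchanges ω : ℝ) / n) := by
    rw [Fintype.card_subtype, Finset.card_filter]
    push_cast
    refine Finset.sum_congr rfl fun ω _ => ?_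
    simp only [mem_preimage, indicator_apply, Pi.one_apply]
  rw [h1, Fintype.sum_prod_type, Nat.add_sub_cancel]
  simp only [Finset.sum_range]
  push_cast
  field_simp
  rfl

/-- The transport bound for uniformly random permutations. -/
theorem mean_exchanges_le {μ : Measure ℝ} (hμ : SolvesRDE μ)
    (hsupp : ∀ᵐ x ∂μ, x ∈ Icc (0 : ℝ) 1) {y : ℝ} (hy : |y| ≤ 13 / 25) (n : ℕ) [NeZero n]
    {S T : Set ℝ} (hS : MeasurableSet S) (hT : MeasurableSet T) {C : ℝ} (hC : 0 ≤ C)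
    (hST : ∀ x ∈ S, ∀ z ∉ T, 1 ≤ C * Real.exp (y * n * (x - z))) :
    (normalizedLaw n).real S ≤ μ.real T + C * costBound y n := by
  have hn : (0 : ℝ) < n := Nat.cast_pos.2 (NeZero.pos n)
  have hn' : (0 : ℝ) < (n.factorial : ℝ) := by positivity
  rw [normalizedLaw_real n hS, ← sum_listAverage_permArray, div_le_iff₀ hn']
  have hT' : MeasurableSet ((fun z : ℝ => z / n) ⁻¹' T) := measurable_id.div_const _ hT
  have h1 : ∀ σ ∈ (Finset.univ : Finset (Equiv.Perm (Fin n))),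
      listAverage (fun k => S.indicator 1 ((k : ℝ) / n)) (permArray σ) 1 n ≤
        μ.real T + C * costBound y n := fun σ _ => by
    have := isDualBound_costBound hμ hsupp hy n (permArray σ) 1 n le_rfl (NeZero.one_le)
      (listValues_permArray σ).2 (by omega) (fun k => S.indicator 1 ((k : ℝ) / n))
      (((fun z : ℝ => z / n) ⁻¹' T).indicator 1) C hC
      (measurable_one.indicator hT')
      (fun z => ⟨indicator_nonneg (fun _ _ => zero_le_one) z,
        indicator_le_self' (fun _ _ => zero_le_one) z⟩)
      (fun k z _ => by
        have h0 : 0 ≤ C * Real.exp (y * (k - z)) := mul_nonneg hC (Real.exp_pos _).le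
        have h2 : 0 ≤ ((fun z : ℝ => z / n) ⁻¹' T).indicator (1 : ℝ → ℝ) z :=
          indicator_nonneg (fun _ _ => zero_le_one) z
        by_cases hk : (k : ℝ) / n ∈ S
        · by_cases hz : z / n ∈ T
          · rw [indicator_of_mem hk, indicator_of_mem (by exact hz)]
            simpa using h0
          · have h3 := hST _ hk _ hz
            have h4 : y * n * (k / n - z / n) = y * (k - z) := by field_simp
            rw [h4] at h3
            rw [indicator_of_mem hk, Pi.one_apply]
            linarith
        · rw [indicator_of_notMem hk]; linarith)
    refine this.trans (le_of_eq ?_)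
    congr 1
    have h5 : (fun x : ℝ => ((fun z : ℝ => z / n) ⁻¹' T).indicator (1 : ℝ → ℝ) (n * x)) =
        T.indicator 1 := by
      ext x
      have : (n : ℝ) * x / n = x := by field_simp
      by_cases hx : x ∈ T
      · rw [indicator_of_mem hx, indicator_of_mem (by simpa only [mem_preimage, this] using hx)]
        rfl
      · rw [indicator_of_notMem hx,
          indicator_of_notMem (by simpa only [mem_preimage, this] using hx)]
    rw [h5, integral_indicator_one hT]
  refine (Finset.sum_le_card_nsmul _ _ _ h1).trans (le_of_eq ?_)
  rw [Finset.card_univ, Fintype.card_perm, Fintype.card_fin, nsmul_eq_mul, mul_comm]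

instance isProbabilityMeasure_normalizedLaw (n : ℕ) [NeZero n] :
    IsProbabilityMeasure (normalizedLaw n) := PMF.toMeasure.isProbabilityMeasure _

/-- The two distribution functions differ by at most the mass of an interval of length
`(6 + t) / √n` and an error `exp (-2 t²)`. -/
theorem dKS_le_add_exp {μ : Measure ℝ} (hμ : SolvesRDE μ) (hsupp : ∀ᵐ x ∂μ, x ∈ Icc (0 : ℝ) 1)
    {M : ℝ} (hM : ∀ a b : ℝ, a ≤ b → μ.real (Ioc a b) ≤ M * (b - a)) (n : ℕ) [NeZero n] {t : ℝ}
    (ht : 0 ≤ t) (htn : t ≤ 13 / 100 * √n) :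
    dKS (normalizedLaw n) μ ≤ M / √n * (6 + t) + Real.exp (-2 * t ^ 2) := by
  have hPμ := hμ.1
  have hn : (0 : ℝ) < n := Nat.cast_pos.2 (NeZero.pos n)
  have hs : 0 < √(n : ℝ) := Real.sqrt_pos.2 hn
  have hss := Real.mul_self_sqrt hn.le
  set lam := 4 * t / √(n : ℝ) with hlam
  have hlam0 : 0 ≤ lam := by positivity
  have hlam1 : lam ≤ 13 / 25 := by rw [hlam, div_le_iff₀ hs]; linarith
  set r := (6 + t) / √(n : ℝ) with hr
  have hr0 : 0 ≤ r := by positivity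
  set C := Real.exp (-(lam * n * r)) with hC
  have hC0 : 0 ≤ C := (Real.exp_pos _).le
  have hcost : ∀ y : ℝ, |y| = lam → C * costBound y n = Real.exp (-2 * t ^ 2) := fun y hy => by
    unfold costBound
    rw [hC, ← Real.exp_add, ← sq_abs, hy]
    congr 1
    rw [hlam, hr]
    field_simp
    nlinarith
  have hexp : ∀ v : ℝ, r ≤ v → 1 ≤ C * Real.exp (lam * n * v) := fun v hv => by
    rw [hC, ← Real.exp_add, Real.one_le_exp_iff]
    have := mul_le_mul_of_nonneg_left hv (by positivity : 0 ≤ lam * n)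
    linarith
  unfold dKS
  refine ciSup_le fun x => abs_le.2 ⟨?_, ?_⟩
  · -- compare the tails `(x, ∞)` and `(x - r, ∞)`
    have h1 := mean_exchanges_le hμ hsupp (y := lam) (by rwa [abs_of_nonneg hlam0]) n
      (measurableSet_Ioi (a := x)) (measurableSet_Ioi (a := x - r)) hC0 fun w hw z hz =>
        hexp _ (by rw [mem_Ioi] at hw hz; linarith)
    rw [hcost lam (abs_of_nonneg hlam0), ← compl_Iic, ← compl_Iic,
      probReal_compl_eq_one_sub measurableSet_Iic,
      probReal_compl_eq_one_sub measurableSet_Iic] at h1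
    have h2 : μ.real (Iic x) = μ.real (Iic (x - r)) + μ.real (Ioc (x - r) x) := by
      rw [← measureReal_union (by
        rw [Set.disjoint_left]; intro z hz hz'; exact absurd hz'.1 (not_lt.2 hz))
        measurableSet_Ioc, Iic_union_Ioc_eq_Iic (by linarith)]
    have h3 := hM (x - r) x (by linarith)
    have h4 : M * (x - (x - r)) = M / √n * (6 + t) := by rw [hr]; ring
    linarith
  · have h1 := mean_exchanges_le hμ hsupp (y := -lam) (by rwa [abs_neg, abs_of_nonneg hlam0]) n
      (measurableSet_Iic (a := x)) (measurableSet_Iic (a := x + r)) hC0 fun w hw z hz => by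
        rw [mem_Iic] at hw hz
        rw [show -lam * n * (w - z) = lam * n * (z - w) by ring]
        exact hexp _ (by linarith)
    rw [hcost (-lam) (by rw [abs_neg, abs_of_nonneg hlam0])] at h1
    have h2 : μ.real (Iic (x + r)) = μ.real (Iic x) + μ.real (Ioc x (x + r)) := by
      rw [← measureReal_union (by
        rw [Set.disjoint_left]; intro z hz hz'; exact absurd hz'.1 (not_lt.2 hz))
        measurableSet_Ioc, Iic_union_Ioc_eq_Iic (by linarith)]
    have h3 := hM x (x + r) (by linarith)
    have h4 : M * (x + r - x) = M / √n * (6 + t) := by rw [hr]; ring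
    linarith

theorem dKS_le_one (μ ν : Measure ℝ) [IsProbabilityMeasure μ] [IsProbabilityMeasure ν] :
    dKS μ ν ≤ 1 :=
  ciSup_le fun x => abs_le.2 ⟨by
    linarith [measureReal_nonneg (μ := μ) (s := Iic x), measureReal_le_one (μ := ν) (s := Iic x)],
    by
    linarith [measureReal_nonneg (μ := ν) (s := Iic x), measureReal_le_one (μ := μ) (s := Iic x)]⟩

/-! ### From the exponential tail to the moment constants -/

theorem two_pow_le_Gamma {x : ℝ} (hx : 7 ≤ x) : (2 : ℝ) ^ (x : ℝ) ≤ Real.Gamma (x + 1) := by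
  have hf : 7 ≤ ⌊x⌋₊ := Nat.le_floor (by exact_mod_cast hx)
  have h1 : ∀ n : ℕ, 7 ≤ n → 2 ^ (n + 1) ≤ n.factorial := fun n hn => by
    induction n, hn using Nat.le_induction with
    | base => decide
    | succ k hk ih =>
      rw [Nat.factorial_succ, pow_succ]
      nlinarith
  have h2 : (⌊x⌋₊ : ℝ) ≤ x := Nat.floor_le (by linarith)
  have h2' : (7 : ℝ) ≤ ⌊x⌋₊ := by exact_mod_cast hf
  calc (2 : ℝ) ^ (x : ℝ) ≤ (2 : ℝ) ^ ((⌊x⌋₊ + 1 : ℕ) : ℝ) :=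
        Real.rpow_le_rpow_of_exponent_le (by norm_num) (by
          push_cast; exact (Nat.lt_floor_add_one x).le)
    _ ≤ (⌊x⌋₊.factorial : ℝ) := by
        rw [Real.rpow_natCast]; exact_mod_cast h1 _ hf
    _ = Real.Gamma (⌊x⌋₊ + 1) := (Real.Gamma_nat_eq_factorial _).symm
    _ ≤ Real.Gamma (x + 1) := Real.Gamma_strictMonoOn_Ici.monotoneOn
        (by rw [mem_Ici]; linarith) (by rw [mem_Ici]; linarith) (by linarith)

/-- The moment `∫ p t ^ (p - 1) exp (-2 t²) dt` over the positive half-line. -/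
noncomputable def gaussMoment (p : ℝ) : ℝ := Real.Gamma (p / 2 + 1) / (2 : ℝ) ^ (p / 2)

theorem gaussMoment_pos {p : ℝ} (hp : 0 < p) : 0 < gaussMoment p :=
  div_pos (Real.Gamma_pos_of_pos (by linarith)) (by positivity)

theorem tauConst_rpow {p : ℝ} (hp : 0 < p) :
    0 < tauConst p ∧ tauConst p ^ p = (1 + gaussMoment p) / 2 := by
  have h := gaussMoment_pos hp
  have h1 : 1 / 2 + Real.Gamma (p / 2 + 1) / (2 : ℝ) ^ (p / 2 + 1) = (1 + gaussMoment p) / 2 := by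
    unfold gaussMoment
    rw [Real.rpow_add_one (by norm_num)]
    field_simp
  unfold tauConst
  rw [h1]
  refine ⟨by positivity, ?_⟩
  rw [← Real.rpow_mul (by positivity), one_div_mul_cancel hp.ne', Real.rpow_one]

/-- `κ_p` exceeds `7 (2 p + 3) / (2 p - 1)` by at least the `L^p` norm of the exponential tail. -/
theorem gaussMoment_rpow_le {p : ℝ} (hp : 1 ≤ p) :
    gaussMoment p ^ (1 / p) ≤ (2 * p + 3) / (2 * p - 1) * tauConst p := by
  have hp0 : 0 < p := by linarith
  have hG := gaussMoment_pos hp0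
  obtain ⟨h1, h2⟩ := tauConst_rpow hp0
  have h3 : gaussMoment p ≤ ((1 + 1 / p) * tauConst p) ^ p := by
    rw [Real.mul_rpow (by positivity) h1.le, h2]
    have := one_add_mul_self_le_rpow_one_add (s := 1 / p) (by
      have : 0 < 1 / p := by positivity
      linarith) hp
    rw [mul_one_div_cancel hp0.ne'] at this
    nlinarith
  calc gaussMoment p ^ (1 / p) ≤ (((1 + 1 / p) * tauConst p) ^ p) ^ (1 / p) :=
        Real.rpow_le_rpow hG.le h3 (by positivity)
    _ = (1 + 1 / p) * tauConst p := by
        rw [← Real.rpow_mul (by positivity), mul_one_div_cancel hp0.ne', Real.rpow_one]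
    _ ≤ _ := by
        refine mul_le_mul_of_nonneg_right ?_ h1.le
        rw [le_div_iff₀ (by linarith)]
        field_simp
        nlinarith

/-- As a consequence, the asserted bound exceeds `1` unless `n ≥ 65`. -/
theorem eight_le_kappaConst {p : ℝ} (hp : 1 ≤ p) : 8 ≤ kappaConst p := by
  have hp0 : 0 < p := by linarith
  obtain ⟨h1, h2⟩ := tauConst_rpow hp0
  unfold kappaConst
  rw [div_mul_eq_mul_div, le_div_iff₀ (by linarith)]
  rcases le_or_gt p (29 / 2) with h | h
  · nlinarith
  · have h3 : 1 ≤ tauConst p := by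
      by_contra hlt
      push Not at hlt
      have h4 := Real.rpow_lt_one h1.le hlt hp0
      have h5 : 1 ≤ gaussMoment p := by
        unfold gaussMoment
        rw [one_le_div (by positivity)]
        exact two_pow_le_Gamma (by linarith)
      linarith
    nlinarith

/-- The concave function `x ^ q` has slope at least `q` on `[0, 1]`. -/
theorem mul_sub_le_rpow_sub {q A B : ℝ} (hq0 : 0 ≤ q) (hq1 : q ≤ 1) (hB : 0 ≤ B) (hBA : B ≤ A)
    (hA : A ≤ 1) : q * (A - B) ≤ A ^ q - B ^ q := by
  rcases hB.eq_or_lt with rfl | hB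
  · rcases hBA.eq_or_lt with rfl | hA0
    · simp
    · have h0 : A ≤ A ^ q := by
        simpa using Real.rpow_le_rpow_of_exponent_ge hA0 hA hq1
      rcases hq0.eq_or_lt with rfl | hq
      · simp
      · rw [Real.zero_rpow hq.ne']; nlinarith
  · have hA0 : 0 < A := by linarith
    have h1 := Real.geom_mean_le_arith_mean2_weighted hq0 (by linarith : 0 ≤ 1 - q) hB.le hA0.le
      (by ring)
    have h2 : A ^ q * A ^ (1 - q) = A := by rw [← Real.rpow_add hA0]; simp
    have h3 : A ^ (1 - q) ≤ 1 := Real.rpow_le_one hA0.le hA (by linarith)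
    have h4 : 0 < A ^ (1 - q) := Real.rpow_pos_of_pos hA0 _
    have h5 : B ^ q ≤ A ^ q := Real.rpow_le_rpow hB.le hBA hq0
    nlinarith

/-- The integral of the exponential tail bound, weighted by `p t ^ (p - 1)`. -/
theorem rpow_le_gaussMoment {p d K : ℝ} (hp : 1 ≤ p) (hd : 0 < d) (hK : 0 < K)
    (h : ∀ t, 0 ≤ t → t ≤ d / K → d - K * t ≤ Real.exp (-2 * t ^ 2)) :
    d ^ (p + 1) ≤ (p + 1) * (K ^ p * gaussMoment p) := by
  have hp0 : 0 < p := by linarith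
  set a := d / K with ha
  have ha0 : 0 < a := by positivity
  have hint : ∫ t in Ioi (0 : ℝ), t ^ (p - 1) * Real.exp (-2 * t ^ (2 : ℝ)) =
      gaussMoment p / p := by
    rw [integral_rpow_mul_exp_neg_mul_rpow (by norm_num) (by linarith) (by norm_num)]
    unfold gaussMoment
    rw [Real.Gamma_add_one (by positivity), sub_add_cancel, neg_div, Real.rpow_neg (by norm_num)]
    field_simp
  have hintg : IntegrableOn (fun t : ℝ => t ^ (p - 1) * Real.exp (-2 * t ^ (2 : ℝ))) (Ioi 0) :=
    integrableOn_rpow_mul_exp_neg_mul_rpow (by linarith) (by norm_num) (by norm_num)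
  have h1 : ∫ t in (0 : ℝ)..a, t ^ (p - 1) * (d - K * t) ≤ gaussMoment p / p := by
    rw [← hint, intervalIntegral.integral_of_le ha0.le]
    refine (setIntegral_mono_on ?_ (hintg.mono_set Ioc_subset_Ioi_self) measurableSet_Ioc
      fun t ht => ?_).trans (setIntegral_mono_set hintg ?_ Ioc_subset_Ioi_self.eventuallyLE)
    · refine (ContinuousOn.integrableOn_Icc ?_).mono_set Ioc_subset_Icc_self
      exact (continuousOn_id.rpow_const fun x hx => Or.inr (by linarith)).mul (by fun_prop)
    · refine mul_le_mul_of_nonneg_left ?_ (Real.rpow_nonneg ht.1.le _)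
      rw [Real.rpow_two]
      exact h t ht.1.le ht.2
    · filter_upwards [ae_restrict_mem measurableSet_Ioi] with t ht
      exact mul_nonneg (Real.rpow_nonneg (le_of_lt ht) _) (Real.exp_pos _).le
  have h2 : ∫ t in (0 : ℝ)..a, t ^ (p - 1) * (d - K * t) =
      d * (a ^ p / p) - K * (a ^ (p + 1) / (p + 1)) := by
    have e : ∀ t ∈ uIcc 0 a, t ^ (p - 1) * (d - K * t) = d * t ^ (p - 1) - K * t ^ p := by
      intro t ht
      rw [uIcc_of_le ha0.le] at ht
      rcases ht.1.eq_or_lt with rfl | h0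
      · rw [Real.zero_rpow hp0.ne']; ring
      · have : t ^ p = t ^ (p - 1) * t := by
          rw [← Real.rpow_add_one h0.ne']; congr 1; ring
        rw [this]; ring
    rw [intervalIntegral.integral_congr e, intervalIntegral.integral_sub
      ((intervalIntegral.intervalIntegrable_rpow' (by linarith)).const_mul _)
      ((intervalIntegral.intervalIntegrable_rpow' (by linarith)).const_mul _),
      intervalIntegral.integral_const_mul, intervalIntegral.integral_const_mul,
      integral_rpow (Or.inl (by linarith)), integral_rpow (Or.inl (by linarith)),
      Real.zero_rpow (by linarith), Real.zero_rpow (by linarith)]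
    simp
  have hda : d = K * a := by rw [ha]; field_simp
  have h3 : a ^ (p + 1) = a ^ p * a := Real.rpow_add_one ha0.ne' p
  have h4 : d ^ (p + 1) = K ^ p * K * (a ^ p * a) := by
    rw [← h3, ← Real.rpow_add_one hK.ne', ← Real.mul_rpow hK.le ha0.le, ← hda]
  rw [h2, h3, hda] at h1
  have h5 : K * a * (a ^ p / p) - K * (a ^ p * a / (p + 1)) =
      K * (a ^ p * a) / (p * (p + 1)) := by field_simp; ring
  rw [h5, div_le_div_iff₀ (by positivity) hp0] at h1
  have h6 : K * (a ^ p * a) ≤ (p + 1) * gaussMoment p := by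
    have : p * (K * (a ^ p * a)) ≤ p * ((p + 1) * gaussMoment p) := by linarith
    exact le_of_mul_le_mul_left this hp0
  have h7 : 0 < K ^ p := Real.rpow_pos_of_pos hK p
  rw [h4]
  nlinarith

/-- The term `7 K`, the effect of the discretization, is absorbed into the constant `κ_p`. -/
theorem seven_mul_add_le {p K : ℝ} (hp : 1 ≤ p) (hK : 0 < K) (hKκ : K * kappaConst p ≤ 1) :
    7 * K + (p + 1) ^ (1 / (p + 1)) * (K * gaussMoment p ^ (1 / p)) ^ (p / (p + 1)) ≤
      (p + 1) ^ (1 / (p + 1)) * (K * kappaConst p) ^ (p / (p + 1)) := by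
  have hp0 : 0 < p := by linarith
  have hg : 0 < gaussMoment p ^ (1 / p) := Real.rpow_pos_of_pos (gaussMoment_pos hp0) _
  have hc : 1 ≤ (p + 1) ^ (1 / (p + 1)) := Real.one_le_rpow (by linarith) (by positivity)
  have hκ : 7 * ((2 * p + 3) / (2 * p - 1)) + gaussMoment p ^ (1 / p) ≤ kappaConst p := by
    have := gaussMoment_rpow_le hp
    unfold kappaConst
    linarith
  have hr : 1 ≤ p / (p + 1) * ((2 * p + 3) / (2 * p - 1)) := by
    rw [div_mul_div_comm, one_le_div (mul_pos (by linarith) (by linarith))]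
    nlinarith
  have hr0 : 0 < (2 * p + 3) / (2 * p - 1) := div_pos (by linarith) (by linarith)
  have h1 := mul_sub_le_rpow_sub (q := p / (p + 1)) (A := K * kappaConst p)
    (B := K * gaussMoment p ^ (1 / p)) (by positivity) (by rw [div_le_one (by linarith)]; linarith)
    (by positivity) (mul_le_mul_of_nonneg_left (by linarith) hK.le) hKκ
  have h2 : 7 * K ≤ p / (p + 1) * (K * kappaConst p - K * gaussMoment p ^ (1 / p)) := by
    have h3 : K * (7 * ((2 * p + 3) / (2 * p - 1))) ≤
        K * kappaConst p - K * gaussMoment p ^ (1 / p) := by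
      rw [← mul_sub]; exact mul_le_mul_of_nonneg_left (by linarith) hK.le
    have h4 := mul_le_mul_of_nonneg_left h3 (by positivity : 0 ≤ p / (p + 1))
    have h5 := mul_le_mul_of_nonneg_left hr (by positivity : 0 ≤ 7 * K)
    linarith
  have h6 : 0 ≤ (K * kappaConst p) ^ (p / (p + 1)) -
      (K * gaussMoment p ^ (1 / p)) ^ (p / (p + 1)) :=
    le_trans (by positivity) (h2.trans h1)
  nlinarith

/-- At the right end `t = 13 √n / 100` of the range of the tail bound, the exponential term is
smaller than `1 / √n`. -/
theorem sqrt_lt_exp {n : ℕ} (hn : 65 ≤ n) : √(n : ℝ) < Real.exp (2 * (13 / 100 * √n) ^ 2) := by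
  have h1 : (65 : ℝ) ≤ n := by exact_mod_cast hn
  have h2 : (403 / 50 : ℝ) ≤ √n := Real.le_sqrt_of_sq_le (by norm_num; linarith)
  have h3 : (7.38 : ℝ) ≤ Real.exp 2 := by
    have := Real.exp_one_gt_d9
    have e : Real.exp 2 = Real.exp 1 * Real.exp 1 := by rw [← Real.exp_add]; norm_num
    rw [e]; nlinarith
  have h4 : Real.exp (2 * (13 / 100 * √n) ^ 2) =
      Real.exp 2 * Real.exp (2 * (13 / 100 * √n) ^ 2 - 2) := by rw [← Real.exp_add]; ring_nf
  have h5 := Real.add_one_le_exp (2 * (13 / 100 * √(n : ℝ)) ^ 2 - 2)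
  have h6 : 0 ≤ 2 * (13 / 100 * √(n : ℝ)) ^ 2 - 2 + 1 := by nlinarith
  have h7 : 7.38 * (2 * (13 / 100 * √(n : ℝ)) ^ 2 - 2 + 1) ≤
      Real.exp 2 * Real.exp (2 * (13 / 100 * √(n : ℝ)) ^ 2 - 2) :=
    mul_le_mul h3 h5 h6 (Real.exp_pos _).le
  rw [h4]
  nlinarith

/-- Optimizing the tail bound: where `t` ranges up to `(δ - 7 K) / K`, it is integrated against
`p t ^ (p - 1)`; if this range is not available, then the tail bound at the largest `t` is
contradictory. -/
theorem le_rate_of_tail_bound {p M δ : ℝ} {n : ℕ} (hp : 1 ≤ p) (hM : 1 ≤ M) (hn : 0 < n)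
    (hδ : δ ≤ 1) (h : ∀ t : ℝ, 0 ≤ t → t ≤ 13 / 100 * √n →
      δ ≤ M / √n * (6 + t) + Real.exp (-2 * t ^ 2)) :
    δ ≤ (p + 1) ^ (1 / (p + 1)) * (M / √n * kappaConst p) ^ (p / (p + 1)) := by
  have hp0 : 0 < p := by linarith
  have hs : 0 < √(n : ℝ) := Real.sqrt_pos.2 (by exact_mod_cast hn)
  have hc : 1 ≤ (p + 1) ^ (1 / (p + 1)) := Real.one_le_rpow (by linarith) (by positivity)
  have hκ := eight_le_kappaConst hp
  set K := M / √(n : ℝ) with hK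
  have hK0 : 0 < K := by positivity
  rcases le_or_gt 1 (K * kappaConst p) with hbig | hsmall
  · -- the bound is trivial
    have h1 := Real.one_le_rpow hbig (by positivity : 0 ≤ p / (p + 1))
    nlinarith
  have hM' : 1 ≤ √(n : ℝ) * K := by rw [hK]; field_simp; linarith
  have hn65 : 65 ≤ n := by
    have h1 : 8 < √(n : ℝ) := by nlinarith
    have h2 : (64 : ℝ) < n := by
      have := Real.mul_self_sqrt (Nat.cast_nonneg n : (0 : ℝ) ≤ n)
      nlinarith
    exact_mod_cast h2
  refine le_trans ?_ (seven_mul_add_le hp hK0 hsmall.le)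
  have hd : δ - 7 * K ≤ K * (13 / 100 * √n) := by
    by_contra hlt
    push Not at hlt
    have h1 := h _ (by positivity) le_rfl
    have h2 : K < Real.exp (-2 * (13 / 100 * √(n : ℝ)) ^ 2) := by nlinarith
    have h3 := sqrt_lt_exp hn65
    have h4 : Real.exp (-2 * (13 / 100 * √(n : ℝ)) ^ 2) *
        Real.exp (2 * (13 / 100 * √(n : ℝ)) ^ 2) = 1 := by
      rw [← Real.exp_add, ← Real.exp_zero]; congr 1; ring
    have h5 : √(n : ℝ) * K < 1 := by
      rw [← h4, mul_comm]
      exact mul_lt_mul h2 h3.le hs (Real.exp_pos _).le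
    linarith
  have hG := gaussMoment_pos hp0
  rcases le_or_gt (δ - 7 * K) 0 with h0 | h0
  · have : 0 ≤ (p + 1) ^ (1 / (p + 1)) * (K * gaussMoment p ^ (1 / p)) ^ (p / (p + 1)) := by
      positivity
    linarith
  have h1 := rpow_le_gaussMoment hp h0 hK0 fun t ht0 ht => by
    rw [le_div_iff₀ hK0] at ht
    have := h t ht0 (by
      have : K * t ≤ K * (13 / 100 * √n) := by linarith
      exact le_of_mul_le_mul_left this hK0)
    linarith
  have h2 := Real.rpow_le_rpow (by positivity) h1 (by positivity : 0 ≤ 1 / (p + 1))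
  rw [← Real.rpow_mul h0.le, mul_one_div_cancel (by linarith), Real.rpow_one,
    Real.mul_rpow (by positivity) (by positivity)] at h2
  have h3 : (K ^ p * gaussMoment p) ^ (1 / (p + 1)) =
      (K * gaussMoment p ^ (1 / p)) ^ (p / (p + 1)) := by
    have : K ^ p * gaussMoment p = (K * gaussMoment p ^ (1 / p)) ^ p := by
      rw [Real.mul_rpow hK0.le (by positivity), ← Real.rpow_mul hG.le, one_div_mul_cancel hp0.ne',
        Real.rpow_one]
    rw [this, ← Real.rpow_mul (by positivity)]
    congr 1
    ring
  rw [h3] at h2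
  linarith

/-- The asserted bound in terms of `p = -1 + 1 / (2 ε)`, for which `2 ε = 1 / (p + 1)`. -/
theorem omegaConst_mul_rpow {M ε : ℝ} (hM : 0 ≤ M) (hε : 0 < ε) (hε4 : ε ≤ 1 / 4) {n : ℕ}
    (hn : 0 < n) :
    omegaConst M ε * (n : ℝ) ^ (-(1 / 2 : ℝ) + ε) =
      ((-1 + 1 / (2 * ε)) + 1) ^ (1 / ((-1 + 1 / (2 * ε)) + 1)) *
        (M / √n * kappaConst (-1 + 1 / (2 * ε))) ^
          ((-1 + 1 / (2 * ε)) / ((-1 + 1 / (2 * ε)) + 1)) := by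
  have hn' : (0 : ℝ) < n := by exact_mod_cast hn
  have hp : 1 ≤ -1 + 1 / (2 * ε) := by
    have : 2 ≤ 1 / (2 * ε) := by rw [le_div_iff₀ (by linarith)]; linarith
    linarith
  have hκ := eight_le_kappaConst hp
  have e1 : (-1 + 1 / (2 * ε)) + 1 = 1 / (2 * ε) := by ring
  have e2 : 1 / (1 / (2 * ε)) = 2 * ε := one_div_one_div _
  have e3 : (-1 + 1 / (2 * ε)) / (1 / (2 * ε)) = 1 - 2 * ε := by field_simp; ring
  have e4 : M / √n * kappaConst (-1 + 1 / (2 * ε)) =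
      M * kappaConst (-1 + 1 / (2 * ε)) * (n : ℝ) ^ (-(1 / 2 : ℝ)) := by
    rw [Real.rpow_neg hn'.le, ← Real.sqrt_eq_rpow]; ring
  rw [e1, e2, e3, e4, Real.mul_rpow (by positivity) (by positivity), ← Real.rpow_mul hn'.le]
  unfold omegaConst
  rw [mul_assoc]
  congr 3
  ring

/-! ### The fixed point equation: support and uniqueness -/

theorem SolvesRDE.map_eq {μ : Measure ℝ} (h : SolvesRDE μ) :
    ((volume.restrict (Icc (0 : ℝ) 1)).prod μ).map (fun z : ℝ × ℝ => rdeMap z.1 z.2) = μ := h.2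

/-- A function `f` with `f (√U x + √U (1 - √U)) ≤ √U f x` satisfies `P(f X > t) ≤ P(f X > 2 t)` for
`t > 0`, as `√U ≤ 1 / 2` with positive probability. -/
theorem SolvesRDE.ae_nonpos {μ : Measure ℝ} (h : SolvesRDE μ) {f : ℝ → ℝ} (hf : Measurable f)
    (hfU : ∀ U ∈ Icc (0 : ℝ) 1, ∀ x, f (rdeMap U x) ≤ √U * f x) : ∀ᵐ x ∂μ, f x ≤ 0 := by
  have hP := h.1
  have hmeas : ∀ t, MeasurableSet {x | t < f x} := fun t => measurableSet_lt measurable_const hf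
  have key : ∀ t : ℝ, 0 < t → μ.real {x | t < f x} ≤ μ.real {x | 2 * t < f x} := by
    intro t ht
    have hsub : (fun z : ℝ × ℝ => rdeMap z.1 z.2) ⁻¹' {x | t < f x} ⊆
        Iic (1 / 4) ×ˢ {x | 2 * t < f x} ∪ Ioi (1 / 4) ×ˢ {x | t < f x} ∪
          (Icc (0 : ℝ) 1)ᶜ ×ˢ univ := by
      rintro ⟨U, x⟩ hz
      simp only [mem_preimage, mem_ofPred_eq] at hz
      by_cases hU : U ∈ Icc (0 : ℝ) 1
      · left
        have h1 := hz.trans_le (hfU U hU x)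
        have h2 := Real.sqrt_nonneg U
        have h3 : 0 < f x := by
          by_contra hle
          push Not at hle
          nlinarith
        rcases le_or_gt U (1 / 4) with h4 | h4
        · left
          refine ⟨h4, ?_⟩
          have h5 : √U ≤ 1 / 2 := by
            rw [Real.sqrt_le_left (by norm_num)]; norm_num; linarith
          rw [mem_ofPred_eq]
          nlinarith
        · right
          refine ⟨h4, ?_⟩
          have h5 : √U ≤ 1 := Real.sqrt_le_one.2 hU.2
          rw [mem_ofPred_eq]
          nlinarith
      · exact Or.inr ⟨hU, mem_univ _⟩
    have h1 : μ {x | t < f x} ≤ ENNReal.ofReal (1 / 4) * μ {x | 2 * t < f x} +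
        ENNReal.ofReal (3 / 4) * μ {x | t < f x} := by
      conv_lhs => rw [← h.map_eq, Measure.map_apply measurable_rdeMap (hmeas t)]
      refine (measure_mono hsub).trans ((measure_union_le _ _).trans ?_)
      rw [Measure.prod_prod ((Icc (0 : ℝ) 1)ᶜ), Measure.restrict_apply measurableSet_Icc.compl,
        compl_inter_self, measure_empty, zero_mul, add_zero]
      refine (measure_union_le _ _).trans (le_of_eq ?_)
      rw [Measure.prod_prod, Measure.prod_prod, Measure.restrict_apply measurableSet_Iic,
        Measure.restrict_apply measurableSet_Ioi]
      have e1 : Iic (1 / 4 : ℝ) ∩ Icc 0 1 = Icc 0 (1 / 4) := by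
        ext u; simp only [mem_inter_iff, mem_Iic, mem_Icc]
        exact ⟨fun h => ⟨h.2.1, h.1⟩, fun h => ⟨h.2, h.1, by linarith [h.2]⟩⟩
      have e2 : Ioi (1 / 4 : ℝ) ∩ Icc 0 1 = Ioc (1 / 4) 1 := by
        ext u; simp only [mem_inter_iff, mem_Ioi, mem_Icc, mem_Ioc]
        exact ⟨fun h => ⟨h.1, h.2.2⟩, fun h => ⟨h.1, by linarith [h.1], h.2⟩⟩
      rw [e1, e2, Real.volume_Icc, Real.volume_Ioc]
      norm_num
    have h2 := ENNReal.toReal_mono (by finiteness) h1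
    rw [ENNReal.toReal_add (by finiteness) (by finiteness), ENNReal.toReal_mul, ENNReal.toReal_mul,
      ENNReal.toReal_ofReal (by norm_num), ENNReal.toReal_ofReal (by norm_num)] at h2
    simp only [measureReal_def]
    linarith
  have hzero : ∀ t : ℝ, 0 < t → μ {x | t < f x} = 0 := by
    intro t ht
    have hpow : ∀ k : ℕ, μ.real {x | t < f x} ≤ μ.real {x | 2 ^ k * t < f x} := fun k => by
      induction k with
      | zero => simp
      | succ k ih =>
        refine ih.trans ((key _ (by positivity)).trans (le_of_eq ?_))
        rw [pow_succ]; ring_nf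
    have hlim := tendsto_measure_iInter_atTop (μ := μ) (s := fun k : ℕ => {x | 2 ^ k * t < f x})
      (fun k => (hmeas _).nullMeasurableSet) (fun k l hkl x hx => by
        rw [mem_ofPred_eq] at hx ⊢
        have : (2 : ℝ) ^ k ≤ 2 ^ l := pow_le_pow_right₀ (by norm_num) hkl
        nlinarith) ⟨0, by finiteness⟩
    have hempty : (⋂ k : ℕ, {x | 2 ^ k * t < f x}) = ∅ := by
      rw [eq_empty_iff_forall_notMem]
      intro x hx
      obtain ⟨k, hk⟩ := pow_unbounded_of_one_lt (f x / t) (by norm_num : (1 : ℝ) < 2)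
      have h1 := mem_iInter.1 hx k
      rw [div_lt_iff₀ ht] at hk
      rw [mem_ofPred_eq] at h1
      linarith
    rw [hempty, measure_empty] at hlim
    have hle : μ {x | t < f x} ≤ 0 := ge_of_tendsto' hlim fun k =>
      (ENNReal.toReal_le_toReal (measure_ne_top μ _) (measure_ne_top μ _)).1 (hpow k)
    exact le_antisymm hle bot_le
  have hset : {x | ¬ f x ≤ 0} ⊆ ⋃ k : ℕ, {x | 1 / ((k : ℝ) + 1) < f x} := fun x hx => by
    obtain ⟨k, hk⟩ := exists_nat_one_div_lt (not_le.1 hx)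
    exact mem_iUnion.2 ⟨k, hk⟩
  exact measure_mono_null hset (measure_iUnion_null fun k => hzero _ (by positivity))

theorem SolvesRDE.ae_mem_Icc {μ : Measure ℝ} (h : SolvesRDE μ) : ∀ᵐ x ∂μ, x ∈ Icc (0 : ℝ) 1 := by
  have h1 := h.ae_nonpos (f := fun x => -x) measurable_neg fun U hU x => by
    have h1 := Real.sqrt_nonneg U
    have h2 : √U ≤ 1 := Real.sqrt_le_one.2 hU.2
    unfold rdeMap
    nlinarith
  have h2 := h.ae_nonpos (f := fun x => x - 1) (measurable_id.sub_const 1) fun U hU x => by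
    unfold rdeMap
    nlinarith [sq_nonneg (1 - √U)]
  filter_upwards [h1, h2] with x hx1 hx2
  exact ⟨by linarith, by linarith⟩

theorem SolvesRDE.charFun_eq {μ : Measure ℝ} (h : SolvesRDE μ) (t : ℝ) :
    charFun μ t = ∫ U in (0 : ℝ)..1,
      Complex.exp (t * (√U * (1 - √U) : ℝ) * Complex.I) * charFun μ (t * √U) := by
  have hP := h.1
  have hc : Continuous fun x : ℝ => Complex.exp (t * x * Complex.I) := by fun_prop
  conv_lhs => rw [charFun_apply_real, ← h.map_eq]
  rw [integral_map measurable_rdeMap.aemeasurable hc.aestronglyMeasurable, integral_prod,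
    intervalIntegral.integral_of_le zero_le_one, ← integral_Icc_eq_integral_Ioc]
  · refine integral_congr_ae (ae_of_all _ fun U => ?_)
    simp only
    rw [charFun_apply_real, ← integral_const_mul]
    refine integral_congr_ae (ae_of_all _ fun x => ?_)
    simp only
    rw [← Complex.exp_add]
    unfold rdeMap
    push_cast
    congr 1
    ring
  · refine Integrable.of_bound (hc.measurable.comp measurable_rdeMap).aestronglyMeasurable 1
      (ae_of_all _ fun z => ?_)
    have : ((t : ℂ) * (rdeMap z.1 z.2 : ℝ) * Complex.I) =
        ((t * rdeMap z.1 z.2 : ℝ) : ℂ) * Complex.I := by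
      push_cast; ring
    rw [this, Complex.norm_exp_ofReal_mul_I]

/-- The difference `Δ` of two characteristic functions satisfies `|Δ(t)| ≤ E |Δ(t √U)|`. At a point
`t` where `|Δ|` is maximal over `[-a, a]`, this inequality forces `|Δ(t √U)|` to be constant. -/
theorem SolvesRDE.unique {μ ν : Measure ℝ} (hμ : SolvesRDE μ) (hν : SolvesRDE ν) : μ = ν := by
  have hPμ := hμ.1
  have hPν := hν.1
  refine Measure.ext_of_charFun (funext fun a => ?_)
  set D : ℝ → ℝ := fun t => ‖charFun μ t - charFun ν t‖ with hD
  have hDc : Continuous D := (continuous_charFun.sub continuous_charFun).norm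
  obtain ⟨t, ht, hmax⟩ := (isCompact_Icc (a := -|a|) (b := |a|)).exists_isMaxOn
    ⟨0, by simp⟩ hDc.continuousOn
  have hcont : ∀ (ρ : Measure ℝ) [IsProbabilityMeasure ρ], Continuous fun U : ℝ =>
      Complex.exp (t * (√U * (1 - √U) : ℝ) * Complex.I) * charFun ρ (t * √U) := fun ρ _ =>
    Continuous.mul (by fun_prop) (continuous_charFun.comp (by fun_prop))
  have hle : D t ≤ ∫ U in (0 : ℝ)..1, D (t * √U) := by
    simp only [hD]
    rw [hμ.charFun_eq, hν.charFun_eq, ← intervalIntegral.integral_sub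
      ((hcont μ).intervalIntegrable _ _) ((hcont ν).intervalIntegrable _ _)]
    refine (intervalIntegral.norm_integral_le_integral_norm zero_le_one).trans (le_of_eq ?_)
    refine intervalIntegral.integral_congr fun U _ => ?_
    rw [← mul_sub, norm_mul]
    have : ((t : ℂ) * (√U * (1 - √U) : ℝ) * Complex.I) =
        ((t * (√U * (1 - √U)) : ℝ) : ℂ) * Complex.I := by
      push_cast; ring
    rw [this, Complex.norm_exp_ofReal_mul_I, one_mul]
  have hDt : ∀ U ∈ Icc (0 : ℝ) 1, D (t * √U) ≤ D t := fun U hU => by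
    refine hmax (abs_le.1 ?_)
    rw [abs_mul, abs_of_nonneg (Real.sqrt_nonneg U)]
    exact (mul_le_of_le_one_right (abs_nonneg t) (Real.sqrt_le_one.2 hU.2)).trans (abs_le.2 ht)
  have hzero : D t ≤ 0 := by
    by_contra hpos
    push Not at hpos
    have hc : Continuous fun U : ℝ => D t - D (t * √U) :=
      continuous_const.sub (hDc.comp (by fun_prop))
    have h1 := intervalIntegral.integral_pos zero_lt_one hc.continuousOn
      (fun U hU => sub_nonneg.2 (hDt U ⟨hU.1.le, hU.2⟩)) ⟨0, by simp, by
        simpa [hD] using hpos⟩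
    have hc' : Continuous fun U : ℝ => D (t * √U) := hDc.comp (by fun_prop)
    rw [intervalIntegral.integral_sub (continuous_const.intervalIntegrable _ _)
      (hc'.intervalIntegrable _ _), intervalIntegral.integral_const, sub_zero, one_smul] at h1
    linarith
  have ha : D a ≤ D t := hmax (abs_le.1 le_rfl)
  have : D a = 0 := le_antisymm (ha.trans hzero) (norm_nonneg _)
  exact sub_eq_zero.1 (norm_eq_zero.1 this)

/-! ### The fixed point equation: existence -/

/-- The term `√u₀ ⋯ √uₖ₋₁ · √uₖ (1 - √uₖ)` of the series that iterates the fixed point equation. -/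
noncomputable def perpetuityTerm (u : ℕ → unitInterval) (k : ℕ) : ℝ :=
  (∏ i ∈ Finset.range k, √(u i : ℝ)) * (√(u k : ℝ) * (1 - √(u k : ℝ)))

/-- A random variable that solves the fixed point equation, as a function of a sequence of
independent uniform random variables. -/
noncomputable def perpetuity (u : ℕ → unitInterval) : ℝ := ∑' k, perpetuityTerm u k

theorem perpetuityTerm_nonneg (u : ℕ → unitInterval) (k : ℕ) : 0 ≤ perpetuityTerm u k := by
  have h : √(u k : ℝ) ≤ 1 := Real.sqrt_le_one.2 (u k).2.2
  exact mul_nonneg (Finset.prod_nonneg fun i _ => Real.sqrt_nonneg _)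
    (mul_nonneg (Real.sqrt_nonneg _) (by linarith))

theorem sum_perpetuityTerm_le (u : ℕ → unitInterval) (n : ℕ) :
    ∑ k ∈ Finset.range n, perpetuityTerm u k + ∏ i ∈ Finset.range n, √(u i : ℝ) ≤ 1 := by
  induction n with
  | zero => simp
  | succ n ih =>
    have h : 0 ≤ ∏ i ∈ Finset.range n, √(u i : ℝ) :=
      Finset.prod_nonneg fun i _ => Real.sqrt_nonneg _
    rw [Finset.sum_range_succ, Finset.prod_range_succ, perpetuityTerm]
    nlinarith [mul_nonneg h (sq_nonneg (1 - √(u n : ℝ)))]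

theorem summable_perpetuityTerm (u : ℕ → unitInterval) : Summable (perpetuityTerm u) :=
  summable_of_sum_range_le (c := 1) (perpetuityTerm_nonneg u) fun n => by
    have := sum_perpetuityTerm_le u n
    have h : 0 ≤ ∏ i ∈ Finset.range n, √(u i : ℝ) :=
      Finset.prod_nonneg fun i _ => Real.sqrt_nonneg _
    linarith

theorem perpetuity_eq (u : ℕ → unitInterval) :
    perpetuity u = rdeMap (u 0) (perpetuity fun k => u (k + 1)) := by
  unfold perpetuity
  rw [(summable_perpetuityTerm u).tsum_eq_zero_add]
  have h : ∀ k, perpetuityTerm u (k + 1) = √(u 0 : ℝ) * perpetuityTerm (fun k => u (k + 1)) k :=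
    fun k => by
      unfold perpetuityTerm
      rw [Finset.prod_range_succ']
      ring
  simp only [h]
  rw [tsum_mul_left]
  unfold rdeMap perpetuityTerm
  simp
  ring

theorem measurable_perpetuity : Measurable perpetuity := by
  have h : ∀ k, Measurable fun u => perpetuityTerm u k := fun k => by
    unfold perpetuityTerm
    fun_prop
  exact measurable_of_tendsto_metrizable
    (fun n => Finset.measurable_sum (Finset.range n) fun k _ => h k)
    (tendsto_pi_nhds.2 fun u => by
      have := (summable_perpetuityTerm u).hasSum.tendsto_sum_nat
      simpa [perpetuity] using this)

/-- The law of a sequence of independent uniform random variables. -/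
noncomputable def uniformSequence : Measure (ℕ → unitInterval) :=
  Measure.infinitePi fun _ => volume

instance : IsProbabilityMeasure uniformSequence := by unfold uniformSequence; infer_instance

/-- The sequence `a, u₀, u₁, …`. -/
def consSequence (z : unitInterval × (ℕ → unitInterval)) : ℕ → unitInterval
  | 0 => z.1
  | k + 1 => z.2 k

theorem measurable_consSequence : Measurable consSequence := by
  refine measurable_pi_lambda _ fun k => ?_
  cases k with
  | zero => exact measurable_fst
  | succ k => exact (measurable_pi_apply k).comp measurable_snd

/-- Putting one more uniform random variable in front of a sequence does not change its law. -/
theorem map_consSequence :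
    ((volume : Measure unitInterval).prod uniformSequence).map consSequence = uniformSequence := by
  classical
  refine Measure.eq_infinitePi _ fun s t ht => ?_
  obtain ⟨n, hn⟩ : ∃ n, s ⊆ Finset.range (n + 1) :=
    ⟨s.sup id, fun i hi => Finset.mem_range.2 (Nat.lt_succ_of_le (Finset.le_sup (f := id) hi))⟩
  set t' : ℕ → Set unitInterval := fun i => if i ∈ s then t i else univ with ht'
  have hmt : ∀ i, MeasurableSet (t' i) := fun i => by
    simp only [ht']; split_ifs
    exacts [ht i, MeasurableSet.univ]
  have hpre : consSequence ⁻¹' (Set.pi s t) =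
      t' 0 ×ˢ Set.pi (Finset.range n) (fun i => t' (i + 1)) := by
    ext z
    simp only [mem_preimage, Set.mem_pi, Finset.mem_coe, mem_prod, Finset.mem_range, ht']
    constructor
    · intro h
      refine ⟨?_, fun i _ => ?_⟩
      · split_ifs with h0
        exacts [h 0 h0, mem_univ _]
      · split_ifs with h0
        exacts [h (i + 1) h0, mem_univ _]
    · rintro ⟨h0, h1⟩ i hi
      cases i with
      | zero => rw [if_pos hi] at h0; exact h0
      | succ i =>
        have := h1 i (by have := Finset.mem_range.1 (hn hi); omega)
        rw [if_pos hi] at this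
        exact this
  have hprod : ∏ i ∈ s, (volume : Measure unitInterval) (t i) =
      ∏ i ∈ Finset.range (n + 1), (volume : Measure unitInterval) (t' i) := by
    refine Finset.prod_subset_one_on_sdiff hn (fun i hi => ?_) fun i hi => ?_
    · rw [Finset.mem_sdiff] at hi
      simp [ht', hi.2]
    · simp [ht', hi]
  rw [Measure.map_apply measurable_consSequence
    (MeasurableSet.pi s.countable_toSet fun i _ => ht i), hpre, Measure.prod_prod, uniformSequence,
    Measure.infinitePi_pi _ fun i _ => hmt (i + 1), hprod, Finset.prod_range_succ', mul_comm]

theorem exists_solvesRDE : ∃ μ : Measure ℝ, SolvesRDE μ := by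
  refine ⟨uniformSequence.map perpetuity,
    Measure.isProbabilityMeasure_map measurable_perpetuity.aemeasurable, ?_⟩
  change Measure.map (fun z : ℝ × ℝ => rdeMap z.1 z.2) _ = _
  rw [← unitInterval.measurePreserving_coe.map_eq,
    Measure.map_prod_map _ _ measurable_subtype_coe measurable_perpetuity,
    Measure.map_map measurable_rdeMap (measurable_subtype_coe.prodMap measurable_perpetuity)]
  conv_rhs => rw [← map_consSequence]
  rw [Measure.map_map measurable_perpetuity measurable_consSequence]
  congr 1
  ext z
  exact (perpetuity_eq (consSequence z)).symm

/-! ### The fixed point equation: bounded density -/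

/-- The function `(x - w)₊ ^ (-γ)`. -/
noncomputable def subRpowNeg (γ w x : ℝ) : ENNReal :=
  if w < x then ENNReal.ofReal ((x - w) ^ (-γ)) else 0

theorem measurable_subRpowNeg (γ w : ℝ) : Measurable (subRpowNeg γ w) := by
  unfold subRpowNeg
  exact Measurable.ite measurableSet_Ioi
    (((measurable_id.sub_const w).pow_const (-γ)).ennreal_ofReal) measurable_const

/-- Of the `U` in `[0,1]`, a proportion of at most `2 (β - α)` satisfies `α ≤ √U ≤ β`. -/
theorem volume_sqrt_mem_Icc_le (α β : ℝ) :
    (volume.restrict (Icc (0 : ℝ) 1)) {U | α ≤ √U ∧ √U ≤ β} ≤ ENNReal.ofReal (2 * (β - α)) := by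
  have hm : MeasurableSet {U : ℝ | α ≤ √U ∧ √U ≤ β} :=
    measurable_id.sqrt measurableSet_Icc
  rw [Measure.restrict_apply hm]
  have hsub : {U : ℝ | α ≤ √U ∧ √U ≤ β} ∩ Icc 0 1 ⊆
      Icc ((max α 0) ^ 2) ((min β 1) ^ 2) := by
    rintro U ⟨⟨h1, h2⟩, h3⟩
    have h0 := Real.sqrt_nonneg U
    have h4 : max α 0 ≤ √U := max_le h1 h0
    have h5 : √U ≤ min β 1 := le_min h2 (Real.sqrt_le_one.2 h3.2)
    have h6 := Real.sq_sqrt h3.1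
    rw [← h6]
    exact ⟨pow_le_pow_left₀ (le_max_right _ _) h4 2, pow_le_pow_left₀ h0 h5 2⟩
  by_cases hle : max α 0 ≤ min β 1
  · refine (measure_mono hsub).trans ?_
    rw [Real.volume_Icc]
    refine ENNReal.ofReal_le_ofReal ?_
    have h1 := le_max_left α 0
    have h2 := le_max_right α 0
    have h3 := min_le_left β 1
    have h4 := min_le_right β 1
    nlinarith
  · have : {U : ℝ | α ≤ √U ∧ √U ≤ β} ∩ Icc 0 1 = ∅ := by
      rw [eq_empty_iff_forall_notMem]
      rintro U ⟨⟨h1, h2⟩, h3⟩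
      exact hle ((max_le h1 (Real.sqrt_nonneg U)).trans
        (le_min h2 (Real.sqrt_le_one.2 h3.2)))
    rw [this, measure_empty]
    exact bot_le

/-- Interpolation between the bounds `√h` and `h / √c`. -/
theorem sqrt_sub_sqrt_le {c h γ : ℝ} (hc : 0 < c) (hh : 0 < h) (hγ0 : 0 ≤ γ) (hγ : γ ≤ 1 / 2) :
    √c - √(c - h) ≤ h ^ (1 / 2 + γ) * c ^ (-γ) := by
  have hsc : 0 < √c := Real.sqrt_pos.2 hc
  have hcc := Real.mul_self_sqrt hc.le
  have h0 : 0 < √c - √(c - h) := sub_pos.2 (Real.sqrt_lt_sqrt_iff_of_pos hc |>.2 (by linarith))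
  have h1 : √c - √(c - h) ≤ √h := by
    have : √c ≤ √(c - h) + √h := by
      rcases le_or_gt h c with hle | hlt
      · rw [← Real.sqrt_sq (by positivity : 0 ≤ √(c - h) + √h)]
        refine Real.sqrt_le_sqrt ?_
        have e1 := Real.sq_sqrt (sub_nonneg.2 hle)
        have e2 := Real.sq_sqrt hh.le
        nlinarith [Real.sqrt_nonneg (c - h), Real.sqrt_nonneg h]
      · have := Real.sqrt_le_sqrt hlt.le
        linarith [Real.sqrt_nonneg (c - h)]
    linarith
  have h2 : √c - √(c - h) ≤ h / √c := by
    rw [le_div_iff₀ hsc]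
    rcases le_or_gt h c with hle | hlt
    · have e1 := Real.mul_self_sqrt (sub_nonneg.2 hle)
      have e2 : √(c - h) ≤ √c := Real.sqrt_le_sqrt (by linarith)
      nlinarith [Real.sqrt_nonneg (c - h)]
    · have := Real.sqrt_nonneg (c - h)
      nlinarith
  calc √c - √(c - h) = (√c - √(c - h)) ^ (1 - 2 * γ) * (√c - √(c - h)) ^ (2 * γ) := by
        rw [← Real.rpow_add h0]; simp
    _ ≤ (√h) ^ (1 - 2 * γ) * (h / √c) ^ (2 * γ) := by
        gcongr
        linarith
    _ = h ^ (1 / 2 + γ) * c ^ (-γ) := by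
        rw [Real.sqrt_eq_rpow, Real.sqrt_eq_rpow, ← Real.rpow_mul hh.le,
          Real.div_rpow hh.le (by positivity), ← Real.rpow_mul hc.le, Real.rpow_neg hc.le,
          ← mul_div_assoc, ← Real.rpow_add hh, div_eq_mul_inv]
        congr 2
        · ring
        · congr 1; ring

/-- Given `X = x`, the variable `√U x + √U (1 - √U) = c + v - (√U - (1 + x) / 2)²`, where `c = (1
+ x)² / 4 - v`, belongs to `(v, v + h]` only if `√U` belongs to one of two intervals of length `√c
- √(c - h)`; moreover `c ≥ (x - w) / 4` if `w = 2 √v - 1`. -/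
theorem volume_rdeMap_mem_Ioc_le {γ : ℝ} (hγ0 : 0 ≤ γ) (hγ : γ ≤ 1 / 2) {x : ℝ}
    (hx : x ∈ Icc (0 : ℝ) 1) (v : ℝ) {h : ℝ} (hh : 0 < h) :
    (volume.restrict (Icc (0 : ℝ) 1)) {U | rdeMap U x ∈ Ioc v (v + h)} ≤
      ENNReal.ofReal (8 * h ^ (1 / 2 + γ)) * subRpowNeg γ (2 * √v - 1) x := by
  set b := (1 + x) / 2 with hb
  set c := b ^ 2 - v with hc
  have hZ : ∀ U, rdeMap U x = b ^ 2 - (√U - b) ^ 2 := fun U => by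
    unfold rdeMap; rw [hb]; ring
  have hvc : 2 * √v - 1 < x ∨ c ≤ 0 := by
    by_contra hcon
    push Not at hcon
    obtain ⟨h1, h2⟩ := hcon
    have h3 : b ≤ √v := by rw [hb]; linarith
    have h4 : 0 < √v := by rw [hb] at h3; linarith [hx.1]
    have h5 := Real.sq_sqrt (Real.sqrt_pos.1 h4).le
    have : 0 < b := by rw [hb]; linarith [hx.1]
    nlinarith
  rcases le_or_gt c 0 with hc0 | hc0
  · have : {U | rdeMap U x ∈ Ioc v (v + h)} = ∅ := by
      rw [eq_empty_iff_forall_notMem]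
      intro U hU
      have h1 : v < rdeMap U x := hU.1
      rw [hZ] at h1
      nlinarith [sq_nonneg (√U - b)]
    rw [this, measure_empty]
    exact bot_le
  · have hw : 2 * √v - 1 < x := hvc.resolve_right (not_le.2 hc0)
    have hc1 : (x - (2 * √v - 1)) / 4 ≤ c := by
      -- for negative `v` the convention `√v = 0` is used
      have h1 : v ≤ √v ^ 2 := by
        rcases le_or_gt 0 v with h0 | h0
        · rw [Real.sq_sqrt h0]
        · nlinarith [sq_nonneg √v]
      have h2 := Real.sqrt_nonneg v
      have h3 : √v < b := by rw [hb]; linarith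
      have h4 : 1 / 2 ≤ b := by rw [hb]; linarith [hx.1]
      have h5 : (x - (2 * √v - 1)) / 4 = (b - √v) / 2 := by rw [hb]; ring
      rw [h5]
      nlinarith
    have hl0 : √(c - h) ≤ √c := Real.sqrt_le_sqrt (by linarith)
    have hsub : {U | rdeMap U x ∈ Ioc v (v + h)} ⊆
        {U | b - √c ≤ √U ∧ √U ≤ b - √(c - h)} ∪ {U | b + √(c - h) ≤ √U ∧ √U ≤ b + √c} := by
      intro U hU
      have h1 : v < rdeMap U x := hU.1
      have h2 : rdeMap U x ≤ v + h := hU.2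
      rw [hZ] at h1 h2
      have h3 : |√U - b| ≤ √c := Real.abs_le_sqrt (by linarith)
      have h4 : √(c - h) ≤ |√U - b| := by
        rw [← Real.sqrt_sq_eq_abs]; exact Real.sqrt_le_sqrt (by linarith)
      rcases abs_cases (√U - b) with ⟨h5, -⟩ | ⟨h5, -⟩
      · right; constructor <;> linarith
      · left; constructor <;> linarith
    refine (measure_mono hsub).trans ((measure_union_le _ _).trans ?_)
    refine (add_le_add (volume_sqrt_mem_Icc_le _ _) (volume_sqrt_mem_Icc_le _ _)).trans ?_
    unfold subRpowNeg
    rw [if_pos hw, ← ENNReal.ofReal_add (by linarith) (by linarith),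
      ← ENNReal.ofReal_mul (by positivity)]
    refine ENNReal.ofReal_le_ofReal ?_
    have h1 := sqrt_sub_sqrt_le hc0 hh hγ0 hγ
    have hd : 0 < x - (2 * √v - 1) := by linarith
    have h2 : c ^ (-γ) ≤ 2 * (x - (2 * √v - 1)) ^ (-γ) := by
      calc c ^ (-γ) ≤ ((x - (2 * √v - 1)) / 4) ^ (-γ) :=
            Real.rpow_le_rpow_of_nonpos (by positivity) hc1 (by linarith)
        _ = 4 ^ γ * (x - (2 * √v - 1)) ^ (-γ) := by
            rw [Real.div_rpow hd.le (by norm_num), Real.rpow_neg (by norm_num : (0 : ℝ) ≤ 4)]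
            field_simp
        _ ≤ 2 * (x - (2 * √v - 1)) ^ (-γ) := by
            refine mul_le_mul_of_nonneg_right ?_ (Real.rpow_nonneg hd.le _)
            calc (4 : ℝ) ^ γ ≤ 4 ^ (1 / 2 : ℝ) :=
                  Real.rpow_le_rpow_of_exponent_le (by norm_num) hγ
              _ = 2 := by
                  rw [← Real.sqrt_eq_rpow, show (4 : ℝ) = 2 ^ 2 by norm_num,
                    Real.sqrt_sq (by norm_num)]
    have h3 := mul_le_mul_of_nonneg_left h2 (by positivity : 0 ≤ h ^ (1 / 2 + γ))
    linarith

/-- A bound for the moments of order `-γ` improves to a bound of order `1 / 2 + γ` for the masses of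
intervals. -/
theorem SolvesRDE.measure_Ioc_le {μ : Measure ℝ} (hμ : SolvesRDE μ) {γ : ℝ} (hγ0 : 0 ≤ γ)
    (hγ : γ ≤ 1 / 2) {K : ENNReal} (hK : ∀ w, ∫⁻ x, subRpowNeg γ w x ∂μ ≤ K) (v : ℝ) {h : ℝ}
    (hh : 0 < h) : μ (Ioc v (v + h)) ≤ ENNReal.ofReal (8 * h ^ (1 / 2 + γ)) * K := by
  have hP := hμ.1
  conv_lhs => rw [← hμ.map_eq, Measure.map_apply measurable_rdeMap measurableSet_Ioc,
    Measure.prod_apply_symm (measurable_rdeMap measurableSet_Ioc)]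
  calc _ ≤ ∫⁻ x, ENNReal.ofReal (8 * h ^ (1 / 2 + γ)) * subRpowNeg γ (2 * √v - 1) x ∂μ := by
        refine lintegral_mono_ae ?_
        filter_upwards [hμ.ae_mem_Icc] with x hx
        exact volume_rdeMap_mem_Ioc_le hγ0 hγ hx v hh
    _ ≤ _ := by
        rw [lintegral_const_mul _ (measurable_subRpowNeg _ _)]
        gcongr
        exact hK _

/-- Conversely, a bound of order `β` for the masses of intervals implies a bound for the moments of
every order `-γ` with `γ < β`, by a dyadic decomposition. -/
theorem lintegral_subRpowNeg_le {μ : Measure ℝ} [IsProbabilityMeasure μ] {β γ : ℝ} (hγ0 : 0 ≤ γ)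
    (hγβ : γ < β) {K : ENNReal} (hK : K ≠ ⊤)
    (h : ∀ (v : ℝ) {h : ℝ}, 0 < h → μ (Ioc v (v + h)) ≤ ENNReal.ofReal (8 * h ^ β) * K) :
    ∃ K' : ENNReal, K' ≠ ⊤ ∧ ∀ w, ∫⁻ x, subRpowNeg γ w x ∂μ ≤ K' := by
  set q : ℝ := 2 ^ (γ - β) with hq
  have hq0 : 0 < q := by positivity
  have hq1 : q < 1 := Real.rpow_lt_one_of_one_lt_of_neg (by norm_num) (by linarith)
  refine ⟨1 + ∑' k : ℕ, ENNReal.ofReal (8 * 2 ^ γ) * K * ENNReal.ofReal q ^ k, ?_, fun w => ?_⟩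
  · rw [ENNReal.tsum_mul_left, ENNReal.tsum_geometric]
    have h1 : (1 - ENNReal.ofReal q)⁻¹ ≠ ⊤ := by
      rw [ENNReal.inv_ne_top]
      exact (tsub_pos_of_lt (by rw [← ENNReal.ofReal_one]; exact
        (ENNReal.ofReal_lt_ofReal_iff one_pos).2 hq1)).ne'
    finiteness
  · have hpt : ∀ x, subRpowNeg γ w x ≤ 1 + ∑' k : ℕ,
        (Ioc w (w + (1 / 2) ^ k)).indicator
          (fun _ => ENNReal.ofReal ((2 : ℝ) ^ γ * (2 ^ γ) ^ k)) x := by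
      intro x
      unfold subRpowNeg
      split_ifs with hwx
      · rcases le_or_gt (x - w) 1 with h1 | h1
        · obtain ⟨k, hk1, hk2⟩ := exists_nat_pow_near_of_lt_one (sub_pos.2 hwx) h1
            (by norm_num : (0 : ℝ) < 1 / 2) (by norm_num)
          refine le_trans ?_ (le_add_left (ENNReal.le_tsum k))
          rw [indicator_of_mem (by exact ⟨hwx, by linarith⟩)]
          refine ENNReal.ofReal_le_ofReal ?_
          calc (x - w) ^ (-γ) ≤ ((1 / 2 : ℝ) ^ (k + 1)) ^ (-γ) :=
                Real.rpow_le_rpow_of_nonpos (by positivity) hk1.le (by linarith)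
            _ = (2 : ℝ) ^ γ * (2 ^ γ) ^ k := by
                rw [← Real.rpow_natCast, ← Real.rpow_natCast, ← Real.rpow_mul (by norm_num),
                  ← Real.rpow_mul (by norm_num), ← Real.rpow_add (by norm_num), one_div,
                  Real.inv_rpow (by norm_num), ← Real.rpow_neg (by norm_num)]
                congr 1
                push_cast
                ring
        · refine le_trans ?_ le_self_add
          rw [← ENNReal.ofReal_one]
          refine ENNReal.ofReal_le_ofReal ?_
          exact Real.rpow_le_one_of_one_le_of_nonpos h1.le (by linarith)
      · exact bot_le
    refine (lintegral_mono hpt).trans ?_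
    rw [lintegral_add_left measurable_const, lintegral_tsum fun k =>
      (measurable_const.indicator measurableSet_Ioc).aemeasurable]
    simp only [lintegral_const, measure_univ, one_mul]
    gcongr with k
    rw [lintegral_indicator measurableSet_Ioc, setLIntegral_const]
    refine (mul_le_mul_right (h w (by positivity)) _).trans (le_of_eq ?_)
    rw [← mul_assoc, ← ENNReal.ofReal_mul (by positivity), ← ENNReal.ofReal_pow hq0.le,
      mul_right_comm (ENNReal.ofReal _) K, ← ENNReal.ofReal_mul (by positivity)]
    congr 2
    have : ((1 / 2 : ℝ) ^ k) ^ β * (2 ^ γ) ^ k = q ^ k := by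
      rw [hq, ← Real.rpow_natCast, ← Real.rpow_natCast, ← Real.rpow_natCast,
        ← Real.rpow_mul (by norm_num), ← Real.rpow_mul (by norm_num), ← Real.rpow_mul (by norm_num),
        one_div, Real.inv_rpow (by norm_num), ← Real.rpow_neg (by norm_num),
        ← Real.rpow_add (by norm_num)]
      congr 1
      ring
    rw [← this]
    ring

/-- The masses of intervals are of the order of their lengths: the exponent is raised from `0` in
three rounds to `1 / 2`, `5 / 6` and `1`. -/
theorem SolvesRDE.exists_measure_Ioc_le {μ : Measure ℝ} (hμ : SolvesRDE μ) :
    ∃ K : ENNReal, K ≠ ⊤ ∧ ∀ (v : ℝ) {h : ℝ}, 0 < h →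
      μ (Ioc v (v + h)) ≤ ENNReal.ofReal h * K := by
  have hP := hμ.1
  have h0 : ∀ w, ∫⁻ x, subRpowNeg 0 w x ∂μ ≤ 1 := fun w => by
    refine (lintegral_mono (g := fun _ => 1) fun x => ?_).trans (by simp)
    unfold subRpowNeg
    split_ifs <;> simp
  have h1 := hμ.measure_Ioc_le le_rfl (by norm_num) h0
  obtain ⟨K1, hK1, h2⟩ := lintegral_subRpowNeg_le (γ := 1 / 3) (by norm_num) (by norm_num)
    ENNReal.one_ne_top @h1
  have h3 := hμ.measure_Ioc_le (by norm_num) (by norm_num) h2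
  obtain ⟨K2, hK2, h4⟩ := lintegral_subRpowNeg_le (γ := 1 / 2) (by norm_num) (by norm_num) hK1 @h3
  refine ⟨8 * K2, by finiteness, fun v h hh => ?_⟩
  refine (hμ.measure_Ioc_le (by norm_num) le_rfl h4 v hh).trans (le_of_eq ?_)
  norm_num
  ring

/-- A measure that is bounded by the length on intervals is bounded by Lebesgue measure, as the
latter is the largest such (outer) measure. -/
theorem le_volume_of_Ioc_le {ν : Measure ℝ}
    (h : ∀ a b : ℝ, a < b → ν (Ioc a b) ≤ ENNReal.ofReal (b - a)) : ν ≤ volume := by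
  rw [Measure.le_iff']
  intro s
  have h1 : ν.toOuterMeasure ≤ StieltjesFunction.id.outer := by
    refine OuterMeasure.le_ofFunction.2 fun s => ?_
    rw [StieltjesFunction.length_eq]
    refine le_iInf fun a => le_iInf fun b => le_iInf fun hs => ?_
    rw [show (botSet : Set ℝ) = ∅ by simp [botSet], sdiff_empty] at hs
    refine (measure_mono hs).trans ?_
    rcases lt_or_ge a b with hab | hab
    · exact h a b hab
    · rw [Ioc_eq_empty (not_lt.2 hab), measure_empty]; exact bot_le
  rw [Real.volume_eq_stieltjes_id]
  rw [StieltjesFunction.measure]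
  exact h1 s

theorem SolvesRDE.exists_le_smul_volume {μ : Measure ℝ} (hμ : SolvesRDE μ) :
    ∃ K : NNReal, μ ≤ K • volume := by
  obtain ⟨K, hK, h⟩ := hμ.exists_measure_Ioc_le
  lift K to NNReal using hK
  have hK0 : K + 1 ≠ 0 := by positivity
  refine ⟨K + 1, ?_⟩
  have h1 : (K + 1)⁻¹ • μ ≤ volume := le_volume_of_Ioc_le fun a b hab => by
    have h2 := h a (sub_pos.2 hab)
    rw [add_sub_cancel] at h2
    rw [Measure.smul_apply, ENNReal.smul_def, smul_eq_mul, mul_comm, ENNReal.coe_inv hK0,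
      ← div_eq_mul_inv]
    refine ENNReal.div_le_of_le_mul (h2.trans ?_)
    gcongr
    exact_mod_cast le_self_add
  calc μ = (K + 1) • ((K + 1)⁻¹ • μ) := by rw [smul_smul, mul_inv_cancel₀ hK0, one_smul]
    _ ≤ (K + 1) • volume := by
      rw [Measure.le_iff'] at h1 ⊢
      intro s
      rw [Measure.smul_apply, Measure.smul_apply]
      exact smul_le_smul_of_nonneg_left (h1 s) bot_le

theorem SolvesRDE.exists_density {μ : Measure ℝ} (hμ : SolvesRDE μ) :
    ∃ f : ℝ → ℝ, IsLebesgueDensity μ f := by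
  have hP := hμ.1
  obtain ⟨K, hK⟩ := hμ.exists_le_smul_volume
  have hac : μ ≪ volume := (Measure.absolutelyContinuous_of_le hK).trans
    (Measure.smul_absolutelyContinuous)
  refine ⟨fun x => (μ.rnDeriv volume x).toReal, (Measure.measurable_rnDeriv _ _).ennreal_toReal,
    fun x => ENNReal.toReal_nonneg, ?_⟩
  conv_lhs => rw [← Measure.withDensity_rnDeriv_eq μ volume hac]
  refine withDensity_congr_ae ?_
  filter_upwards [μ.rnDeriv_lt_top volume] with x hx
  rw [ENNReal.ofReal_toReal hx.ne]

theorem SolvesRDE.eLpNorm_density_lt_top {μ : Measure ℝ} (hμ : SolvesRDE μ) {f : ℝ → ℝ}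
    (hf : IsLebesgueDensity μ f) : eLpNorm f ⊤ volume < ⊤ := by
  obtain ⟨K, hK⟩ := hμ.exists_le_smul_volume
  have h1 : (fun x => ENNReal.ofReal (f x)) ≤ᵐ[volume] fun _ => (K : ENNReal) := by
    refine ae_le_of_forall_setLIntegral_le_of_sigmaFinite hf.1.ennreal_ofReal fun s hs _ => ?_
    rw [← withDensity_apply _ hs, ← hf.2.2, setLIntegral_const]
    simpa using hK s
  rw [eLpNorm_exponent_top]
  refine (eLpNormEssSup_le_of_ae_bound (C := K) ?_).trans_lt ENNReal.ofReal_lt_top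
  filter_upwards [h1] with x hx
  rw [Real.norm_of_nonneg (hf.2.1 x)]
  rw [← ENNReal.ofReal_coe_nnreal] at hx
  exact (ENNReal.ofReal_le_ofReal_iff K.2).1 hx

theorem IsLebesgueDensity.measureReal_Ioc_le {μ : Measure ℝ} {f : ℝ → ℝ}
    (hf : IsLebesgueDensity μ f) (htop : eLpNorm f ⊤ volume < ⊤) {a b : ℝ} (hab : a ≤ b) :
    μ.real (Ioc a b) ≤ (eLpNorm f ⊤ volume).toReal * (b - a) := by
  have h1 : μ (Ioc a b) ≤ eLpNorm f ⊤ volume * ENNReal.ofReal (b - a) := by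
    rw [hf.2.2, withDensity_apply _ measurableSet_Ioc, ← Real.volume_Ioc, ← setLIntegral_const]
    refine lintegral_mono_ae (ae_restrict_of_ae ?_)
    rw [eLpNorm_exponent_top]
    filter_upwards [enorm_ae_le_eLpNormEssSup f volume] with x hx
    rwa [Real.enorm_of_nonneg (hf.2.1 x)] at hx
  have h2 := ENNReal.toReal_mono (by finiteness) h1
  rwa [ENNReal.toReal_mul, ENNReal.toReal_ofReal (sub_nonneg.2 hab)] at h2

/-- The law lives on the unit interval, so its density has supremum at least `1`. -/
theorem SolvesRDE.one_le_of_measure_Ioc_le {μ : Measure ℝ} (hμ : SolvesRDE μ) {M : ℝ}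
    (hM : ∀ a b : ℝ, a ≤ b → μ.real (Ioc a b) ≤ M * (b - a)) : 1 ≤ M := by
  have hP := hμ.1
  have h1 : ∀ η : ℝ, 0 < η → 1 ≤ M * (1 + η) := fun η hη => by
    have h2 : μ (Ioc (-η) 1) = 1 := by
      rw [← prob_compl_eq_zero_iff measurableSet_Ioc, ← mem_ae_iff]
      filter_upwards [hμ.ae_mem_Icc] with x hx using ⟨by linarith [hx.1], hx.2⟩
    have h3 := hM (-η) 1 (by linarith)
    rw [measureReal_def, h2, ENNReal.toReal_one] at h3
    linarith
  by_contra hlt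
  push Not at hlt
  have := h1 (1 - M) (by linarith)
  nlinarith [sq_pos_of_pos (sub_pos.2 hlt)]

theorem mainTheorem3 :
    (∃! μ : Measure ℝ, SolvesRDE μ) ∧
    ∀ μ : Measure ℝ, SolvesRDE μ →
      (∃ f : ℝ → ℝ, IsLebesgueDensity μ f) ∧
      ∀ f : ℝ → ℝ, IsLebesgueDensity μ f →
        eLpNorm f ⊤ volume < ⊤ ∧
        ∀ ε : ℝ, 0 < ε → ε ≤ 1 / 4 → ∀ (n : ℕ) [NeZero n],
          dKS (normalizedLaw n) μ ≤
            omegaConst (eLpNorm f ⊤ volume).toReal ε * (n : ℝ) ^ (-(1 / 2 : ℝ) + ε) := by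
  refine ⟨?_, fun μ hμ => ⟨hμ.exists_density, fun f hf => ⟨hμ.eLpNorm_density_lt_top hf, ?_⟩⟩⟩
  · obtain ⟨μ, hμ⟩ := exists_solvesRDE
    exact ⟨μ, hμ, fun ν hν => hν.unique hμ⟩
  · intro ε hε hε4 n _
    have hP := hμ.1
    have hM := fun a b (hab : a ≤ b) => hf.measureReal_Ioc_le (hμ.eLpNorm_density_lt_top hf) hab
    have hp : 1 ≤ -1 + 1 / (2 * ε) := by
      have : 2 ≤ 1 / (2 * ε) := by rw [le_div_iff₀ (by linarith)]; linarith
      linarith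
    rw [omegaConst_mul_rpow ENNReal.toReal_nonneg hε hε4 (NeZero.pos n)]
    exact le_rate_of_tail_bound hp (hμ.one_le_of_measure_Ioc_le hM) (NeZero.pos n) (dKS_le_one _ _)
      fun t ht htn => dKS_le_add_exp hμ hμ.ae_mem_Icc hM n ht htn
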